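/- Theorem 5.2. Let $d\geqslant 1$ and let $\mathcal H\colon[0,\infty)\to\mathbb C^{d\times d}$ be measurable and bounded, with $\mathcal H(\xi)$ Hermitian for almost every $\xi$, such that for every bounded $K\subseteq[0,\infty)$ there are $m,M>0$ such that for all $\zeta\in\mathbb C^d$ the bounds $m|\zeta|^2\leqslant\zeta^\star\mathcal H(\cdot)\zeta\leqslant M|\zeta|^2$ hold almost everywhere on $K$. Let $L^2_{\mathcal H}=L^2_{\mathcal H}(0,\infty)$ be the space of (classes of) measurable $x\colon(0,\infty)\to\mathbb C^d$ with $\|x\|^2=\int_0^\infty x^\star\mathcal Hx\,\mathrm d\xi<\infty$, with scalar product $\langle x,y\rangle=\int_0^\infty x^\star\mathcal Hy\,\mathrm d\xi$. Let $P_1,P_0\in\mathbb C^{d\times d}$ with $P_1^\star=P_1$ invertible and $P_0^\star=-P_0$. Let $S\in\mathbb C^{d\times d}$ be unitary with $P_1=S^\star\operatorname{diag}(\Lambda,-\Theta)S$, where $\Lambda=\operatorname{diag}(\lambda_1,\dots,\lambda_{n_+})$, $\Theta=\operatorname{diag}(\theta_1,\dots,\theta_{n_-})$, $n_++n_-=d$,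 and all $\lambda_k,\theta_j>0$. Let $\operatorname{pr}_+\colon\mathbb C^d\to\mathbb C^{n_+}$ and $\operatorname{pr}_-\colon\mathbb C^d\to\mathbb C^{n_-}$ be the projections onto the first $n_+$ and the last $n_-$ coordinates, and let $\mathcal G_1=\mathbb C^{n_+}$ with $\langle\cdot,\Lambda\,\cdot\rangle$ and $\mathcal G_2=\mathbb C^{n_-}$ with $\langle\cdot,\Theta\,\cdot\rangle$. Derivatives are distributional derivatives on $(0,\infty)$, and $\mathcal Hx(0)$ is the value at $0$ of the continuous representative of $\mathcal Hx$ on $[0,\infty)$. Let $Q$ be one of the two matrices $I$ and $P_1$ (the theorem holds for each choice), and put $$D(A)=\{x\in L^2_{\mathcal H}\;:\;Q(\mathcal Hx)'\in L^2_{\mathcal H},\ \mathcal Hx(0)=0\}.$$ Let $H\colon D(H)\subseteq L^2_{\mathcal H}\to L^2_{\mathcal H}$ be a linear operator with $D(A)\subseteq D(H)$ and $-Hx=P_1(\mathcal Hx)'+P_0\mathcal Hx$ for all $x\in D(H)$. Then $H$ generates a $C_0$-semigroup of contractions on $L^2_{\mathcal H}$ if and only if there is a contraction $T\colon\mathcal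 G_2\to\mathcal G_1$ (a linear map with $\|Tv\|_{\mathcal G_1}\leqslant\|v\|_{\mathcal G_2}$ for all $v$) such that $$D(H)=\{x\in L^2_{\mathcal H}\;:\;Q(\mathcal Hx)'\in L^2_{\mathcal H},\ T\operatorname{pr}_-(S\mathcal Hx(0))=\operatorname{pr}_+(S\mathcal Hx(0))\}.$$ (For $Q=I$ the condition is $(\mathcal Hx)'\in L^2_{\mathcal H}$; for $Q=P_1$ it says that $P_1(\mathcal Hx)'+P_0\mathcal Hx\in L^2_{\mathcal H}$.) -/

import Mathlib

open MeasureTheory Set Filter Topology Matrix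
open scoped NNReal ContDiff

noncomputable section

namespace PortHamiltonian

/-- Lebesgue measure on the semi-axis `[0, ∞)`. -/
def semiAxis : Measure ℝ := volume.restrict (Ici (0 : ℝ))

/-- A Hamiltonian on the semi-axis `[0, ∞)`: a measurable `ℂ^{d×d}`-valued function that is Hermitian
almost everywhere and satisfies two-sided bounds on every bounded subset of `[0, ∞)`. Values at
negative arguments play no role. -/
structure Hamiltonian (d : ℕ) where
  toFun : ℝ → Matrix (Fin d) (Fin d) ℂ
  aemeasurable : ∀ i j, AEMeasurable (fun ξ => toFun ξ i j) semiAxis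
  hermitian : ∀ᵐ ξ ∂semiAxis, (toFun ξ).IsHermitian
  bounds : ∀ K : Set ℝ, K ⊆ Ici 0 → Bornology.IsBounded K →
    ∃ m M : ℝ, 0 < m ∧ 0 < M ∧ ∀ ζ : Fin d → ℂ, ∀ᵐ ξ ∂volume, ξ ∈ K →
      m * ∑ i, ‖ζ i‖ ^ 2 ≤ (star ζ ⬝ᵥ toFun ξ *ᵥ ζ).re ∧
        (star ζ ⬝ᵥ toFun ξ *ᵥ ζ).re ≤ M * ∑ i, ‖ζ i‖ ^ 2

variable {d : ℕ}

instance : CoeFun (Hamiltonian d) (fun _ => ℝ → Matrix (Fin d) (Fin d) ℂ) := ⟨Hamiltonian.toFun⟩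

namespace Hamiltonian

variable (ℋ : Hamiltonian d)

/-- The Hamiltonian is (essentially) bounded on the whole semi-axis. -/
def Bounded : Prop := ∃ C : ℝ, ∀ᵐ ξ ∂semiAxis, ∀ i j, ‖ℋ ξ i j‖ ≤ C

/-- The pointwise weighted product `f(ξ)^⋆ ℋ(ξ) g(ξ)`. -/
def form (f g : ℝ → Fin d → ℂ) (ξ : ℝ) : ℂ := star (f ξ) ⬝ᵥ (ℋ ξ *ᵥ g ξ)

/-- `f` belongs to `L²_ℋ(0, ∞)`: it is measurable and `f^⋆ ℋ f` is integrable. That `f` is then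
square integrable on bounded sets is automatic, see `MemL2.integrableOn_sq`. -/
def MemL2 (f : ℝ → Fin d → ℂ) : Prop :=
  AEStronglyMeasurable f semiAxis ∧ Integrable (ℋ.form f f) semiAxis

variable {ℋ}

lemma lower_bound (R : ℝ) : ∃ m : ℝ, 0 < m ∧ ∀ᵐ ξ ∂semiAxis, ξ ≤ R → ∀ ζ : Fin d → ℂ,
    m * ∑ i, ‖ζ i‖ ^ 2 ≤ (star ζ ⬝ᵥ ℋ ξ *ᵥ ζ).re := by
  obtain ⟨m, M, hm, -, h⟩ := ℋ.bounds (Icc 0 R) (fun x hx => hx.1) (Metric.isBounded_Icc 0 R)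
  refine ⟨m, hm, ?_⟩
  have h2 := ae_all_iff.2 (fun n => h (TopologicalSpace.denseSeq (Fin d → ℂ) n))
  refine (ae_restrict_iff' measurableSet_Ici).2 ?_
  filter_upwards [h2] with ξ hξ h0 hR ζ
  have hc : IsClosed {ζ : Fin d → ℂ | m * ∑ i, ‖ζ i‖ ^ 2 ≤ (star ζ ⬝ᵥ ℋ ξ *ᵥ ζ).re} := by
    refine isClosed_le (by fun_prop) (Complex.continuous_re.comp ?_)
    exact Continuous.dotProduct continuous_star (Continuous.matrix_mulVec continuous_const continuous_id)
  have hs : range (TopologicalSpace.denseSeq (Fin d → ℂ)) ⊆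
      {ζ : Fin d → ℂ | m * ∑ i, ‖ζ i‖ ^ 2 ≤ (star ζ ⬝ᵥ ℋ ξ *ᵥ ζ).re} := by
    rintro _ ⟨n, rfl⟩
    exact (hξ n ⟨h0, hR⟩).1
  exact hc.closure_subset_iff.2 hs ((TopologicalSpace.denseRange_denseSeq (Fin d → ℂ)) ζ)

lemma lower_bound_ae : ∀ᵐ ξ ∂semiAxis, ∃ m : ℝ, 0 < m ∧ ∀ ζ : Fin d → ℂ,
    m * ∑ i, ‖ζ i‖ ^ 2 ≤ (star ζ ⬝ᵥ ℋ ξ *ᵥ ζ).re := by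
  choose m hm h using fun n : ℕ => lower_bound (ℋ := ℋ) n
  filter_upwards [ae_all_iff.2 h] with ξ hξ
  obtain ⟨n, hn⟩ := exists_nat_ge ξ
  exact ⟨m n, hm n, hξ n hn⟩

lemma dot_symm {A : Matrix (Fin d) (Fin d) ℂ} (hA : A.IsHermitian) (a b : Fin d → ℂ) :
    star (star a ⬝ᵥ A *ᵥ b) = star b ⬝ᵥ A *ᵥ a := by
  rw [← star_dotProduct_star, star_star, star_mulVec, hA.eq, ← dotProduct_mulVec]

lemma dot_bound {A : Matrix (Fin d) (Fin d) ℂ} (hA : A.IsHermitian)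
    (hp : ∀ ζ : Fin d → ℂ, 0 ≤ (star ζ ⬝ᵥ A *ᵥ ζ).re) (a b : Fin d → ℂ) :
    ‖star a ⬝ᵥ A *ᵥ b‖ ≤ (star a ⬝ᵥ A *ᵥ a).re + (star b ⬝ᵥ A *ᵥ b).re := by
  obtain ⟨c, hc, hcz⟩ := Complex.exists_norm_eq_mul_self (star a ⬝ᵥ A *ᵥ b)
  have h1 : star a ⬝ᵥ A *ᵥ (-c • b) = -(‖star a ⬝ᵥ A *ᵥ b‖ : ℂ) := by
    rw [hcz, mulVec_smul, dotProduct_smul, smul_eq_mul, neg_mul]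
  have h2 : (star (-c • b) ⬝ᵥ A *ᵥ a).re = -‖star a ⬝ᵥ A *ᵥ b‖ := by
    rw [← dot_symm hA, h1]; simp
  have h3 : star (-c • b) ⬝ᵥ A *ᵥ (-c • b) = star b ⬝ᵥ A *ᵥ b := by
    rw [mulVec_smul, dotProduct_smul, star_smul, smul_dotProduct, smul_smul]
    have : -c * star (-c) = 1 := by
      rw [star_neg, neg_mul_neg]
      have := Complex.mul_conj' c
      rw [hc] at this
      simpa using this
    rw [this, one_smul]
  have h4 := hp (a + -c • b)
  rw [mulVec_add, dotProduct_add, star_add, add_dotProduct, add_dotProduct, h1, h3] at h4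
  simp only [Complex.add_re, Complex.neg_re, Complex.ofReal_re, h2] at h4
  have h5 := hp a
  have h6 := hp b
  linarith [norm_nonneg (star a ⬝ᵥ A *ᵥ b)]

lemma form_ae_nonneg (f : ℝ → Fin d → ℂ) : ∀ᵐ ξ ∂semiAxis, 0 ≤ (ℋ.form f f ξ).re := by
  filter_upwards [ℋ.lower_bound_ae] with ξ ⟨m, hm, h⟩
  exact le_trans (by positivity) (h _)

lemma MemL2.integrable_form {f g : ℝ → Fin d → ℂ} (hf : ℋ.MemL2 f) (hg : ℋ.MemL2 g) :
    Integrable (ℋ.form f g) semiAxis := by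
  refine (hf.2.norm.add hg.2.norm).mono' ?_ ?_
  · have h1 : ∀ i, AEMeasurable (fun ξ => f ξ i) semiAxis :=
      fun i => (measurable_pi_apply i).comp_aemeasurable hf.1.aemeasurable
    have h2 : ∀ i, AEMeasurable (fun ξ => g ξ i) semiAxis :=
      fun i => (measurable_pi_apply i).comp_aemeasurable hg.1.aemeasurable
    refine AEMeasurable.aestronglyMeasurable ?_
    unfold form dotProduct mulVec dotProduct
    refine Finset.aemeasurable_fun_sum _ fun i _ => ?_
    refine AEMeasurable.mul ?_ (Finset.aemeasurable_fun_sum _ fun j _ => (ℋ.aemeasurable i j).mul (h2 j))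
    exact Complex.continuous_conj.measurable.comp_aemeasurable (h1 i)
  · filter_upwards [ℋ.lower_bound_ae, ℋ.hermitian] with ξ ⟨m, hm, h⟩ hH
    refine (dot_bound hH (fun ζ => le_trans (by positivity) (h ζ)) _ _).trans ?_
    exact add_le_add (Complex.re_le_norm _) (Complex.re_le_norm _)

lemma form_add_left (f g h : ℝ → Fin d → ℂ) : ℋ.form (f + g) h = ℋ.form f h + ℋ.form g h := by
  ext ξ; simp [form, add_dotProduct]

lemma form_add_right (f g h : ℝ → Fin d → ℂ) : ℋ.form f (g + h) = ℋ.form f g + ℋ.form f h := by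
  ext ξ; simp [form, mulVec_add]

lemma form_smul_left (c : ℂ) (f g : ℝ → Fin d → ℂ) : ℋ.form (c • f) g = star c • ℋ.form f g := by
  ext ξ; simp [form]

lemma form_smul_right (c : ℂ) (f g : ℝ → Fin d → ℂ) : ℋ.form f (c • g) = c • ℋ.form f g := by
  ext ξ; simp [form, mulVec_smul]

lemma form_congr {f f' g g' : ℝ → Fin d → ℂ} (hf : f =ᵐ[semiAxis] f') (hg : g =ᵐ[semiAxis] g') :
    ℋ.form f g =ᵐ[semiAxis] ℋ.form f' g' := by
  filter_upwards [hf, hg] with ξ h1 h2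
  simp only [form, h1, h2]

lemma MemL2.congr {f g : ℝ → Fin d → ℂ} (hf : ℋ.MemL2 f) (h : f =ᵐ[semiAxis] g) : ℋ.MemL2 g :=
  ⟨hf.1.congr h, hf.2.congr (form_congr h h)⟩

lemma MemL2.add {f g : ℝ → Fin d → ℂ} (hf : ℋ.MemL2 f) (hg : ℋ.MemL2 g) : ℋ.MemL2 (f + g) := by
  refine ⟨hf.1.add hg.1, ?_⟩
  rw [form_add_left, form_add_right, form_add_right]
  exact (hf.2.add (hf.integrable_form hg)).add ((hg.integrable_form hf).add hg.2)

lemma MemL2.smul {f : ℝ → Fin d → ℂ} (c : ℂ) (hf : ℋ.MemL2 f) : ℋ.MemL2 (c • f) := by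
  refine ⟨hf.1.const_smul c, ?_⟩
  rw [form_smul_left, form_smul_right]
  exact (hf.2.smul c).smul (star c)

lemma memL2_zero : ℋ.MemL2 0 := by
  refine ⟨aestronglyMeasurable_zero, ?_⟩
  have : ℋ.form 0 0 = 0 := by ext ξ; simp [form]
  rw [this]
  exact integrable_zero _ _ _

/-- Elements of `L²_ℋ(0, ∞)` are square integrable on bounded sets. -/
lemma MemL2.integrableOn_sq {f : ℝ → Fin d → ℂ} (hf : ℋ.MemL2 f) (R : ℝ) :
    IntegrableOn (fun ξ => ∑ i, ‖f ξ i‖ ^ 2) (Icc 0 R) := by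
  obtain ⟨m, hm, h⟩ := lower_bound (ℋ := ℋ) R
  have hle : volume.restrict (Icc (0 : ℝ) R) ≤ semiAxis :=
    Measure.restrict_mono (fun x hx => hx.1) le_rfl
  have h1 := ((hf.2.re).mono_measure hle).const_mul m⁻¹
  refine h1.mono' ?_ ?_
  · have h2 : ∀ i, AEMeasurable (fun ξ => f ξ i) (volume.restrict (Icc (0 : ℝ) R)) :=
      fun i => (measurable_pi_apply i).comp_aemeasurable
        (hf.1.aemeasurable.mono_measure hle)
    exact (Finset.aemeasurable_fun_sum _ fun i _ => (h2 i).norm.pow_const 2).aestronglyMeasurable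
  · filter_upwards [ae_mono hle h, ae_restrict_mem measurableSet_Icc] with ξ h3 h4
    rw [Real.norm_of_nonneg (by positivity), le_inv_mul_iff₀ hm]
    exact h3 h4.2 _

variable (ℋ) in
/-- The subspace of (classes of) functions underlying `L²_ℋ(0, ∞)`. -/
def submodule : Submodule ℂ (ℝ →ₘ[semiAxis] (Fin d → ℂ)) where
  carrier := {x | ℋ.MemL2 x}
  zero_mem' := memL2_zero.congr AEEqFun.coeFn_zero.symm
  add_mem' {x y} hx hy := (MemL2.add hx hy).congr (AEEqFun.coeFn_add x y).symm
  smul_mem' c x hx := (MemL2.smul c hx).congr (AEEqFun.coeFn_smul c x).symm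

variable (ℋ) in
/-- The weighted space `L²_ℋ(0, ∞)`, elements being functions modulo equality almost everywhere. -/
def L2 : Type := ↥ℋ.submodule

instance : AddCommGroup ℋ.L2 := inferInstanceAs (AddCommGroup ↥ℋ.submodule)

instance : Module ℂ ℋ.L2 := inferInstanceAs (Module ℂ ↥ℋ.submodule)

/-- A representative of an element of `L²_ℋ(0, ∞)`. -/
def L2.rep (x : ℋ.L2) : ℝ → Fin d → ℂ := x.1

instance : CoeFun ℋ.L2 (fun _ => ℝ → Fin d → ℂ) := ⟨L2.rep⟩

lemma L2.memL2 (x : ℋ.L2) : ℋ.MemL2 x := x.2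

lemma L2.coe_add (x y : ℋ.L2) : ⇑(x + y) =ᵐ[semiAxis] ⇑x + ⇑y := AEEqFun.coeFn_add x.1 y.1

lemma L2.coe_smul (c : ℂ) (x : ℋ.L2) : ⇑(c • x) =ᵐ[semiAxis] c • ⇑x := AEEqFun.coeFn_smul c x.1

/-- The scalar product `⟨x, y⟩ = ∫ x^⋆ ℋ y` of `L²_ℋ(0, ∞)`. -/
@[reducible] def core : InnerProductSpace.Core ℂ ℋ.L2 where
  inner x y := ∫ ξ, ℋ.form x y ξ ∂semiAxis
  conj_inner_symm x y := by
    change (starRingEnd ℂ) (∫ ξ, ℋ.form y x ξ ∂semiAxis) = _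
    rw [← integral_conj]
    refine integral_congr_ae ?_
    filter_upwards [ℋ.hermitian] with ξ h
    exact dot_symm h _ _
  re_inner_nonneg x := by
    change 0 ≤ (∫ ξ, ℋ.form x x ξ ∂semiAxis).re
    have : (∫ ξ, ℋ.form x x ξ ∂semiAxis).re = ∫ ξ, (ℋ.form x x ξ).re ∂semiAxis :=
      (integral_re x.memL2.2).symm
    rw [this]
    exact integral_nonneg_of_ae (form_ae_nonneg _)
  add_left x y z := by
    rw [integral_congr_ae (form_congr (L2.coe_add x y) (ae_eq_refl _)), form_add_left]
    exact integral_add (x.memL2.integrable_form z.memL2) (y.memL2.integrable_form z.memL2)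
  smul_left x y c := by
    change ∫ ξ, ℋ.form (c • x : ℋ.L2) y ξ ∂semiAxis = _
    rw [integral_congr_ae (form_congr (L2.coe_smul c x) (ae_eq_refl _)), form_smul_left]
    exact integral_const_mul _ _
  definite x hx := by
    change ∫ ξ, ℋ.form x x ξ ∂semiAxis = 0 at hx
    have h1 : ∫ ξ, (ℋ.form x x ξ).re ∂semiAxis = 0 := by
      have : (∫ ξ, ℋ.form x x ξ ∂semiAxis).re = ∫ ξ, (ℋ.form x x ξ).re ∂semiAxis :=
        (integral_re x.memL2.2).symm
      rw [← this, hx, Complex.zero_re]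
    have h2 := (integral_eq_zero_iff_of_nonneg_ae (form_ae_nonneg _) x.memL2.2.re).1 h1
    refine Subtype.ext (AEEqFun.ext (EventuallyEq.trans ?_ AEEqFun.coeFn_zero.symm))
    filter_upwards [h2, ℋ.lower_bound_ae] with ξ h3 ⟨m, hm, h⟩
    have h4 : m * ∑ i, ‖x.rep ξ i‖ ^ 2 ≤ 0 := (h (x.rep ξ)).trans_eq h3
    have h5 : ∑ i, ‖x.rep ξ i‖ ^ 2 = 0 :=
      le_antisymm (by nlinarith) (by positivity)
    have h6 := (Finset.sum_eq_zero_iff_of_nonneg (fun i _ => by positivity)).1 h5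
    funext i
    have h7 : x.rep ξ i = 0 := by simpa using h6 i (Finset.mem_univ i)
    exact h7

instance : NormedAddCommGroup ℋ.L2 := (core (ℋ := ℋ)).toNormedAddCommGroup

instance : InnerProductSpace ℂ ℋ.L2 := InnerProductSpace.ofCore (core (ℋ := ℋ)).toCore

end Hamiltonian

/-- `v` is the distributional derivative of `u` on `(0, ∞)`. -/
def IsWeakDeriv (u v : ℝ → Fin d → ℂ) : Prop :=
  LocallyIntegrableOn u (Ioi 0) ∧ LocallyIntegrableOn v (Ioi 0) ∧
    ∀ φ : ℝ → ℝ, ContDiff ℝ ∞ φ → HasCompactSupport φ → tsupport φ ⊆ Ioi 0 →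
      ∫ ξ in Ioi 0, deriv φ ξ • u ξ = - ∫ ξ in Ioi 0, φ ξ • v ξ

/-- `u(0) = c`, evaluated through the continuous representative of `u` on `[0, ∞)`. -/
def HasValueAtZero (u : ℝ → Fin d → ℂ) (c : Fin d → ℂ) : Prop :=
  ∃ g : ℝ → Fin d → ℂ, ContinuousOn g (Ici 0) ∧ g =ᵐ[semiAxis] u ∧ g 0 = c

/-- The function `ℋx`. -/
def Hamiltonian.mul (ℋ : Hamiltonian d) (x : ℋ.L2) (ξ : ℝ) : Fin d → ℂ := ℋ ξ *ᵥ x ξ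

/-- The set of `x ∈ L²_ℋ` such that `Q(ℋx)' ∈ L²_ℋ` and the value `(ℋx)(0)` satisfies the boundary
condition `B`. -/
def Hamiltonian.domain (ℋ : Hamiltonian d) (Q : Matrix (Fin d) (Fin d) ℂ)
    (B : (Fin d → ℂ) → Prop) : Set ℋ.L2 :=
  {x | (∃ v, IsWeakDeriv (ℋ.mul x) v ∧ ℋ.MemL2 (fun ξ => Q *ᵥ v ξ)) ∧
    ∃ c, HasValueAtZero (ℋ.mul x) c ∧ B c}

/-- `y = P₁(ℋx)' + P₀ℋx` on `(0, ∞)`, the derivative being distributional. -/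
def Hamiltonian.IsImage (ℋ : Hamiltonian d) (P₁ P₀ : Matrix (Fin d) (Fin d) ℂ) (x y : ℋ.L2) : Prop :=
  ∃ v, IsWeakDeriv (ℋ.mul x) v ∧
    ⇑y =ᵐ[semiAxis] fun ξ => P₁ *ᵥ v ξ + P₀ *ᵥ ℋ.mul x ξ

/-- `T` is a `C₀`-semigroup of contractions. -/
structure IsContractionSemigroup {X : Type*} [NormedAddCommGroup X] [NormedSpace ℂ X]
    (T : ℝ≥0 → X →L[ℂ] X) : Prop where
  zero : T 0 = ContinuousLinearMap.id ℂ X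
  add : ∀ s t, T (s + t) = (T s).comp (T t)
  contraction : ∀ t, ‖T t‖ ≤ 1
  tendsto : ∀ x, Tendsto (fun t => T t x) (𝓝 0) (𝓝 x)

/-- The (possibly unbounded) operator `H` generates a `C₀`-semigroup of contractions: `Hx = y` (with
`x ∈ D(H)`) exactly when `(T(t)x - x)/t → y` as `t ↓ 0`. -/
def GeneratesContractionSemigroup {X : Type*} [NormedAddCommGroup X] [NormedSpace ℂ X]
    (H : X →ₗ.[ℂ] X) : Prop :=
  ∃ T : ℝ≥0 → X →L[ℂ] X, IsContractionSemigroup T ∧ ∀ x y : X, (x, y) ∈ H.graph ↔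
    Tendsto (fun t : ℝ≥0 => ((t : ℝ)⁻¹ : ℂ) • (T t x - x)) (𝓝[>] 0) (𝓝 y)

/-- The projections onto the first `p` and the last `q` coordinates. -/
def prPlus {p q : ℕ} (v : Fin (p + q) → ℂ) : Fin p → ℂ := fun k => v (Fin.castAdd q k)

def prMinus {p q : ℕ} (v : Fin (p + q) → ℂ) : Fin q → ℂ := fun j => v (Fin.natAdd p j)

/-- The matrix `Δ = diag(Λ, -Θ)`. -/
def deltaMatrix {p q : ℕ} (lam : Fin p → ℝ) (theta : Fin q → ℝ) :
    Matrix (Fin (p + q)) (Fin (p + q)) ℂ :=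
  Matrix.diagonal fun i => ((Fin.append lam (fun j => -theta j) i : ℝ) : ℂ)

/-- `T` is a contraction from `ℂ^q` with squared norm `⟨v, Θv⟩` to `ℂ^p` with squared norm
`⟨w, Λw⟩`, for `Λ = diag lam` and `Θ = diag theta`. -/
def IsWeightedContraction {p q : ℕ} (lam : Fin p → ℝ) (theta : Fin q → ℝ)
    (T : (Fin q → ℂ) →ₗ[ℂ] (Fin p → ℂ)) : Prop :=
  ∀ v, ∑ k, lam k * ‖T v k‖ ^ 2 ≤ ∑ j, theta j * ‖v j‖ ^ 2

end PortHamiltonian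

end

noncomputable section

/-! Everything rests on Green's identity. Boundedness of `ℋ` gives `|ℋζ|² ≤ K ζ^⋆ℋζ`, so `ℋx` is
square integrable without weight for every `x ∈ L²_ℋ`. Hence integrating `(ℋx)^⋆P₁(ℋx)` by parts
over the semi-axis leaves no term at infinity, and, `P₀` being skew, every `x ∈ D(H)` with `c =
ℋx(0)` satisfies `2 Re⟨x, Hx⟩ = c^⋆P₁c` (`HasTrace.inner_add_inner`). In the coordinates `Sc = (a,
b)` this is `⟨a, Λa⟩ - ⟨b, Θb⟩`. Dissipativity is therefore a statement about the subspace of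
boundary values in `ℂ^d`.

Necessity. A generator is dissipative, so on its boundary values `‖a‖_Λ ≤ ‖b‖_Θ`. Thus `a` is a
contractive function of `b` on a subspace, and composing with an orthogonal projection extends it to
a contraction `T` on all of `ℂ^q` (`exists_contraction_of_nonpos`). The operator with boundary
condition `Tb = a` is a dissipative extension of `H`. It cannot be proper because `1 - H` is onto,
by the Laplace transform of the semigroup (`mem_domain_of_generates`).

Sufficiency. The condition `Tb = a` makes `H` dissipative. The adjoint problem has its boundary
values in the `P₁`-orthogonal companion of the graph of `T`. There the form is nonnegative, so no
nonzero vector is orthogonal to the range of `c - H`, `c > 0`. The companion of the companion is the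
graph again, so `H` is closed and this range is closed. The Lumer–Phillips theorem, proved here
through Yosida approximation, gives the semigroup.

The choice of `Q`. As `ℋ` is bounded below only locally, multiplication by `P₁` need not preserve
`L²_ℋ`. For `Q = 1` the inclusion `D(A) ⊆ D(H)` forces it to: up to an oscillating unimodular factor
and a small correction, every `v ∈ L²_ℋ` is `(ℋx)'` for some `x ∈ D(A)`, and then `P₁v ∈ L²_ℋ`. The
matrices preserving `L²_ℋ` form a finite-dimensional algebra, so `P₁⁻¹` preserves it too, and both
choices of `Q` describe the same domains (`memL2_mulVec_iff`). -/

namespace PortHamiltonian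

/-! ### Necessary properties of generators: dissipativity and surjectivity of `1 - H` -/

section Semigroup

variable {X : Type*} [NormedAddCommGroup X] [InnerProductSpace ℂ X]

lemma IsContractionSemigroup.norm_apply_le {T : ℝ≥0 → X →L[ℂ] X} (hT : IsContractionSemigroup T)
    (t : ℝ≥0) (x : X) : ‖T t x‖ ≤ ‖x‖ := by
  simpa using (T t).le_of_opNorm_le (hT.contraction t) x

/-- For `s ≤ t` the semigroup law factors `T s` out of the difference, and contractivity discards
it. This reduces continuity of orbits to continuity at `0`. -/
lemma IsContractionSemigroup.norm_sub_le {T : ℝ≥0 → X →L[ℂ] X} (hT : IsContractionSemigroup T)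
    (s t : ℝ≥0) (x : X) : ‖T s x - T t x‖ ≤ ‖T (nndist s t) x - x‖ := by
  wlog h : s ≤ t generalizing s t
  · rw [norm_sub_rev, nndist_comm]
    exact this t s (le_of_not_ge h)
  have h1 : nndist s t = t - s := by
    rw [NNReal.nndist_eq, tsub_eq_zero_of_le h]
    exact max_eq_right zero_le
  have h2 : T t x = T s (T (t - s) x) := by
    conv_lhs => rw [← add_tsub_cancel_of_le h, hT.add]
    rfl
  rw [h1, h2, ← map_sub, norm_sub_rev (T (t - s) x)]
  exact hT.norm_apply_le _ _

lemma IsContractionSemigroup.continuous_orbit {T : ℝ≥0 → X →L[ℂ] X}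
    (hT : IsContractionSemigroup T) (x : X) : Continuous fun t => T t x := by
  refine continuous_iff_continuousAt.2 fun t => ?_
  rw [ContinuousAt, tendsto_iff_norm_sub_tendsto_zero]
  have h1 : Tendsto (fun s : ℝ≥0 => nndist s t) (𝓝 t) (𝓝 0) := by
    have : Continuous fun s : ℝ≥0 => nndist s t := by fun_prop
    simpa using this.tendsto t
  have h2 := (tendsto_iff_norm_sub_tendsto_zero.1 (hT.tendsto x)).comp h1
  exact squeeze_zero (fun _ => norm_nonneg _) (fun s => hT.norm_sub_le s t x) h2

/-- By Cauchy–Schwarz and contractivity `Re⟨x, T t x⟩ ≤ ‖x‖²`, so every difference quotient already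
has the right sign. -/
lemma IsContractionSemigroup.re_inner_nonpos {T : ℝ≥0 → X →L[ℂ] X}
    (hT : IsContractionSemigroup T) {x y : X}
    (h : Tendsto (fun t : ℝ≥0 => ((t : ℝ)⁻¹ : ℂ) • (T t x - x)) (𝓝[>] 0) (𝓝 y)) :
    (inner ℂ x y).re ≤ 0 := by
  have h1 : Tendsto (fun t : ℝ≥0 => (inner ℂ x (((t : ℝ)⁻¹ : ℂ) • (T t x - x))).re) (𝓝[>] 0)
      (𝓝 (inner ℂ x y).re) :=
    (Complex.continuous_re.tendsto _).comp (tendsto_const_nhds.inner h)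
  refine le_of_tendsto h1 (Eventually.of_forall fun t => ?_)
  rw [inner_smul_right, inner_sub_right, ← Complex.ofReal_inv, Complex.re_ofReal_mul]
  refine mul_nonpos_of_nonneg_of_nonpos (by positivity) ?_
  rw [Complex.sub_re, inner_self_eq_norm_sq_to_K]
  have h2 : (inner ℂ x (T t x)).re ≤ ‖x‖ * ‖T t x‖ := re_inner_le_norm (𝕜 := ℂ) x (T t x)
  have h3 := mul_le_mul_of_nonneg_left (hT.norm_apply_le t x) (norm_nonneg x)
  have h4 : (((‖x‖ : ℂ)) ^ 2).re = ‖x‖ * ‖x‖ := by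
    rw [← Complex.ofReal_pow, Complex.ofReal_re, sq]
  erw [h4]
  linarith

theorem GeneratesContractionSemigroup.re_inner_nonpos {H : X →ₗ.[ℂ] X}
    (h : GeneratesContractionSemigroup H) (x : H.domain) : (inner ℂ (x : X) (H x)).re ≤ 0 := by
  obtain ⟨T, hT, hH⟩ := h
  exact hT.re_inner_nonpos ((hH _ _).1 (H.mem_graph x))

lemma tendsto_coe_nhdsGT_zero :
    Tendsto (fun t : ℝ≥0 => (t : ℝ)) (𝓝[>] 0) (𝓝[≠] 0) := by
  refine tendsto_nhdsWithin_iff.2 ⟨?_, ?_⟩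
  · exact (NNReal.continuous_coe.tendsto 0).mono_left nhdsWithin_le_nhds
  · filter_upwards [self_mem_nhdsWithin] with t ht
    exact (NNReal.coe_pos.2 ht).ne'

/-- The solution is the resolvent at `1` in Laplace form, `R = ∫₀^∞ e^{-t} T(t)f dt`. -/
theorem GeneratesContractionSemigroup.exists_sub_eq [CompleteSpace X] {H : X →ₗ.[ℂ] X}
    (h : GeneratesContractionSemigroup H) (f : X) : ∃ x : H.domain, (x : X) - H x = f := by
  obtain ⟨T, hT, hH⟩ := h
  set c : ℝ → X := fun t => T t.toNNReal f with hc
  have hcc : Continuous c := (hT.continuous_orbit f).comp continuous_real_toNNReal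
  set e : ℝ → X := fun t => Real.exp (-t) • c t with he
  have hec : Continuous e := by fun_prop
  have hei : IntegrableOn e (Ioi 0) := by
    refine ((integrableOn_exp_neg_Ioi 0).mul_const ‖f‖).mono' hec.aestronglyMeasurable ?_
    refine Eventually.of_forall fun t => ?_
    rw [he, norm_smul, Real.norm_of_nonneg (Real.exp_pos _).le]
    exact mul_le_mul_of_nonneg_left (hT.norm_apply_le _ _) (Real.exp_pos _).le
  set R : X := ∫ t in Ioi 0, e t with hR
  -- Applying `T h` shifts the orbit by `h`, at the price of the factor `e^h`. Extending the
  -- integrands by zero turns the substitution into translation invariance on the line.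
  have hTR : ∀ h : ℝ≥0, T h R = Real.exp h • (R - ∫ t in (0 : ℝ)..h, e t) := by
    intro h
    have h1 : R - ∫ t in (0 : ℝ)..h, e t = ∫ t in Ioi (h : ℝ), e t := by
      rw [intervalIntegral.integral_of_le h.coe_nonneg, hR, ← Ioc_union_Ioi_eq_Ioi h.coe_nonneg,
        setIntegral_union (Ioc_disjoint_Ioi le_rfl) measurableSet_Ioi
          (hei.mono_set Ioc_subset_Ioi_self) (hei.mono_set (Ioi_subset_Ioi h.coe_nonneg))]
      simp
    rw [h1, hR, ← (T h).integral_comp_comm hei, ← integral_smul]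
    rw [← integral_indicator measurableSet_Ioi, ← integral_indicator measurableSet_Ioi,
      ← integral_add_right_eq_self ((Ioi (h : ℝ)).indicator fun a => Real.exp h • e a) (h : ℝ)]
    congr 1
    ext t
    by_cases ht : t ∈ Ioi (0 : ℝ)
    · have ht' : t + h ∈ Ioi (h : ℝ) := by simpa using ht
      rw [indicator_of_mem ht, indicator_of_mem ht']
      have ht0 : (0 : ℝ) ≤ t := le_of_lt ht
      have h2 : (t + (h : ℝ)).toNNReal = h + t.toNNReal := by
        rw [Real.toNNReal_add ht0 h.coe_nonneg, Real.toNNReal_coe, add_comm]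
      simp only [he, hc, h2, hT.add, smul_smul, ← Real.exp_add]
      rw [(T h).map_smul_of_tower]
      simp
    · have ht' : t + h ∉ Ioi (h : ℝ) := by simpa using ht
      rw [indicator_of_notMem ht, indicator_of_notMem ht']
  -- The derivative of `h ↦ T(h)R` at `0` identifies `HR` as `R - f`.
  have hd : HasDerivAt (fun h : ℝ => Real.exp h • (R - ∫ t in (0 : ℝ)..h, e t)) (R - f) 0 := by
    have h1 : HasDerivAt (fun h : ℝ => ∫ t in (0 : ℝ)..h, e t) (e 0) 0 :=
      (hec.integral_hasStrictDerivAt 0 0).hasDerivAt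
    have h2 := (Real.hasDerivAt_exp 0).smul (h1.const_sub R)
    convert! h2 using 1
    simp [he, hc, hT.zero, sub_eq_neg_add]
  have hlim := (hasDerivAt_iff_tendsto_slope_zero.1 hd).comp tendsto_coe_nhdsGT_zero
  have hg : (R, R - f) ∈ H.graph := by
    refine (hH _ _).2 (hlim.congr fun t => ?_)
    simp only [Function.comp, zero_add, ← hTR]
    simp [← Complex.coe_smul]
  obtain ⟨x, hx1, hx2⟩ := (LinearPMap.mem_graph_iff H).1 hg
  exact ⟨x, by rw [hx1, hx2]; simp⟩

end Semigroup

end PortHamiltonian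

namespace PortHamiltonian

/-! ### Exponentials of bounded dissipative operators and their limits -/

section Yosida

variable {X : Type*} [NormedAddCommGroup X] [InnerProductSpace ℂ X]

/-- The one-parameter group generated by a bounded operator. -/
def expGroup (A : X →L[ℂ] X) (t : ℝ) : X →L[ℂ] X := NormedSpace.exp (t • A)

lemma expGroup_zero (A : X →L[ℂ] X) : expGroup A 0 = 1 := by
  simp [expGroup, NormedSpace.exp_zero]

variable [CompleteSpace X]

lemma expGroup_add (A : X →L[ℂ] X) (s t : ℝ) : expGroup A (s + t) = expGroup A s * expGroup A t := by
  let _ : NormedAlgebra ℚ (X →L[ℂ] X) := NormedAlgebra.restrictScalars ℚ ℂ _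
  rw [expGroup, add_smul, NormedSpace.exp_add_of_commute]
  · rfl
  · exact ((Commute.refl A).smul_left s).smul_right t

lemma expGroup_commute {A B : X →L[ℂ] X} (h : Commute A B) (t : ℝ) : Commute A (expGroup B t) :=
  (h.smul_right t).exp_right

lemma hasDerivAt_expGroup (A : X →L[ℂ] X) (x : X) (t : ℝ) :
    HasDerivAt (fun s => expGroup A s x) (expGroup A t (A x)) t := by
  have h := hasDerivAt_exp_smul_const A t
  have h2 := ((ContinuousLinearMap.apply ℂ X x).restrictScalars ℝ).hasFDerivAt.comp_hasDerivAt t h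
  exact h2

/-- The derivative of `‖e^{sA}x‖²` is `2 Re⟨e^{sA}x, A e^{sA}x⟩ ≤ 0`. -/
lemma norm_expGroup_apply_le {A : X →L[ℂ] X} (hA : ∀ x, (inner ℂ x (A x)).re ≤ 0) {t : ℝ}
    (ht : 0 ≤ t) (x : X) : ‖expGroup A t x‖ ≤ ‖x‖ := by
  have hd : ∀ s, HasDerivAt (fun s => ‖expGroup A s x‖ ^ 2)
      (2 * (inner ℂ (expGroup A s x) (A (expGroup A s x))).re) s := by
    intro s
    have h1 := (hasDerivAt_expGroup A x s).inner ℂ (hasDerivAt_expGroup A x s)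
    have h2 := Complex.reCLM.hasFDerivAt.comp_hasDerivAt s h1
    have h3 : expGroup A s (A x) = A (expGroup A s x) :=
      (congr($((expGroup_commute (Commute.refl A) s).eq) x)).symm
    convert! h2 using 1
    · ext s
      exact (inner_self_eq_norm_sq (𝕜 := ℂ) _).symm
    · rw [h3, ← inner_conj_symm (A _), two_mul]
      exact congr(_ + $(Complex.conj_re _)).symm
  have hanti : Antitone fun s => ‖expGroup A s x‖ ^ 2 :=
    antitone_of_hasDerivAt_nonpos hd fun s => mul_nonpos_of_nonneg_of_nonpos zero_le_two (hA _)
  have := hanti ht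
  simp only [expGroup_zero, one_apply_eq_self] at this
  exact le_of_sq_le_sq this (norm_nonneg _)

/-- The path `s ↦ e^{sA}e^{(t-s)B}x` joins the two vectors. By commutation its derivative is
`e^{sA}e^{(t-s)B}(A - B)x`, and both exponentials are contractions for `0 ≤ s ≤ t`. -/
lemma norm_expGroup_sub_le {A B : X →L[ℂ] X} (hA : ∀ x, (inner ℂ x (A x)).re ≤ 0)
    (hB : ∀ x, (inner ℂ x (B x)).re ≤ 0) (hAB : Commute A B) {t : ℝ} (ht : 0 ≤ t) (x : X) :
    ‖expGroup A t x - expGroup B t x‖ ≤ ‖A x - B x‖ * t := by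
  have hd : ∀ s, HasDerivAt (fun s => expGroup A s (expGroup B (t - s) x))
      (expGroup A s (expGroup B (t - s) (A x - B x))) s := by
    intro s
    have h1 : HasDerivAt (fun s => expGroup A s) (expGroup A s * A) s := hasDerivAt_exp_smul_const A s
    have h2 := (hasDerivAt_expGroup B x (t - s)).scomp s ((hasDerivAt_id s).const_sub t)
    let b : (X →L[ℂ] X) →L[ℝ] X →L[ℝ] X :=
      (ContinuousLinearMap.restrictScalarsL ℂ X X ℝ ℝ)
    have h3 := (b.hasFDerivAt.comp_hasDerivAt s h1).clm_apply h2
    convert! h3 using 1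
    have h4 : A (expGroup B (t - s) x) = expGroup B (t - s) (A x) :=
      congr($((expGroup_commute hAB (t - s)).eq) x)
    rw [sub_eq_add_neg t s] at h4
    simp [b, h4, sub_eq_add_neg]
  have := norm_image_sub_le_of_norm_deriv_le_segment' (a := 0) (b := t)
    (fun s _ => (hd s).hasDerivWithinAt) (C := ‖A x - B x‖) (fun s hs => ?_) t ⟨ht, le_rfl⟩
  · simpa [expGroup_zero] using this
  · exact (norm_expGroup_apply_le hA hs.1 _).trans (norm_expGroup_apply_le hB (by linarith [hs.2]) _)

lemma norm_expGroup_sub_id_le {A : X →L[ℂ] X} (hA : ∀ x, (inner ℂ x (A x)).re ≤ 0) {t : ℝ}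
    (ht : 0 ≤ t) (x : X) : ‖expGroup A t x - x‖ ≤ ‖A x‖ * t := by
  have := norm_expGroup_sub_le hA (B := 0) (by simp) (Commute.zero_right A) ht x
  simpa [expGroup, NormedSpace.exp_zero] using this

/-- A first-order Taylor remainder that does not involve `‖A‖` and so survives a limit in `A`. In
the application `y` is the limit of the `A n x`. The image `A y` is not controlled, hence the
approximation `z` of `y`, for which `A z` is. -/
lemma norm_expGroup_sub_sub_le {A : X →L[ℂ] X} (hA : ∀ x, (inner ℂ x (A x)).re ≤ 0) {t : ℝ}
    (ht : 0 ≤ t) (x y z : X) :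
    ‖expGroup A t x - x - t • y‖ ≤ (‖A x - y‖ + 2 * ‖y - z‖ + ‖A z‖ * t) * t := by
  have hd : ∀ s, HasDerivAt (fun s => expGroup A s x - s • y) (expGroup A s (A x) - y) s := by
    intro s
    have := (hasDerivAt_expGroup A x s).sub ((hasDerivAt_id s).smul_const y)
    simpa using! this
  have := norm_image_sub_le_of_norm_deriv_le_segment' (a := 0) (b := t)
    (fun s _ => (hd s).hasDerivWithinAt) (C := ‖A x - y‖ + 2 * ‖y - z‖ + ‖A z‖ * t)
    (fun s hs => ?_) t ⟨ht, le_rfl⟩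
  · simpa [expGroup_zero, sub_right_comm] using this
  · have h1 : expGroup A s (A x) - y =
        expGroup A s (A x - y) + expGroup A s (y - z) + (expGroup A s z - z) + (z - y) := by
      simp only [map_sub]; abel
    have h2 := norm_expGroup_apply_le hA hs.1 (A x - y)
    have h3 := norm_expGroup_apply_le hA hs.1 (y - z)
    have h4 := norm_expGroup_sub_id_le hA hs.1 z
    have h5 : ‖A z‖ * s ≤ ‖A z‖ * t := mul_le_mul_of_nonneg_left hs.2.le (norm_nonneg _)
    have h6 := norm_sub_rev z y
    rw [h1]
    refine (norm_add_le _ _).trans ?_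
    have h7 := norm_add_le (expGroup A s (A x - y) + expGroup A s (y - z)) (expGroup A s z - z)
    have h8 := norm_add_le (expGroup A s (A x - y)) (expGroup A s (y - z))
    linarith

/-- Convergence of the groups generated by commuting bounded dissipative operators. -/
theorem exists_isContractionSemigroup_of_tendsto {A : ℕ → X →L[ℂ] X}
    (hA : ∀ n x, (inner ℂ x (A n x)).re ≤ 0) (hcomm : ∀ m n, Commute (A m) (A n))
    {D : Set X} (hD : Dense D) {h : X → X} (hh : ∀ x ∈ D, Tendsto (fun n => A n x) atTop (𝓝 (h x))) :
    ∃ T : ℝ≥0 → X →L[ℂ] X, IsContractionSemigroup T ∧ ∀ x ∈ D,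
      Tendsto (fun t : ℝ≥0 => ((t : ℝ)⁻¹ : ℂ) • (T t x - x)) (𝓝[>] 0) (𝓝 (h x)) := by
  have hcau : ∀ (t : ℝ≥0) (x : X), CauchySeq fun n => expGroup (A n) t x := by
    intro t x
    refine Metric.cauchySeq_iff.2 fun ε hε => ?_
    obtain ⟨z, hz, hxz⟩ := Metric.dense_iff.1 hD x (ε / 3) (by positivity)
    rw [Metric.mem_ball, dist_comm, dist_eq_norm] at hz
    obtain ⟨N, hN⟩ := Metric.cauchySeq_iff.1 (hh z hxz).cauchySeq (ε / (3 * (t + 1))) (by positivity)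
    refine ⟨N, fun m hm n hn => ?_⟩
    have h1 := norm_expGroup_apply_le (hA m) t.coe_nonneg (x - z)
    have h2 := norm_expGroup_apply_le (hA n) t.coe_nonneg (x - z)
    have h3 := norm_expGroup_sub_le (hA m) (hA n) (hcomm m n) t.coe_nonneg z
    have h4 := hN m hm n hn
    rw [dist_eq_norm] at h4 ⊢
    have h5 : ‖A m z - A n z‖ * t < ε / 3 := by
      have h6 : ‖A m z - A n z‖ * (t + 1) < ε / (3 * (t + 1)) * (t + 1) :=
        mul_lt_mul_of_pos_right h4 (by positivity)
      have h7 : ε / (3 * ((t : ℝ) + 1)) * (t + 1) = ε / 3 := by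
        field_simp
      nlinarith [norm_nonneg (A m z - A n z)]
    have h8 : expGroup (A m) t x - expGroup (A n) t x = expGroup (A m) t (x - z) +
        (expGroup (A m) t z - expGroup (A n) t z) - expGroup (A n) t (x - z) := by
      simp only [map_sub]; abel
    rw [h8]
    have h9 := norm_sub_le (expGroup (A m) t (x - z) +
        (expGroup (A m) t z - expGroup (A n) t z)) (expGroup (A n) t (x - z))
    have h10 := norm_add_le (expGroup (A m) t (x - z)) (expGroup (A m) t z - expGroup (A n) t z)
    linarith
  choose S hS using fun t x => cauchySeq_tendsto_of_complete (hcau t x)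
  have hSle : ∀ t x, ‖S t x‖ ≤ ‖x‖ := fun t x =>
    le_of_tendsto (hS t x).norm (Eventually.of_forall fun n =>
      norm_expGroup_apply_le (hA n) t.coe_nonneg x)
  let T : ℝ≥0 → X →L[ℂ] X := fun t =>
    LinearMap.mkContinuous
      { toFun := S t
        map_add' := fun x y => tendsto_nhds_unique (hS t (x + y)) (by
          simpa using (hS t x).add (hS t y))
        map_smul' := fun c x => tendsto_nhds_unique (hS t (c • x)) (by
          simpa using (hS t x).const_smul c) } 1
      (fun x => by simpa using hSle t x)
  have hT : ∀ (t : ℝ≥0) (x : X), Tendsto (fun n => expGroup (A n) t x) atTop (𝓝 (T t x)) := hS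
  have hTle : ∀ (t : ℝ≥0) (x : X), ‖T t x‖ ≤ ‖x‖ := hSle
  have hlim : ∀ x ∈ D, ∀ z ∈ D, ∀ t : ℝ≥0,
      ‖T t x - x - (t : ℝ) • h x‖ ≤ (2 * ‖h x - z‖ + ‖h z‖ * t) * t := by
    intro x hx z hz t
    have h1 : Tendsto (fun n => ‖expGroup (A n) t x - x - (t : ℝ) • h x‖) atTop
        (𝓝 ‖T t x - x - (t : ℝ) • h x‖) := (((hT t x).sub_const x).sub_const _).norm
    have h2 : Tendsto (fun n => (‖A n x - h x‖ + 2 * ‖h x - z‖ + ‖A n z‖ * t) * t) atTop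
        (𝓝 ((‖h x - h x‖ + 2 * ‖h x - z‖ + ‖h z‖ * t) * t)) :=
      (((((hh x hx).sub_const (h x)).norm.add_const _).add ((hh z hz).norm.mul_const _))).mul_const _
    refine (le_of_tendsto_of_tendsto' h1 h2 fun n =>
      norm_expGroup_sub_sub_le (hA n) t.coe_nonneg x (h x) z).trans_eq ?_
    simp
  refine ⟨T, ⟨?_, ?_, ?_, ?_⟩, ?_⟩
  · ext x
    refine tendsto_nhds_unique (hT 0 x) ?_
    simp [expGroup_zero]
  · intro s t
    ext x
    refine tendsto_nhds_unique (hT (s + t) x) ?_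
    -- Operator and argument both vary with `n`; contractivity absorbs the change of argument.
    have h1 : Tendsto (fun n => expGroup (A n) s (expGroup (A n) t x - T t x)) atTop (𝓝 0) := by
      refine squeeze_zero_norm (fun n => norm_expGroup_apply_le (hA n) s.coe_nonneg _) ?_
      simpa using ((hT t x).sub_const (T t x)).norm
    have h2 := h1.add (hT s (T t x))
    simp only [zero_add] at h2
    refine h2.congr fun n => ?_
    simp [expGroup_add]
  · exact fun t => ContinuousLinearMap.opNorm_le_bound _ zero_le_one fun x => by
      simpa using hTle t x
  · intro x
    refine Metric.tendsto_nhds.2 fun ε hε => ?_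
    obtain ⟨z, hz, hxz⟩ := Metric.dense_iff.1 hD x (ε / 3) (by positivity)
    rw [Metric.mem_ball, dist_comm, dist_eq_norm] at hz
    have hz2 : ∀ t : ℝ≥0, ‖T t z - z‖ ≤ ‖h z‖ * t := fun t => by
      have h1 : Tendsto (fun n => ‖expGroup (A n) t z - z‖) atTop (𝓝 ‖T t z - z‖) :=
        ((hT t z).sub_const z).norm
      exact le_of_tendsto_of_tendsto' h1 ((hh z hxz).norm.mul_const _) fun n =>
        norm_expGroup_sub_id_le (hA n) t.coe_nonneg z
    have h1 : Tendsto (fun t : ℝ≥0 => ‖h z‖ * (t : ℝ)) (𝓝 0) (𝓝 0) := by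
      have : Continuous fun t : ℝ≥0 => ‖h z‖ * (t : ℝ) := by fun_prop
      simpa using this.tendsto 0
    filter_upwards [h1.eventually (gt_mem_nhds (show 0 < ε / 3 by positivity))] with t ht
    have h2 : T t x - x = T t (x - z) + (T t z - z) - (x - z) := by simp only [map_sub]; abel
    rw [dist_eq_norm, h2]
    have h3 := norm_sub_le (T t (x - z) + (T t z - z)) (x - z)
    have h4 := norm_add_le (T t (x - z)) (T t z - z)
    linarith [hTle t (x - z), hz2 t]
  · intro x hx
    refine Metric.tendsto_nhds.2 fun ε hε => ?_
    -- Here the vector approximated from `D` is `h x` and not `x`; it serves as the auxiliary point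
    -- of the Taylor estimate.
    obtain ⟨z, hz, hxz⟩ := Metric.dense_iff.1 hD (h x) (ε / 3) (by positivity)
    rw [Metric.mem_ball, dist_comm, dist_eq_norm] at hz
    have h1 : Tendsto (fun t : ℝ≥0 => ‖h z‖ * (t : ℝ)) (𝓝[>] 0) (𝓝 0) := by
      have : Continuous fun t : ℝ≥0 => ‖h z‖ * (t : ℝ) := by fun_prop
      simpa using (this.tendsto 0).mono_left nhdsWithin_le_nhds
    filter_upwards [h1.eventually (gt_mem_nhds (show 0 < ε / 3 by positivity)),
      self_mem_nhdsWithin] with t ht ht0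
    have ht0' : 0 < (t : ℝ) := NNReal.coe_pos.2 ht0
    have h2 : ((t : ℝ)⁻¹ : ℂ) • (T t x - x) - h x = (t : ℝ)⁻¹ • (T t x - x - (t : ℝ) • h x) := by
      rw [smul_sub (t : ℝ)⁻¹, smul_smul, inv_mul_cancel₀ ht0'.ne', one_smul, ← Complex.ofReal_inv,
        Complex.coe_smul]
    rw [dist_eq_norm, h2, norm_smul, Real.norm_of_nonneg (by positivity)]
    refine lt_of_le_of_lt (mul_le_mul_of_nonneg_left (hlim x hx z hxz t) (by positivity)) ?_
    rw [mul_comm, mul_assoc, mul_inv_cancel₀ ht0'.ne', mul_one]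
    linarith

end Yosida

end PortHamiltonian

namespace PortHamiltonian

/-! ### Resolvents and the Lumer–Phillips theorem -/

section HilleYosida

variable {X : Type*} [NormedAddCommGroup X] [InnerProductSpace ℂ X]

lemma re_inner_smul_self (c : ℝ) (x : X) : (inner ℂ x ((c : ℂ) • x)).re = c * ‖x‖ ^ 2 := by
  rw [inner_smul_right, Complex.re_ofReal_mul]
  congr 1
  exact inner_self_eq_norm_sq (𝕜 := ℂ) x

/-- Pairing with `x` gives `Re⟨x, cx - y⟩ ≥ c‖x‖²`. This coercivity is behind injectivity, the
resolvent bound and closedness of the range. -/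
lemma mul_norm_le_norm_smul_sub {x y : X} (h : (inner ℂ x y).re ≤ 0) (c : ℝ) :
    c * ‖x‖ ≤ ‖(c : ℂ) • x - y‖ := by
  rcases eq_or_ne x 0 with rfl | hx
  · simp
  have h1 : (inner ℂ x ((c : ℂ) • x - y)).re ≤ ‖x‖ * ‖(c : ℂ) • x - y‖ :=
    re_inner_le_norm (𝕜 := ℂ) _ _
  rw [inner_sub_right, Complex.sub_re, re_inner_smul_self] at h1
  have h2 : 0 < ‖x‖ := norm_pos_iff.2 hx
  nlinarith

lemma eq_of_smul_sub_eq {H : X →ₗ.[ℂ] X} (hH : ∀ x : H.domain, (inner ℂ (x : X) (H x)).re ≤ 0)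
    {c : ℝ} (hc : 0 < c) {x y : H.domain} (h : (c : ℂ) • (x : X) - H x = (c : ℂ) • (y : X) - H y) :
    x = y := by
  have h1 := mul_norm_le_norm_smul_sub (hH (x - y)) c
  have h2 : (c : ℂ) • ((x - y : H.domain) : X) - H (x - y) = 0 := by
    rw [LinearPMap.map_sub, Submodule.coe_sub, smul_sub, sub_sub_sub_comm, h, sub_self]
  rw [h2, norm_zero] at h1
  have h3 : ‖((x - y : H.domain) : X)‖ = 0 :=
    le_antisymm (by nlinarith [norm_nonneg ((x - y : H.domain) : X)]) (norm_nonneg _)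
  exact sub_eq_zero.1 (Subtype.ext (norm_eq_zero.1 h3))

lemma exists_resolvent {H : X →ₗ.[ℂ] X} (hH : ∀ x : H.domain, (inner ℂ (x : X) (H x)).re ≤ 0)
    {c : ℝ} (hc : 0 < c) (hr : ∀ f, ∃ x : H.domain, (c : ℂ) • (x : X) - H x = f) :
    ∃ R : X →L[ℂ] X, (∀ f, c * ‖R f‖ ≤ ‖f‖) ∧ (∀ f, ∃ h : R f ∈ H.domain,
      (c : ℂ) • R f - H ⟨R f, h⟩ = f) ∧ ∀ x : H.domain, R ((c : ℂ) • (x : X) - H x) = x := by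
  choose r hr using hr
  have hle : ∀ f, c * ‖(r f : X)‖ ≤ ‖f‖ := fun f => by
    conv_rhs => rw [← hr f]
    exact mul_norm_le_norm_smul_sub (hH _) c
  let R₀ : X →ₗ[ℂ] X :=
    { toFun := fun f => r f
      map_add' := fun f g => by
        rw [← Submodule.coe_add]
        refine congrArg _ (eq_of_smul_sub_eq hH hc ?_)
        rw [hr, LinearPMap.map_add, Submodule.coe_add, smul_add, add_sub_add_comm, hr, hr]
      map_smul' := fun a f => by
        rw [RingHom.id_apply, ← Submodule.coe_smul]
        refine congrArg _ (eq_of_smul_sub_eq hH hc ?_)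
        rw [hr, LinearPMap.map_smul, Submodule.coe_smul, smul_comm, ← smul_sub, hr] }
  refine ⟨R₀.mkContinuous c⁻¹ fun f => ?_, hle, fun f => ⟨(r f).2, hr f⟩, fun x => ?_⟩
  · rw [inv_mul_eq_div, le_div_iff₀ hc, mul_comm]
    exact hle f
  · exact congrArg Subtype.val (eq_of_smul_sub_eq hH hc (hr _))

/-- The Lumer–Phillips theorem in Hilbert spaces. -/
theorem generatesContractionSemigroup_of_dissipative [CompleteSpace X] {H : X →ₗ.[ℂ] X}
    (hH : ∀ x : H.domain, (inner ℂ (x : X) (H x)).re ≤ 0)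
    (hr : ∀ c : ℝ, 0 < c → ∀ f, ∃ x : H.domain, (c : ℂ) • (x : X) - H x = f) :
    GeneratesContractionSemigroup H := by
  -- If `y` is orthogonal to the domain and `x - Hx = y`, then `‖x‖² = Re⟨x, Hx⟩ ≤ 0`, so `x` and
  -- `y` vanish.
  have hD : Dense (H.domain : Set X) := by
    rw [Submodule.dense_iff_topologicalClosure_eq_top, Submodule.topologicalClosure_eq_top_iff,
      Submodule.eq_bot_iff]
    intro y hy
    obtain ⟨x, hx⟩ := hr 1 one_pos y
    have h1 : inner ℂ (x : X) y = 0 := hy x x.2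
    have h2 := hH x
    have h3 : (inner ℂ (x : X) (((1 : ℝ) : ℂ) • (x : X) - H x)).re = 0 := by rw [hx, h1]; simp
    rw [inner_sub_right, Complex.sub_re, re_inner_smul_self] at h3
    have h4 : ‖(x : X)‖ = 0 := by
      have : ‖(x : X)‖ ^ 2 = 0 := le_antisymm (by linarith) (by positivity)
      simpa using this
    have h5 : x = 0 := Subtype.ext (norm_eq_zero.1 h4)
    rw [← hx, h5]
    simp
  set c : ℕ → ℝ := fun n => n + 1 with hc
  have hc0 : ∀ n, 0 < c n := fun n => by positivity
  choose R hRle hRdom hRinv using fun n => exists_resolvent hH (hc0 n) (hr _ (hc0 n))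
  -- The resolvent identity; exchanging `m` and `n` in it shows that the resolvents commute.
  have hres : ∀ m n, R m - R n = ((c n - c m : ℝ) : ℂ) • (R m * R n) := by
    intro m n
    ext f
    obtain ⟨h1, h2⟩ := hRdom n f
    have h3 := hRinv m ⟨R n f, h1⟩
    have h4 : f = ((c m : ℂ) • R n f - H ⟨R n f, h1⟩) + ((c n - c m : ℝ) : ℂ) • R n f := by
      rw [Complex.ofReal_sub, sub_smul]
      conv_lhs => rw [← h2]
      abel
    have h5 : R m f = R n f + ((c n - c m : ℝ) : ℂ) • R m (R n f) := by
      conv_lhs => rw [h4, map_add, h3, map_smul]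
    simp [h5]
  have hcommR : ∀ m n, Commute (R m) (R n) := by
    intro m n
    rcases eq_or_ne m n with rfl | hmn
    · exact Commute.refl _
    have h1 := hres m n
    have h2 := hres n m
    rw [← neg_sub, h1, ← neg_smul, ← Complex.ofReal_neg, neg_sub] at h2
    have h3 : ((c m - c n : ℝ) : ℂ) ≠ 0 := by
      rw [Complex.ofReal_ne_zero, sub_ne_zero]
      simp [hc, hmn]
    have h4 : ((c m - c n : ℝ) : ℂ) • (R m * R n) = ((c m - c n : ℝ) : ℂ) • (R n * R m) := by
      rw [← h2]
    exact smul_right_injective _ h3 h4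
  -- The Yosida approximations, equal to `c n • R n (H x)` on the domain. They are dissipative
  -- because `‖c n • R n x‖ ≤ ‖x‖`.
  let A : ℕ → X →L[ℂ] X := fun n => ((c n : ℝ) : ℂ) • (((c n : ℝ) : ℂ) • R n - 1)
  have hAapply : ∀ n x, A n x = ((c n : ℝ) : ℂ) • (((c n : ℝ) : ℂ) • R n x - x) := fun n x => by
    simp [A]
  have hA : ∀ n x, (inner ℂ x (A n x)).re ≤ 0 := by
    intro n x
    rw [hAapply, inner_smul_right, Complex.re_ofReal_mul]
    refine mul_nonpos_of_nonneg_of_nonpos (hc0 n).le ?_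
    have h1 : (inner ℂ x (R n x)).re ≤ ‖x‖ * ‖R n x‖ := re_inner_le_norm (𝕜 := ℂ) _ _
    have h2 : (inner ℂ x x).re = ‖x‖ ^ 2 := inner_self_eq_norm_sq (𝕜 := ℂ) x
    rw [inner_sub_right, Complex.sub_re, inner_smul_right, Complex.re_ofReal_mul, h2]
    have h3 := mul_le_mul_of_nonneg_left h1 (hc0 n).le
    have h4 := mul_le_mul_of_nonneg_left (hRle n x) (norm_nonneg x)
    nlinarith
  have hcommA : ∀ m n, Commute (A m) (A n) := fun m n =>
    (((((hcommR m n).smul_left _).smul_right _).sub_left (Commute.one_left _)).sub_right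
      (Commute.one_right _)).smul_left _ |>.smul_right _
  have hRH : ∀ n (x : H.domain), ((c n : ℝ) : ℂ) • R n x - x = R n (H x) := fun n x => by
    have := hRinv n x
    rw [map_sub, map_smul, sub_eq_iff_eq_add] at this
    rw [this]; abel
  have hclim : Tendsto c atTop atTop := tendsto_atTop_add_const_right _ _ tendsto_natCast_atTop_atTop
  have hRle' : ∀ n x, ‖((c n : ℝ) : ℂ) • R n x‖ ≤ ‖x‖ := fun n x => by
    rw [norm_smul, Complex.norm_of_nonneg (hc0 n).le]
    exact hRle n x
  -- On the domain the error `R n (H z)` has norm at most `‖H z‖ / c n`; density and the uniform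
  -- bound give the rest.
  have hlim : ∀ y : X, Tendsto (fun n => ((c n : ℝ) : ℂ) • R n y) atTop (𝓝 y) := by
    intro y
    refine Metric.tendsto_atTop.2 fun ε hε => ?_
    obtain ⟨z, hz, hzD⟩ := Metric.dense_iff.1 hD y (ε / 3) (by positivity)
    rw [Metric.mem_ball, dist_comm, dist_eq_norm] at hz
    obtain ⟨N, hN⟩ := (tendsto_atTop.1 hclim (3 * (‖H ⟨z, hzD⟩‖ + 1) / ε)).exists_forall_of_atTop
    refine ⟨N, fun n hn => ?_⟩
    have h1 := hRle n (H ⟨z, hzD⟩)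
    have h2 := hN n hn
    rw [div_le_iff₀ hε] at h2
    have h3 : ‖R n (H ⟨z, hzD⟩)‖ < ε / 3 := by
      by_contra! h4
      have := mul_le_mul_of_nonneg_left h4 (hc0 n).le
      linarith
    rw [← hRH n ⟨z, hzD⟩] at h3
    have h4 := hRle' n (y - z)
    have h5 : ((c n : ℝ) : ℂ) • R n y - y = ((c n : ℝ) : ℂ) • R n (y - z) +
        (((c n : ℝ) : ℂ) • R n z - z) - (y - z) := by
      rw [map_sub, smul_sub]; abel
    rw [dist_eq_norm, h5]
    have h6 := norm_sub_le (((c n : ℝ) : ℂ) • R n (y - z) + (((c n : ℝ) : ℂ) • R n z - z)) (y - z)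
    have h7 := norm_add_le (((c n : ℝ) : ℂ) • R n (y - z)) (((c n : ℝ) : ℂ) • R n z - z)
    simp only at h3
    linarith
  classical
  let h : X → X := fun x => if hx : x ∈ H.domain then H ⟨x, hx⟩ else 0
  have hh : ∀ x ∈ (H.domain : Set X), Tendsto (fun n => A n x) atTop (𝓝 (h x)) := by
    intro x hx
    have : h x = H ⟨x, hx⟩ := dif_pos hx
    rw [this]
    refine (hlim _).congr fun n => ?_
    rw [hAapply, ← hRH n ⟨x, hx⟩]
  obtain ⟨T, hT, hTlim⟩ := exists_isContractionSemigroup_of_tendsto hA hcommA hD hh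
  have hgraph : ∀ x : H.domain,
      Tendsto (fun t : ℝ≥0 => ((t : ℝ)⁻¹ : ℂ) • (T t x - x)) (𝓝[>] 0) (𝓝 (H x)) := fun x => by
    have := hTlim x x.2
    rwa [show h x = H x from dif_pos x.2] at this
  refine ⟨T, hT, fun x y => ⟨fun hxy => ?_, fun hxy => ?_⟩⟩
  · obtain ⟨z, rfl, rfl⟩ := (LinearPMap.mem_graph_iff H).1 hxy
    exact hgraph z
  -- The generator of `T` extends `H`. It is dissipative, so `1` minus it is injective, while `1 -
  -- H` is already onto; hence the extension is not proper.
  · obtain ⟨z, hz⟩ := hr 1 one_pos (x - y)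
    have h1 : Tendsto (fun t : ℝ≥0 => ((t : ℝ)⁻¹ : ℂ) • (T t (x - z) - (x - z))) (𝓝[>] 0)
        (𝓝 (y - H z)) := by
      refine (hxy.sub (hgraph z)).congr fun t => ?_
      rw [← smul_sub, map_sub, sub_sub_sub_comm]
    have h2 := mul_norm_le_norm_smul_sub (hT.re_inner_nonpos h1) 1
    rw [Complex.ofReal_one, one_smul] at hz
    have h3 : x - (z : X) - (y - H z) = 0 := by
      rw [sub_sub_sub_comm, hz, sub_self]
    rw [Complex.ofReal_one, one_smul, h3, norm_zero, one_mul] at h2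
    have h4 : x = z := sub_eq_zero.1 (norm_le_zero_iff.1 h2)
    have h5 : y = H z := by
      rw [h4, sub_self, zero_sub, neg_eq_zero] at h3
      exact sub_eq_zero.1 h3
    rw [h4, h5]
    exact H.mem_graph z

end HilleYosida

end PortHamiltonian

/-! ### Euclidean norms, bounds for the Hamiltonian, completeness of the weighted space -/

namespace PortHamiltonian

variable {d : ℕ}

/-- The squared Euclidean norm of a vector. -/
def sqNorm (ζ : Fin d → ℂ) : ℝ := ∑ i, ‖ζ i‖ ^ 2

lemma sqNorm_nonneg (ζ : Fin d → ℂ) : 0 ≤ sqNorm ζ := Finset.sum_nonneg fun _ _ => by positivity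

lemma sqNorm_zero : sqNorm (0 : Fin d → ℂ) = 0 := by simp [sqNorm]

@[fun_prop]
lemma continuous_sqNorm : Continuous (sqNorm : (Fin d → ℂ) → ℝ) := by
  unfold sqNorm; fun_prop

lemma star_dotProduct_self (ζ : Fin d → ℂ) : star ζ ⬝ᵥ ζ = (sqNorm ζ : ℂ) := by
  simp only [dotProduct, sqNorm, Complex.ofReal_sum, Pi.star_apply]
  refine Finset.sum_congr rfl fun i _ => ?_
  rw [Complex.ofReal_pow]
  exact Complex.conj_mul' _

lemma sqNorm_smul (c : ℂ) (ζ : Fin d → ℂ) : sqNorm (c • ζ) = ‖c‖ ^ 2 * sqNorm ζ := by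
  simp [sqNorm, mul_pow, Finset.mul_sum]

lemma sqNorm_add_le (a b : Fin d → ℂ) : sqNorm (a + b) ≤ 2 * sqNorm a + 2 * sqNorm b := by
  simp only [sqNorm, Finset.mul_sum, ← Finset.sum_add_distrib]
  refine Finset.sum_le_sum fun i _ => ?_
  have h1 := norm_add_le (a i) (b i)
  have h2 := sq_nonneg (‖a i‖ - ‖b i‖)
  have h3 := pow_le_pow_left₀ (norm_nonneg _) h1 2
  rw [Pi.add_apply]
  nlinarith

lemma norm_sq_le_sqNorm (ζ : Fin d → ℂ) : ‖ζ‖ ^ 2 ≤ sqNorm ζ := by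
  have h : ‖ζ‖ ≤ √(sqNorm ζ) := by
    refine (pi_norm_le_iff_of_nonneg (Real.sqrt_nonneg _)).2 fun i => Real.le_sqrt_of_sq_le ?_
    exact Finset.single_le_sum (f := fun i => ‖ζ i‖ ^ 2) (fun _ _ => by positivity) (Finset.mem_univ i)
  calc ‖ζ‖ ^ 2 ≤ √(sqNorm ζ) ^ 2 := pow_le_pow_left₀ (norm_nonneg _) h 2
    _ = sqNorm ζ := Real.sq_sqrt (sqNorm_nonneg ζ)

lemma sqNorm_le_norm_sq (ζ : Fin d → ℂ) : sqNorm ζ ≤ d * ‖ζ‖ ^ 2 := by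
  calc sqNorm ζ ≤ ∑ _i : Fin d, ‖ζ‖ ^ 2 := Finset.sum_le_sum fun i _ =>
        pow_le_pow_left₀ (norm_nonneg _) (norm_le_pi_norm ζ i) 2
    _ = d * ‖ζ‖ ^ 2 := by simp

lemma sqNorm_eq_zero {ζ : Fin d → ℂ} (h : sqNorm ζ = 0) : ζ = 0 := by
  have h1 := norm_sq_le_sqNorm ζ
  rw [h] at h1
  have h2 : ‖ζ‖ ^ 2 = 0 := le_antisymm h1 (by positivity)
  simpa using h2

lemma norm_dotProduct_le (a b : Fin d → ℂ) : 2 * ‖star a ⬝ᵥ b‖ ≤ sqNorm a + sqNorm b := by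
  have h1 : ‖star a ⬝ᵥ b‖ ≤ ∑ i, ‖a i‖ * ‖b i‖ := by
    refine (norm_sum_le _ _).trans (Finset.sum_le_sum fun i _ => ?_)
    simp
  rw [sqNorm, sqNorm, ← Finset.sum_add_distrib]
  refine (mul_le_mul_of_nonneg_left h1 zero_le_two).trans ?_
  rw [Finset.mul_sum]
  exact Finset.sum_le_sum fun i _ => by nlinarith [sq_nonneg (‖a i‖ - ‖b i‖)]

/-- Bound of `M *ᵥ ζ` in terms of a bound of the entries of `M`. -/
lemma sqNorm_mulVec_le {M : Matrix (Fin d) (Fin d) ℂ} {C : ℝ} (hM : ∀ i j, ‖M i j‖ ≤ C)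
    (ζ : Fin d → ℂ) : sqNorm (M *ᵥ ζ) ≤ d * (d * C) ^ 2 * sqNorm ζ := by
  refine (sqNorm_le_norm_sq _).trans ?_
  rw [mul_assoc]
  refine mul_le_mul_of_nonneg_left ?_ (by positivity)
  have h1 : ‖M *ᵥ ζ‖ ≤ |d * C| * ‖ζ‖ := by
    refine (pi_norm_le_iff_of_nonneg (by positivity)).2 fun i => ?_
    calc ‖(M *ᵥ ζ) i‖ ≤ ∑ j, ‖M i j‖ * ‖ζ j‖ := by
          change ‖∑ j, M i j * ζ j‖ ≤ _
          exact (norm_sum_le _ _).trans (Finset.sum_le_sum fun j _ => (norm_mul _ _).le)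
      _ ≤ ∑ _j : Fin d, C * ‖ζ‖ := Finset.sum_le_sum fun j _ =>
          mul_le_mul (hM i j) (norm_le_pi_norm ζ j) (norm_nonneg _) ((norm_nonneg _).trans (hM i j))
      _ = (d * C) * ‖ζ‖ := by simp [mul_assoc]
      _ ≤ |d * C| * ‖ζ‖ := mul_le_mul_of_nonneg_right (le_abs_self _) (norm_nonneg _)
  calc ‖M *ᵥ ζ‖ ^ 2 ≤ (|d * C| * ‖ζ‖) ^ 2 := pow_le_pow_left₀ (norm_nonneg _) h1 2
    _ = (d * C) ^ 2 * ‖ζ‖ ^ 2 := by rw [mul_pow, sq_abs]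
    _ ≤ (d * C) ^ 2 * sqNorm ζ := mul_le_mul_of_nonneg_left (norm_sq_le_sqNorm ζ) (by positivity)

lemma exists_sqNorm_mulVec_le (M : Matrix (Fin d) (Fin d) ℂ) :
    ∃ C : ℝ, 0 < C ∧ ∀ ζ, sqNorm (M *ᵥ ζ) ≤ C * sqNorm ζ := by
  refine ⟨d * (d * ∑ i, ∑ j, ‖M i j‖) ^ 2 + 1, by positivity, fun ζ => ?_⟩
  refine (sqNorm_mulVec_le (C := ∑ i, ∑ j, ‖M i j‖) (fun i j => ?_) ζ).trans ?_
  · refine le_trans ?_ (Finset.single_le_sum (f := fun i => ∑ j, ‖M i j‖)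
      (fun i _ => Finset.sum_nonneg fun j _ => norm_nonneg _) (Finset.mem_univ i))
    exact Finset.single_le_sum (f := fun j => ‖M i j‖) (fun j _ => norm_nonneg _) (Finset.mem_univ j)
  · nlinarith [sqNorm_nonneg ζ]

lemma semiAxis_eq_restrict_Ioi : semiAxis = volume.restrict (Ioi (0 : ℝ)) :=
  restrict_Ioi_eq_restrict_Ici.symm

namespace Hamiltonian

variable {ℋ : Hamiltonian d}

lemma form_re_nonneg_ae : ∀ᵐ ξ ∂semiAxis, ∀ ζ : Fin d → ℂ, 0 ≤ (star ζ ⬝ᵥ ℋ ξ *ᵥ ζ).re := by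
  filter_upwards [ℋ.lower_bound_ae] with ξ ⟨m, hm, h⟩ ζ
  exact le_trans (by positivity) (h ζ)

variable (ℋ) in
/-- Locally uniform lower bounds, depending only on the integer part of the argument. -/
lemma exists_floor_lower_bound : ∃ m : ℕ → ℝ, (∀ n, 0 < m n) ∧ ∀ᵐ ξ ∂semiAxis,
    ∀ ζ : Fin d → ℂ, m ⌊ξ⌋₊ * sqNorm ζ ≤ (star ζ ⬝ᵥ ℋ ξ *ᵥ ζ).re := by
  choose m hm h using fun n : ℕ => lower_bound (ℋ := ℋ) (n + 1)
  refine ⟨m, hm, ?_⟩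
  filter_upwards [ae_all_iff.2 h] with ξ hξ
  exact hξ _ (Nat.lt_floor_add_one ξ).le

/-- The first bound says that `ℋx` is square integrable without weight whenever `x ∈ L²_ℋ`, although
`ℋ` has no global lower bound. It is `dot_bound` for the pair `tℋζ`, `ζ`. -/
lemma Bounded.exists_bounds (hℋ : ℋ.Bounded) : ∃ K : ℝ, 0 < K ∧ ∀ᵐ ξ ∂semiAxis,
    ∀ ζ : Fin d → ℂ, sqNorm (ℋ ξ *ᵥ ζ) ≤ K * (star ζ ⬝ᵥ ℋ ξ *ᵥ ζ).re ∧
      (star ζ ⬝ᵥ ℋ ξ *ᵥ ζ).re ≤ K * sqNorm ζ := by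
  obtain ⟨C, hC⟩ := hℋ
  set B : ℝ := (1 + d * (d * C) ^ 2) / 2 with hB
  have hB0 : 0 < B := by positivity
  refine ⟨4 * B, by positivity, ?_⟩
  filter_upwards [hC, ℋ.form_re_nonneg_ae, ℋ.hermitian] with ξ h1 h2 h3
  have hup : ∀ ζ : Fin d → ℂ, (star ζ ⬝ᵥ ℋ ξ *ᵥ ζ).re ≤ B * sqNorm ζ := by
    intro ζ
    have h4 := norm_dotProduct_le ζ (ℋ ξ *ᵥ ζ)
    have h5 := sqNorm_mulVec_le h1 ζ
    have h6 := Complex.re_le_norm (star ζ ⬝ᵥ ℋ ξ *ᵥ ζ)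
    rw [hB]
    linarith
  intro ζ
  refine ⟨?_, (hup ζ).trans (by nlinarith [sqNorm_nonneg ζ])⟩
  -- With this `t` the quadratic term `t²B|ℋζ|²` is half of the left side `t|ℋζ|²` and is absorbed
  -- by it.
  set t : ℝ := (2 * B)⁻¹ with ht
  have ht0 : 0 < t := by positivity
  have htB : t * B = 1 / 2 := by rw [ht]; field_simp
  have h4 := dot_bound h3 h2 ((t : ℂ) • (ℋ ξ *ᵥ ζ)) ζ
  have h5 := hup ((t : ℂ) • (ℋ ξ *ᵥ ζ))
  rw [sqNorm_smul, Complex.norm_of_nonneg ht0.le] at h5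
  rw [star_smul, smul_dotProduct, star_dotProduct_self] at h4
  have h6 : ‖star (t : ℂ) • (sqNorm (ℋ ξ *ᵥ ζ) : ℂ)‖ = t * sqNorm (ℋ ξ *ᵥ ζ) := by
    rw [norm_smul, norm_star, Complex.norm_of_nonneg ht0.le,
      Complex.norm_of_nonneg (sqNorm_nonneg _)]
  rw [← star_smul, h6] at h4
  have h7 : B * (t ^ 2 * sqNorm (ℋ ξ *ᵥ ζ)) = t * sqNorm (ℋ ξ *ᵥ ζ) / 2 := by
    rw [sq]; linear_combination (t * sqNorm (ℋ ξ *ᵥ ζ)) * htB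
  have h8 : t * sqNorm (ℋ ξ *ᵥ ζ) ≤ 2 * (star ζ ⬝ᵥ ℋ ξ *ᵥ ζ).re := by linarith
  have h9 := mul_le_mul_of_nonneg_left h8 (show 0 ≤ 2 * B by positivity)
  have h10 : 2 * B * (t * sqNorm (ℋ ξ *ᵥ ζ)) = sqNorm (ℋ ξ *ᵥ ζ) := by
    linear_combination (2 * sqNorm (ℋ ξ *ᵥ ζ)) * htB
  linarith

lemma aestronglyMeasurable_apply {f : ℝ → Fin d → ℂ} {μ : Measure ℝ}
    (hf : AEStronglyMeasurable f μ) (i : Fin d) : AEMeasurable (fun ξ => f ξ i) μ :=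
  (measurable_pi_apply i).comp_aemeasurable hf.aemeasurable

lemma aestronglyMeasurable_mulVec {A : ℝ → Matrix (Fin d) (Fin d) ℂ} {μ : Measure ℝ}
    (hA : ∀ i j, AEMeasurable (fun ξ => A ξ i j) μ) {f : ℝ → Fin d → ℂ}
    (hf : AEStronglyMeasurable f μ) : AEStronglyMeasurable (fun ξ => A ξ *ᵥ f ξ) μ := by
  refine (aemeasurable_pi_lambda _ fun i => ?_).aestronglyMeasurable
  change AEMeasurable (fun ξ => ∑ j, A ξ i j * f ξ j) μ
  exact Finset.aemeasurable_fun_sum _ fun j _ => (hA i j).mul (aestronglyMeasurable_apply hf j)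

lemma aestronglyMeasurable_dotProduct {f g : ℝ → Fin d → ℂ} {μ : Measure ℝ}
    (hf : AEStronglyMeasurable f μ) (hg : AEStronglyMeasurable g μ) :
    AEStronglyMeasurable (fun ξ => star (f ξ) ⬝ᵥ g ξ) μ := by
  refine AEMeasurable.aestronglyMeasurable ?_
  exact Finset.aemeasurable_fun_sum _ fun i _ =>
    (Complex.continuous_conj.measurable.comp_aemeasurable (aestronglyMeasurable_apply hf i)).mul
      (aestronglyMeasurable_apply hg i)

lemma aestronglyMeasurable_const_mulVec (M : Matrix (Fin d) (Fin d) ℂ) {f : ℝ → Fin d → ℂ}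
    {μ : Measure ℝ} (hf : AEStronglyMeasurable f μ) :
    AEStronglyMeasurable (fun ξ => M *ᵥ f ξ) μ :=
  (Continuous.matrix_mulVec continuous_const continuous_id).comp_aestronglyMeasurable hf

lemma aestronglyMeasurable_form {f g : ℝ → Fin d → ℂ} (hf : AEStronglyMeasurable f semiAxis)
    (hg : AEStronglyMeasurable g semiAxis) : AEStronglyMeasurable (ℋ.form f g) semiAxis :=
  aestronglyMeasurable_dotProduct hf (aestronglyMeasurable_mulVec ℋ.aemeasurable hg)

lemma memL2_of_le {f : ℝ → Fin d → ℂ} (hf : AEStronglyMeasurable f semiAxis) {G : ℝ → ℝ}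
    (hG : Integrable G semiAxis) (h : ∀ᵐ ξ ∂semiAxis, (ℋ.form f f ξ).re ≤ G ξ) : ℋ.MemL2 f := by
  refine ⟨hf, (hG.const_mul 2).mono' (aestronglyMeasurable_form hf hf) ?_⟩
  filter_upwards [h, ℋ.form_re_nonneg_ae, ℋ.hermitian] with ξ h1 h2 h3
  have := dot_bound h3 h2 (f ξ) (f ξ)
  simp only [form] at h1 ⊢
  linarith

lemma MemL2.of_sqNorm (hℋ : ℋ.Bounded) {f : ℝ → Fin d → ℂ} (hf : AEStronglyMeasurable f semiAxis)
    (h : Integrable (fun ξ => sqNorm (f ξ)) semiAxis) : ℋ.MemL2 f := by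
  obtain ⟨K, -, hK⟩ := hℋ.exists_bounds
  refine memL2_of_le hf (h.const_mul K) ?_
  filter_upwards [hK] with ξ h1
  exact (h1 (f ξ)).2

lemma MemL2.integrable_sqNorm_mul (hℋ : ℋ.Bounded) {f : ℝ → Fin d → ℂ} (hf : ℋ.MemL2 f) :
    Integrable (fun ξ => sqNorm (ℋ ξ *ᵥ f ξ)) semiAxis := by
  obtain ⟨K, -, hK⟩ := hℋ.exists_bounds
  refine (hf.2.re.const_mul K).mono' ?_ ?_
  · exact continuous_sqNorm.comp_aestronglyMeasurable (aestronglyMeasurable_mulVec ℋ.aemeasurable hf.1)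
  · filter_upwards [hK] with ξ h1
    rw [Real.norm_of_nonneg (sqNorm_nonneg _)]
    exact (h1 (f ξ)).1

lemma integrable_sqNorm_const_mulVec (M : Matrix (Fin d) (Fin d) ℂ) {f : ℝ → Fin d → ℂ}
    (hf : AEStronglyMeasurable f semiAxis) (h : Integrable (fun ξ => sqNorm (f ξ)) semiAxis) :
    Integrable (fun ξ => sqNorm (M *ᵥ f ξ)) semiAxis := by
  obtain ⟨C, -, hC⟩ := exists_sqNorm_mulVec_le M
  refine (h.const_mul C).mono' ?_ (Eventually.of_forall fun ξ => ?_)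
  · exact continuous_sqNorm.comp_aestronglyMeasurable (aestronglyMeasurable_const_mulVec M hf)
  · rw [Real.norm_of_nonneg (sqNorm_nonneg _)]
    exact hC _

/-- `M ℋ f` belongs to `L²_ℋ` for every constant matrix `M`. -/
lemma MemL2.mulVec_mul (hℋ : ℋ.Bounded) (M : Matrix (Fin d) (Fin d) ℂ) {f : ℝ → Fin d → ℂ}
    (hf : ℋ.MemL2 f) : ℋ.MemL2 (fun ξ => M *ᵥ (ℋ ξ *ᵥ f ξ)) := by
  have h1 := aestronglyMeasurable_mulVec ℋ.aemeasurable hf.1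
  exact MemL2.of_sqNorm hℋ (aestronglyMeasurable_const_mulVec M h1)
    (integrable_sqNorm_const_mulVec M h1 (hf.integrable_sqNorm_mul hℋ))

lemma MemL2.integrableOn {f : ℝ → Fin d → ℂ} (hf : ℋ.MemL2 f) (R : ℝ) :
    IntegrableOn f (Icc 0 R) := by
  have hle : volume.restrict (Icc (0 : ℝ) R) ≤ semiAxis :=
    Measure.restrict_mono (fun x hx => hx.1) le_rfl
  have h1 : IntegrableOn (fun _ => (1 : ℝ)) (Icc 0 R) := integrableOn_const (by simp)
  refine (h1.add (hf.integrableOn_sq R)).mono' (hf.1.mono_measure hle) ?_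
  refine Eventually.of_forall fun ξ => ?_
  have h2 := norm_sq_le_sqNorm (f ξ)
  simp only [Pi.add_apply]
  change _ ≤ 1 + sqNorm (f ξ)
  nlinarith [sq_nonneg (‖f ξ‖ - 1)]

/-- The element of `L²_ℋ` represented by a function. -/
def L2.mk (f : ℝ → Fin d → ℂ) (hf : ℋ.MemL2 f) : ℋ.L2 :=
  ⟨AEEqFun.mk f hf.1, hf.congr (AEEqFun.coeFn_mk f hf.1).symm⟩

lemma L2.coe_mk (f : ℝ → Fin d → ℂ) (hf : ℋ.MemL2 f) : ⇑(L2.mk f hf) =ᵐ[semiAxis] f :=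
  AEEqFun.coeFn_mk f hf.1

lemma L2.ext_ae {x y : ℋ.L2} (h : ⇑x =ᵐ[semiAxis] ⇑y) : x = y := Subtype.ext (AEEqFun.ext h)

lemma L2.coe_sub (x y : ℋ.L2) : ⇑(x - y) =ᵐ[semiAxis] ⇑x - ⇑y := AEEqFun.coeFn_sub x.1 y.1

lemma L2.inner_def (x y : ℋ.L2) : inner ℂ x y = ∫ ξ, ℋ.form x y ξ ∂semiAxis := rfl

lemma L2.norm_sq_eq (x : ℋ.L2) : ‖x‖ ^ 2 = ∫ ξ, (ℋ.form x x ξ).re ∂semiAxis := by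
  rw [← inner_self_eq_norm_sq (𝕜 := ℂ), L2.inner_def]
  exact (integral_re x.memL2.2).symm

lemma form_sub_self (f g : ℝ → Fin d → ℂ) (ξ : ℝ) :
    ℋ.form (f - g) (f - g) ξ = star (f ξ - g ξ) ⬝ᵥ (ℋ ξ *ᵥ (f ξ - g ξ)) := rfl

lemma L2.ofReal_norm_sq (x : ℋ.L2) :
    ENNReal.ofReal (‖x‖ ^ 2) = ∫⁻ ξ, ENNReal.ofReal (ℋ.form x x ξ).re ∂semiAxis := by
  rw [L2.norm_sq_eq]
  exact ofReal_integral_eq_lintegral_ofReal x.memL2.2.re (form_ae_nonneg _)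

/-- Multiplication by the square root of the local lower bound maps `L²_ℋ` contractively into the
unweighted `L²`, so a Cauchy sequence has a subsequence converging almost everywhere. Fatou's lemma
for the weighted norm shows that the pointwise limit is the limit in `L²_ℋ`. -/
instance : CompleteSpace ℋ.L2 := by
  refine Metric.complete_of_cauchySeq_tendsto fun x hx => ?_
  obtain ⟨m, hm, hmle⟩ := ℋ.exists_floor_lower_bound
  have hmeas : Measurable fun ξ : ℝ => m ⌊ξ⌋₊ := measurable_from_nat.comp Nat.measurable_floor
  let J : ℋ.L2 → ℝ → Fin d → ℂ := fun x ξ => √(m ⌊ξ⌋₊) • x ξ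
  have hJm : ∀ x, AEStronglyMeasurable (J x) semiAxis := fun x =>
    hmeas.sqrt.aestronglyMeasurable.smul x.memL2.1
  have hJle : ∀ x, eLpNorm (J x) 2 semiAxis ≤ ENNReal.ofReal ‖x‖ := by
    intro x
    have h1 : eLpNorm (J x) 2 semiAxis ^ 2 ≤ ENNReal.ofReal ‖x‖ ^ 2 := by
      rw [← ENNReal.ofReal_pow (norm_nonneg _), L2.ofReal_norm_sq,
        eLpNorm_eq_lintegral_rpow_enorm_toReal two_ne_zero ENNReal.ofNat_ne_top]
      simp only [ENNReal.toReal_ofNat, one_div]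
      rw [← ENNReal.rpow_natCast, ← ENNReal.rpow_mul]
      norm_num
      refine lintegral_mono_ae ?_
      filter_upwards [hmle] with ξ h
      rw [← ofReal_norm, ← ENNReal.ofReal_pow (norm_nonneg _)]
      refine ENNReal.ofReal_le_ofReal (le_trans ?_ (h (x ξ)))
      rw [norm_smul, mul_pow, Real.norm_of_nonneg (Real.sqrt_nonneg _), Real.sq_sqrt (hm _).le]
      exact mul_le_mul_of_nonneg_left (norm_sq_le_sqNorm _) (hm _).le
    exact (ENNReal.pow_le_pow_left_iff two_ne_zero).1 h1
  have hJL : ∀ x, MemLp (J x) 2 semiAxis := fun x =>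
    ⟨hJm x, (hJle x).trans_lt ENNReal.ofReal_lt_top⟩
  have hJsub : ∀ x y, J (x - y) =ᵐ[semiAxis] J x - J y := by
    intro x y
    filter_upwards [L2.coe_sub x y] with ξ h
    simp only [J, h, Pi.sub_apply, smul_sub]
  let Y : ℕ → Lp (Fin d → ℂ) 2 semiAxis := fun n => (hJL (x n)).toLp
  have hYle : ∀ n k, dist (Y n) (Y k) ≤ dist (x n) (x k) := by
    intro n k
    rw [dist_eq_norm, dist_eq_norm, ← MemLp.toLp_sub, Lp.norm_toLp, ← eLpNorm_congr_ae (hJsub _ _)]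
    exact ENNReal.toReal_le_of_le_ofReal (norm_nonneg _) (hJle _)
  have hY : CauchySeq Y := by
    refine Metric.cauchySeq_iff.2 fun ε hε => ?_
    obtain ⟨N, hN⟩ := Metric.cauchySeq_iff.1 hx ε hε
    exact ⟨N, fun k hk n hn => (hYle k n).trans_lt (hN k hk n hn)⟩
  obtain ⟨y, hy⟩ := cauchySeq_tendsto_of_complete hY
  obtain ⟨φ, hφ, hφy⟩ := (tendstoInMeasure_of_tendsto_Lp hy).exists_seq_tendsto_ae
  let f : ℝ → Fin d → ℂ := fun ξ => (√(m ⌊ξ⌋₊))⁻¹ • y ξ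
  have hfm : AEStronglyMeasurable f semiAxis :=
    hmeas.sqrt.inv.aestronglyMeasurable.smul (Lp.aestronglyMeasurable y)
  have hlim : ∀ᵐ ξ ∂semiAxis, Tendsto (fun k => x (φ k) ξ) atTop (𝓝 (f ξ)) := by
    filter_upwards [hφy, ae_all_iff.2 fun k => (hJL (x (φ k))).coeFn_toLp] with ξ h1 h2
    refine (h1.const_smul (√(m ⌊ξ⌋₊))⁻¹).congr fun k => ?_
    rw [h2 k]
    simp only [J, smul_smul]
    rw [inv_mul_cancel₀ (Real.sqrt_pos.2 (hm _)).ne', one_smul]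
  have hFatou : ∀ ε > 0, ∀ N, (∀ k ≥ N, ∀ n ≥ N, dist (x k) (x n) < ε) → ∀ n ≥ N,
      ∫⁻ ξ, ENNReal.ofReal (ℋ.form (f - x n) (f - x n) ξ).re ∂semiAxis ≤ ENNReal.ofReal (ε ^ 2) := by
    intro ε hε N hN n hn
    have h1 : ∀ᵐ ξ ∂semiAxis, ENNReal.ofReal (ℋ.form (f - x n) (f - x n) ξ).re ≤
        liminf (fun k => ENNReal.ofReal
          (ℋ.form (⇑(x (φ k) - x n)) (⇑(x (φ k) - x n)) ξ).re) atTop := by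
      filter_upwards [hlim, ae_all_iff.2 fun k => form_congr (ℋ := ℋ) (L2.coe_sub (x (φ k)) (x n))
        (L2.coe_sub (x (φ k)) (x n))] with ξ h2 h3
      refine le_of_eq (Tendsto.liminf_eq ?_).symm
      refine (ENNReal.continuous_ofReal.tendsto _).comp ?_
      refine ((Complex.continuous_re.tendsto _).comp ?_)
      simp only [h3, form_sub_self]
      have hc : Continuous fun ζ : Fin d → ℂ => star (ζ - x n ξ) ⬝ᵥ (ℋ ξ *ᵥ (ζ - x n ξ)) := by
        refine Continuous.dotProduct (by fun_prop) (Continuous.matrix_mulVec continuous_const (by fun_prop))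
      exact (hc.tendsto (f ξ)).comp h2
    refine (lintegral_mono_ae h1).trans ((lintegral_liminf_le' fun k => ?_).trans ?_)
    · exact ((aestronglyMeasurable_form (x (φ k) - x n).memL2.1
        (x (φ k) - x n).memL2.1).aemeasurable.re).ennreal_ofReal
    · refine liminf_le_of_frequently_le' (Eventually.frequently ?_)
      filter_upwards [eventually_ge_atTop N] with k hk
      rw [← L2.ofReal_norm_sq]
      refine ENNReal.ofReal_le_ofReal (pow_le_pow_left₀ (norm_nonneg _) ?_ 2)
      rw [← dist_eq_norm]
      exact (hN _ (hk.trans hφ.le_apply) n hn).le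
  have hsub : ∀ n, AEStronglyMeasurable (f - ⇑(x n)) semiAxis := fun n => hfm.sub (x n).memL2.1
  have hfL : ℋ.MemL2 f := by
    obtain ⟨N, hN⟩ := Metric.cauchySeq_iff.1 hx 1 one_pos
    have h1 := hFatou 1 one_pos N hN N le_rfl
    have h2 : ℋ.MemL2 (f - ⇑(x N)) := by
      refine memL2_of_le (hsub N) (G := fun ξ => (ℋ.form (f - x N) (f - x N) ξ).re) ?_
        (Eventually.of_forall fun _ => le_rfl)
      refine ⟨(aestronglyMeasurable_form (hsub N) (hsub N)).re, ?_⟩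
      rw [hasFiniteIntegral_iff_ofReal (form_ae_nonneg _)]
      exact h1.trans_lt ENNReal.ofReal_lt_top
    have h3 := h2.add (x N).memL2
    rwa [sub_add_cancel] at h3
  refine ⟨L2.mk f hfL, Metric.tendsto_atTop.2 fun ε hε => ?_⟩
  obtain ⟨N, hN⟩ := Metric.cauchySeq_iff.1 hx (ε / 2) (by positivity)
  refine ⟨N, fun n hn => ?_⟩
  have h1 := hFatou (ε / 2) (by positivity) N hN n hn
  have h2 : ⇑(L2.mk f hfL - x n) =ᵐ[semiAxis] f - ⇑(x n) :=
    (L2.coe_sub _ _).trans ((L2.coe_mk f hfL).sub (ae_eq_refl _))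
  have h3 : ENNReal.ofReal (‖L2.mk f hfL - x n‖ ^ 2) ≤ ENNReal.ofReal ((ε / 2) ^ 2) := by
    rw [L2.ofReal_norm_sq]
    refine le_trans (le_of_eq (lintegral_congr_ae ?_)) h1
    filter_upwards [form_congr (ℋ := ℋ) h2 h2] with ξ h4
    rw [h4]
  rw [ENNReal.ofReal_le_ofReal_iff (by positivity)] at h3
  rw [dist_comm, dist_eq_norm]
  have h4 := le_of_sq_le_sq h3 (by positivity)
  linarith

end Hamiltonian

end PortHamiltonian

namespace PortHamiltonian

/-! ### Absolutely continuous functions and integration by parts -/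

section ProductRule

variable {f g F G : ℝ → ℝ} {R : ℝ}

lemma continuousOn_of_eq_add_integral {E : Type*} [NormedAddCommGroup E] [NormedSpace ℝ E]
    {f F : ℝ → E} (hR : 0 ≤ R) (hf : IntervalIntegrable f volume 0 R)
    (hF : ∀ ξ ∈ Icc 0 R, F ξ = F 0 + ∫ t in (0 : ℝ)..ξ, f t) : ContinuousOn F (Icc 0 R) := by
  have h := intervalIntegral.continuousOn_primitive_interval' hf left_mem_uIcc
  rw [uIcc_of_le hR] at h
  exact (continuousOn_const.add h).congr hF

lemma intervalIntegrable_mul_add_mul {𝕜 : Type*} [RCLike 𝕜] {f g F G : ℝ → 𝕜} (hR : 0 ≤ R)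
    (hf : IntervalIntegrable f volume 0 R) (hg : IntervalIntegrable g volume 0 R)
    (hF : ContinuousOn F (Icc 0 R)) (hG : ContinuousOn G (Icc 0 R)) :
    IntervalIntegrable (fun ξ => f ξ * G ξ + F ξ * g ξ) volume 0 R := by
  rw [← uIcc_of_le hR] at hF hG
  exact (hf.mul_continuousOn hG).add (hg.continuousOn_mul hF)

/-- On `[0, R]` both functions agree with a constant plus a primitive, hence are absolutely
continuous; Lebesgue differentiation identifies their derivatives almost everywhere. -/
lemma integral_mul_add_mul_real (hR : 0 ≤ R) (hf : IntervalIntegrable f volume 0 R)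
    (hg : IntervalIntegrable g volume 0 R) (hF : ∀ ξ ∈ Icc 0 R, F ξ = F 0 + ∫ t in (0 : ℝ)..ξ, f t)
    (hG : ∀ ξ ∈ Icc 0 R, G ξ = G 0 + ∫ t in (0 : ℝ)..ξ, g t) :
    ∫ ξ in (0 : ℝ)..R, (f ξ * G ξ + F ξ * g ξ) = F R * G R - F 0 * G 0 := by
  have hc : ∀ c : ℝ, AbsolutelyContinuousOnInterval (fun _ : ℝ => c) 0 R := fun c =>
    contDiffOn_const.absolutelyContinuousOnInterval
  have h1 := (hc (F 0)).add (hf.absolutelyContinuousOnInterval_intervalIntegral left_mem_uIcc)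
  have h2 := (hc (G 0)).add (hg.absolutelyContinuousOnInterval_intervalIntegral left_mem_uIcc)
  have h3 := h1.integral_deriv_mul_eq_sub h2
  simp only [Pi.add_apply, intervalIntegral.integral_same, add_zero] at h3
  rw [← hF R ⟨hR, le_rfl⟩, ← hG R ⟨hR, le_rfl⟩] at h3
  rw [← h3]
  refine intervalIntegral.integral_congr_ae ?_
  filter_upwards [hf.ae_hasDerivAt_integral, hg.ae_hasDerivAt_integral] with ξ h4 h5 hξ
  have hξ' : ξ ∈ uIcc 0 R := uIoc_subset_uIcc hξ
  have h6 := ((h4 hξ' 0 left_mem_uIcc).const_add (F 0)).deriv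
  have h7 := ((h5 hξ' 0 left_mem_uIcc).const_add (G 0)).deriv
  rw [uIcc_of_le hR] at hξ'
  rw [hF ξ hξ', hG ξ hξ']
  congr 2
  · exact h6.symm
  · exact h7.symm

lemma integral_mul_add_mul {f g F G : ℝ → ℂ} (hR : 0 ≤ R) (hf : IntervalIntegrable f volume 0 R)
    (hg : IntervalIntegrable g volume 0 R) (hF : ∀ ξ ∈ Icc 0 R, F ξ = F 0 + ∫ t in (0 : ℝ)..ξ, f t)
    (hG : ∀ ξ ∈ Icc 0 R, G ξ = G 0 + ∫ t in (0 : ℝ)..ξ, g t) :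
    ∫ ξ in (0 : ℝ)..R, (f ξ * G ξ + F ξ * g ξ) = F R * G R - F 0 * G 0 := by
  have hi : ∀ {k : ℝ → ℂ} (L : ℂ →L[ℝ] ℝ), IntervalIntegrable k volume 0 R →
      IntervalIntegrable (fun t => L (k t)) volume 0 R := fun L hk =>
    ⟨L.integrable_comp hk.1, L.integrable_comp hk.2⟩
  have hp : ∀ {k K : ℝ → ℂ} (L : ℂ →L[ℝ] ℝ), IntervalIntegrable k volume 0 R →
      (∀ ξ ∈ Icc 0 R, K ξ = K 0 + ∫ t in (0 : ℝ)..ξ, k t) →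
      ∀ ξ ∈ Icc 0 R, L (K ξ) = L (K 0) + ∫ t in (0 : ℝ)..ξ, L (k t) := by
    intro k K L hk hK ξ hξ
    have : IntervalIntegrable k volume 0 ξ := hk.mono_set (by
      rw [uIcc_of_le hR, uIcc_of_le hξ.1]; exact Icc_subset_Icc_right hξ.2)
    rw [hK ξ hξ, map_add, L.intervalIntegral_comp_comm this]
  have hreal : ∀ {k K l L : ℝ → ℂ} (A B : ℂ →L[ℝ] ℝ), IntervalIntegrable k volume 0 R →
      (∀ ξ ∈ Icc 0 R, K ξ = K 0 + ∫ t in (0 : ℝ)..ξ, k t) → IntervalIntegrable l volume 0 R →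
      (∀ ξ ∈ Icc 0 R, L ξ = L 0 + ∫ t in (0 : ℝ)..ξ, l t) →
      IntervalIntegrable (fun ξ => A (k ξ) * B (L ξ) + A (K ξ) * B (l ξ)) volume 0 R ∧
      ∫ ξ in (0 : ℝ)..R, (A (k ξ) * B (L ξ) + A (K ξ) * B (l ξ)) =
        A (K R) * B (L R) - A (K 0) * B (L 0) := by
    intro k K l L A B hk hK hl hL
    refine ⟨intervalIntegrable_mul_add_mul hR (hi A hk) (hi B hl)
      (A.continuous.comp_continuousOn (continuousOn_of_eq_add_integral hR hk hK))
      (B.continuous.comp_continuousOn (continuousOn_of_eq_add_integral hR hl hL)), ?_⟩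
    exact integral_mul_add_mul_real hR (F := fun ξ => A (K ξ)) (G := fun ξ => B (L ξ))
      (hi A hk) (hi B hl) (hp A hk hK) (hp B hl hL)
  have hint := intervalIntegrable_mul_add_mul hR hf hg (continuousOn_of_eq_add_integral hR hf hF)
    (continuousOn_of_eq_add_integral hR hg hG)
  obtain ⟨i1, e1⟩ := hreal Complex.reCLM Complex.reCLM hf hF hg hG
  obtain ⟨i2, e2⟩ := hreal Complex.imCLM Complex.imCLM hf hF hg hG
  obtain ⟨i3, e3⟩ := hreal Complex.reCLM Complex.imCLM hf hF hg hG
  obtain ⟨i4, e4⟩ := hreal Complex.imCLM Complex.reCLM hf hF hg hG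
  apply Complex.ext
  · have h1 := Complex.reCLM.intervalIntegral_comp_comm hint
    have h2 := intervalIntegral.integral_sub i1 i2
    rw [e1, e2] at h2
    simp only [Complex.reCLM_apply, Complex.imCLM_apply] at h1 h2
    rw [← h1]
    simp only [Complex.sub_re, Complex.mul_re]
    calc _ = _ := by
          refine intervalIntegral.integral_congr fun ξ _ => ?_
          simp only [Complex.add_re, Complex.mul_re]
          ring
      _ = _ := h2
      _ = _ := by ring
  · have h1 := Complex.imCLM.intervalIntegral_comp_comm hint
    have h2 := intervalIntegral.integral_add i3 i4
    rw [e3, e4] at h2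
    simp only [Complex.reCLM_apply, Complex.imCLM_apply] at h1 h2
    rw [← h1]
    simp only [Complex.sub_im, Complex.mul_im]
    calc _ = _ := by
          refine intervalIntegral.integral_congr fun ξ _ => ?_
          simp only [Complex.add_im, Complex.mul_im]
          ring
      _ = _ := h2
      _ = _ := by ring

end ProductRule

variable {d : ℕ}

/-- `g` is a locally absolutely continuous function on `[0, ∞)` with derivative `v`. -/
structure IsPrimitive (g v : ℝ → Fin d → ℂ) : Prop where
  integrableOn : ∀ R, IntegrableOn v (Icc 0 R)
  eq : ∀ ξ, 0 ≤ ξ → g ξ = g 0 + ∫ t in (0 : ℝ)..ξ, v t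

namespace IsPrimitive

variable {g v h w : ℝ → Fin d → ℂ}

lemma intervalIntegrable (hg : IsPrimitive g v) {R : ℝ} (hR : 0 ≤ R) :
    IntervalIntegrable v volume 0 R :=
  (intervalIntegrable_iff_integrableOn_Icc_of_le hR).2 (hg.integrableOn R)

lemma continuousOn (hg : IsPrimitive g v) : ContinuousOn g (Ici 0) := by
  intro ξ hξ
  have h1 : ContinuousOn g (Icc 0 (ξ + 1)) :=
    continuousOn_of_eq_add_integral (by linarith [mem_Ici.1 hξ])
      (hg.intervalIntegrable (by linarith [mem_Ici.1 hξ])) fun t ht => hg.eq t ht.1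
  refine (h1 ξ ⟨hξ, by linarith⟩).mono_of_mem_nhdsWithin ?_
  rw [← Ici_inter_Iic]
  exact inter_mem_nhdsWithin _ (Iic_mem_nhds (by linarith))

lemma map (hg : IsPrimitive g v) {d' : ℕ} (L : (Fin d → ℂ) →L[ℝ] (Fin d' → ℂ)) :
    IsPrimitive (fun ξ => L (g ξ)) (fun ξ => L (v ξ)) :=
  ⟨fun R => L.integrable_comp (hg.integrableOn R), fun ξ hξ => by
    rw [hg.eq ξ hξ, map_add, L.intervalIntegral_comp_comm (hg.intervalIntegrable hξ)]⟩

lemma mulVec (hg : IsPrimitive g v) (M : Matrix (Fin d) (Fin d) ℂ) :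
    IsPrimitive (fun ξ => M *ᵥ g ξ) (fun ξ => M *ᵥ v ξ) :=
  hg.map (((M.mulVecLin).restrictScalars ℝ).toContinuousLinearMap)

lemma add (hg : IsPrimitive g v) (hh : IsPrimitive h w) :
    IsPrimitive (fun ξ => g ξ + h ξ) (fun ξ => v ξ + w ξ) :=
  ⟨fun R => (hg.integrableOn R).add (hh.integrableOn R), fun ξ hξ => by
    rw [intervalIntegral.integral_add (hg.intervalIntegrable hξ) (hh.intervalIntegrable hξ),
      hg.eq ξ hξ, hh.eq ξ hξ]
    abel⟩

lemma integral_dotProduct (hg : IsPrimitive g v) (hh : IsPrimitive h w) {R : ℝ} (hR : 0 ≤ R) :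
    ∫ ξ in (0 : ℝ)..R, (star (v ξ) ⬝ᵥ h ξ + star (g ξ) ⬝ᵥ w ξ) =
      star (g R) ⬝ᵥ h R - star (g 0) ⬝ᵥ h 0 := by
  have hc : ∀ i, ∀ ξ ∈ Icc 0 R, (star (g ξ)) i = (star (g 0)) i + ∫ t in (0 : ℝ)..ξ, (star (v t)) i := by
    intro i ξ hξ
    let L : (Fin d → ℂ) →L[ℝ] ℂ := Complex.conjCLE.toContinuousLinearMap.comp
      (ContinuousLinearMap.proj i)
    have := L.intervalIntegral_comp_comm (hg.intervalIntegrable hξ.1)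
    change _ = _ + ∫ t in (0 : ℝ)..ξ, L (v t)
    rw [this]
    change L (g ξ) = L (g 0) + _
    rw [hg.eq ξ hξ.1, map_add]
  have hw : ∀ i, ∀ ξ ∈ Icc 0 R, h ξ i = h 0 i + ∫ t in (0 : ℝ)..ξ, w t i := by
    intro i ξ hξ
    let L : (Fin d → ℂ) →L[ℝ] ℂ := ContinuousLinearMap.proj i
    have := L.intervalIntegral_comp_comm (hh.intervalIntegrable hξ.1)
    change _ = _ + ∫ t in (0 : ℝ)..ξ, L (w t)
    rw [this]
    change L (h ξ) = L (h 0) + _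
    rw [hh.eq ξ hξ.1, map_add]
  have hiv : ∀ i, IntervalIntegrable (fun ξ => (star (v ξ)) i) volume 0 R := by
    intro i
    let L : (Fin d → ℂ) →L[ℝ] ℂ := Complex.conjCLE.toContinuousLinearMap.comp
      (ContinuousLinearMap.proj i)
    exact ⟨L.integrable_comp (hg.intervalIntegrable hR).1, L.integrable_comp (hg.intervalIntegrable hR).2⟩
  have hiw : ∀ i, IntervalIntegrable (fun ξ => w ξ i) volume 0 R := by
    intro i
    let L : (Fin d → ℂ) →L[ℝ] ℂ := ContinuousLinearMap.proj i
    exact ⟨L.integrable_comp (hh.intervalIntegrable hR).1, L.integrable_comp (hh.intervalIntegrable hR).2⟩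
  have hsum : ∀ ξ, star (v ξ) ⬝ᵥ h ξ + star (g ξ) ⬝ᵥ w ξ =
      ∑ i, ((star (v ξ)) i * h ξ i + (star (g ξ)) i * w ξ i) := fun ξ => by
    simp only [dotProduct, Finset.sum_add_distrib]
  simp only [hsum]
  rw [intervalIntegral.integral_finsetSum]
  · simp only [dotProduct, ← Finset.sum_sub_distrib]
    exact Finset.sum_congr rfl fun i _ => integral_mul_add_mul hR (F := fun ξ => (star (g ξ)) i)
      (G := fun ξ => h ξ i) (hiv i) (hiw i) (hc i) (hw i)
  · intro i _
    exact intervalIntegrable_mul_add_mul hR (hiv i) (hiw i)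
      (continuousOn_of_eq_add_integral hR (hiv i) (hc i))
      (continuousOn_of_eq_add_integral hR (hiw i) (hw i))

/-- Integration by parts on `[0, ∞)`, the boundary term at infinity vanishing by integrability. -/
lemma integral_dotProduct_semiAxis (hg : IsPrimitive g v) (hh : IsPrimitive h w)
    (h1 : Integrable (fun ξ => star (v ξ) ⬝ᵥ h ξ + star (g ξ) ⬝ᵥ w ξ) semiAxis)
    (h2 : Integrable (fun ξ => star (g ξ) ⬝ᵥ h ξ) semiAxis) :
    ∫ ξ, (star (v ξ) ⬝ᵥ h ξ + star (g ξ) ⬝ᵥ w ξ) ∂semiAxis = - (star (g 0) ⬝ᵥ h 0) := by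
  rw [semiAxis_eq_restrict_Ioi] at h1 h2 ⊢
  have h3 := intervalIntegral_tendsto_integral_Ioi 0 h1 tendsto_id
  set I := ∫ ξ in Ioi 0, (star (v ξ) ⬝ᵥ h ξ + star (g ξ) ⬝ᵥ w ξ)
  -- The limit exists because the derivative of the product is integrable. Since the product is
  -- integrable as well, the limit can only be zero.
  have h4 : Tendsto (fun R => star (g R) ⬝ᵥ h R) atTop (𝓝 (I + star (g 0) ⬝ᵥ h 0)) := by
    refine (h3.add_const (star (g 0) ⬝ᵥ h 0)).congr' ?_
    filter_upwards [eventually_ge_atTop 0] with R hR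
    simp only [id]
    rw [integral_dotProduct hg hh hR, sub_add_cancel]
  have h5 : IntegrableAtFilter (fun R => star (g R) ⬝ᵥ h R) atTop volume :=
    ⟨Ioi 0, Ioi_mem_atTop 0, h2⟩
  have h6 := h5.eq_zero_of_tendsto (fun s hs => ?_) h4
  · exact eq_neg_of_add_eq_zero_left h6
  · obtain ⟨a, ha⟩ := mem_atTop_sets.1 hs
    exact measure_mono_top (fun x hx => ha x hx) Real.volume_Ici

end IsPrimitive

end PortHamiltonian

/-! ### Weak derivatives and continuous representatives -/

namespace PortHamiltonian

variable {d : ℕ}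

lemma integrable_smul_of_tsupport_subset {E : Type*} [NormedAddCommGroup E] [NormedSpace ℝ E]
    {φ : ℝ → ℝ} (hφ : Continuous φ) {K : Set ℝ} (hK : IsCompact K) (hs : tsupport φ ⊆ K)
    {k : ℝ → E} (hk : IntegrableOn k K) : Integrable (fun ξ => φ ξ • k ξ) := by
  have h1 : IntegrableOn (fun ξ => φ ξ • k ξ) K := hk.continuousOn_smul hφ.continuousOn hK
  rw [← integrableOn_univ]
  refine h1.of_forall_sdiff_eq_zero MeasurableSet.univ fun x hx => ?_
  rw [image_eq_zero_of_notMem_tsupport fun h => hx.2 (hs h), zero_smul]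

lemma exists_Icc_of_isCompact_subset_Ioi {K : Set ℝ} (hK : IsCompact K) (h : K ⊆ Ioi 0) :
    ∃ a b : ℝ, 0 < a ∧ a ≤ b ∧ K ⊆ Icc a b := by
  have hK' := hK.insert 1
  obtain ⟨a, ha, ha'⟩ := hK'.exists_isLeast (insert_nonempty _ _)
  obtain ⟨b, -, hb'⟩ := hK'.exists_isGreatest (insert_nonempty _ _)
  refine ⟨a, b, ?_, hb' ha, fun x hx => ⟨ha' (mem_insert_of_mem _ hx), hb' (mem_insert_of_mem _ hx)⟩⟩
  rcases ha with rfl | ha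
  · exact one_pos
  · exact h ha

lemma isPrimitive_smul_const {φ : ℝ → ℝ} (hφ : ContDiff ℝ 1 φ) (ζ : Fin d → ℂ) :
    IsPrimitive (fun ξ => φ ξ • ζ) (fun ξ => deriv φ ξ • ζ) := by
  have hc : Continuous (deriv φ) := hφ.continuous_deriv_one
  refine ⟨fun R => ((hc.smul continuous_const).continuousOn).integrableOn_Icc, fun ξ _ => ?_⟩
  rw [intervalIntegral.integral_smul_const, intervalIntegral.integral_deriv_eq_sub
    (fun x _ => (hφ.differentiable one_ne_zero).differentiableAt) (hc.intervalIntegrable _ _), sub_smul]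
  abel

namespace IsPrimitive

variable {g v u : ℝ → Fin d → ℂ}

/-- Componentwise this is integration by parts against `φ` times a unit vector. The boundary term at
`0` vanishes because `0` lies outside the support of `φ`. -/
lemma isWeakDeriv (hg : IsPrimitive g v) (hu : g =ᵐ[semiAxis] u) : IsWeakDeriv u v := by
  rw [semiAxis_eq_restrict_Ioi] at hu
  have hgl : LocallyIntegrableOn g (Ioi 0) :=
    (hg.continuousOn.mono Ioi_subset_Ici_self).locallyIntegrableOn measurableSet_Ioi
  refine ⟨?_, ?_, ?_⟩
  · intro x hx
    obtain ⟨t, ht, hti⟩ := hgl x hx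
    refine ⟨t ∩ Ioi 0, inter_mem ht self_mem_nhdsWithin, ?_⟩
    exact (hti.mono_set inter_subset_left).congr_fun_ae
      (ae_mono (Measure.restrict_mono inter_subset_right le_rfl) hu)
  · intro x hx
    exact ⟨Icc 0 (x + 1), mem_nhdsWithin_of_mem_nhds (Icc_mem_nhds hx (lt_add_one x)),
      hg.integrableOn _⟩
  · intro φ hφ hφc hφs
    obtain ⟨a, b, ha, hab, hK⟩ := exists_Icc_of_isCompact_subset_Ioi hφc hφs
    have hsub : Icc a b ⊆ Icc 0 b := Icc_subset_Icc_left ha.le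
    have hgi : IntegrableOn g (Icc a b) :=
      (hg.continuousOn.mono fun x hx => ha.le.trans hx.1).integrableOn_Icc
    have hφd : Continuous (deriv φ) := hφ.continuous_deriv (by simp)
    have h1 : Integrable (fun ξ => deriv φ ξ • g ξ) :=
      integrable_smul_of_tsupport_subset hφd isCompact_Icc (tsupport_deriv_subset.trans hK) hgi
    have h2 : Integrable (fun ξ => φ ξ • v ξ) :=
      integrable_smul_of_tsupport_subset hφ.continuous isCompact_Icc hK
        ((hg.integrableOn b).mono_set hsub)
    have h1' : Integrable (fun ξ => φ ξ • g ξ) :=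
      integrable_smul_of_tsupport_subset hφ.continuous isCompact_Icc hK hgi
    have h3 : ∫ ξ in Ioi 0, deriv φ ξ • u ξ = ∫ ξ in Ioi 0, deriv φ ξ • g ξ := by
      refine integral_congr_ae ?_
      filter_upwards [hu] with ξ h
      rw [h]
    rw [h3, eq_neg_iff_add_eq_zero, ← integral_add h1.restrict h2.restrict]
    funext i
    have h4 := (ContinuousLinearMap.proj (R := ℝ) (φ := fun _ : Fin d => ℂ) i).integral_comp_comm
      (h1.restrict.add h2.restrict : Integrable (fun ξ => deriv φ ξ • g ξ + φ ξ • v ξ)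
        (volume.restrict (Ioi 0)))
    simp only [ContinuousLinearMap.proj_apply, Pi.add_apply] at h4
    refine h4.symm.trans ?_
    have h5 := (isPrimitive_smul_const (hφ.of_le (by simp)) (Pi.single i 1 : Fin d → ℂ)).integral_dotProduct_semiAxis hg
    have hdot : ∀ (c : ℝ) (ζ : Fin d → ℂ),
        star (c • (Pi.single i 1 : Fin d → ℂ)) ⬝ᵥ ζ = (c • ζ) i := by
      intro c ζ
      rw [star_smul, smul_dotProduct, ← Pi.single_star, single_dotProduct]
      simp
    simp only [hdot] at h5
    rw [semiAxis_eq_restrict_Ioi] at h5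
    rw [h5]
    · rw [image_eq_zero_of_notMem_tsupport fun h => lt_irrefl (0 : ℝ) (mem_Ioi.1 (hφs h))]
      simp
    · exact (ContinuousLinearMap.proj (R := ℝ) (φ := fun _ : Fin d => ℂ) i).integrable_comp
        (h1.restrict.add h2.restrict)
    · exact (ContinuousLinearMap.proj (R := ℝ) (φ := fun _ : Fin d => ℂ) i).integrable_comp h1'.restrict

end IsPrimitive

lemma IsWeakDeriv.integrable_smul_left {u v : ℝ → Fin d → ℂ} (h : IsWeakDeriv u v) {φ : ℝ → ℝ}
    (hφ : Continuous φ) (hc : HasCompactSupport φ) (hs : tsupport φ ⊆ Ioi 0) :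
    Integrable (fun ξ => φ ξ • u ξ) :=
  integrable_smul_of_tsupport_subset hφ hc le_rfl (h.1.integrableOn_compact_subset hs hc)

lemma IsWeakDeriv.integrable_smul_right {u v : ℝ → Fin d → ℂ} (h : IsWeakDeriv u v) {φ : ℝ → ℝ}
    (hφ : Continuous φ) (hc : HasCompactSupport φ) (hs : tsupport φ ⊆ Ioi 0) :
    Integrable (fun ξ => φ ξ • v ξ) :=
  integrable_smul_of_tsupport_subset hφ hc le_rfl (h.2.1.integrableOn_compact_subset hs hc)

lemma setIntegral_Ioi_smul {u : ℝ → Fin d → ℂ} {φ : ℝ → ℝ} (hs : tsupport φ ⊆ Ioi 0) :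
    ∫ ξ in Ioi 0, φ ξ • u ξ = ∫ ξ, φ ξ • u ξ :=
  setIntegral_eq_integral_of_forall_compl_eq_zero fun x hx => by
    rw [image_eq_zero_of_notMem_tsupport fun h => hx (hs h), zero_smul]

lemma ae_eq_zero_of_forall_test {f : ℝ → Fin d → ℂ} (hf : LocallyIntegrableOn f (Ioi 0))
    (h : ∀ φ : ℝ → ℝ, ContDiff ℝ ∞ φ → HasCompactSupport φ → tsupport φ ⊆ Ioi 0 →
      ∫ ξ in Ioi 0, φ ξ • f ξ = 0) : f =ᵐ[semiAxis] 0 := by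
  rw [semiAxis_eq_restrict_Ioi]
  refine (ae_restrict_iff' measurableSet_Ioi).2 ?_
  refine isOpen_Ioi.ae_eq_zero_of_integral_contDiff_smul_eq_zero hf fun φ h1 h2 h3 => ?_
  rw [← setIntegral_Ioi_smul h3]
  exact h φ h1 h2 h3

lemma IsWeakDeriv.ae_unique {u v v' : ℝ → Fin d → ℂ} (h : IsWeakDeriv u v)
    (h' : IsWeakDeriv u v') : v =ᵐ[semiAxis] v' := by
  have h1 : v - v' =ᵐ[semiAxis] 0 := by
    refine ae_eq_zero_of_forall_test (h.2.1.sub h'.2.1) fun φ h1 h2 h3 => ?_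
    simp only [Pi.sub_apply, smul_sub]
    rw [integral_sub (h.integrable_smul_right h1.continuous h2 h3).restrict
      (h'.integrable_smul_right h1.continuous h2 h3).restrict, sub_eq_zero, ← neg_inj,
      ← h.2.2 φ h1 h2 h3, ← h'.2.2 φ h1 h2 h3]
  filter_upwards [h1] with ξ hξ
  exact sub_eq_zero.1 hξ

/-- A test function with vanishing integral is the derivative of a test function. -/
lemma exists_test_primitive {θ : ℝ → ℝ} (h1 : ContDiff ℝ ∞ θ) (h2 : HasCompactSupport θ)
    (h3 : tsupport θ ⊆ Ioi 0) (h4 : ∫ ξ, θ ξ = 0) :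
    ∃ φ : ℝ → ℝ, ContDiff ℝ ∞ φ ∧ HasCompactSupport φ ∧ tsupport φ ⊆ Ioi 0 ∧ deriv φ = θ := by
  obtain ⟨a, b, ha, hab, hK⟩ := exists_Icc_of_isCompact_subset_Ioi h2 h3
  have hz : ∀ x, x ∉ Icc a b → θ x = 0 := fun x hx =>
    image_eq_zero_of_notMem_tsupport fun h => hx (hK h)
  have hd : ∀ x, HasDerivAt (fun x => ∫ t in a..x, θ t) (θ x) x := fun x =>
    (h1.continuous.integral_hasStrictDerivAt a x).hasDerivAt
  have hderiv : deriv (fun x => ∫ t in a..x, θ t) = θ := funext fun x => (hd x).deriv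
  have hsupp : Function.support (fun x => ∫ t in a..x, θ t) ⊆ Icc a b := by
    intro x hx
    by_contra hx'
    refine hx ?_
    simp only [mem_Icc, not_and_or, not_le] at hx'
    rcases hx' with hxa | hxb
    · simp only
      rw [intervalIntegral.integral_symm, neg_eq_zero]
      refine intervalIntegral.integral_zero_ae ?_
      have : ∀ᵐ t : ℝ, t ≠ a := by simp [ae_iff]
      filter_upwards [this] with t ht0 ht
      rw [uIoc_of_le hxa.le] at ht
      exact hz t fun h => ht0 (le_antisymm ht.2 h.1)
    · simp only
      rw [intervalIntegral.integral_of_le (hab.trans hxb.le), ← h4,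
        ← integral_Icc_eq_integral_Ioc]
      exact setIntegral_eq_integral_of_forall_compl_eq_zero fun t ht =>
        hz t fun h => ht ⟨h.1, h.2.trans hxb.le⟩
  have hts : tsupport (fun x => ∫ t in a..x, θ t) ⊆ Icc a b := closure_minimal hsupp isClosed_Icc
  refine ⟨fun x => ∫ t in a..x, θ t, ?_, ?_, ?_, hderiv⟩
  · refine contDiff_infty_iff_deriv.2 ⟨fun x => (hd x).differentiableAt, ?_⟩
    rwa [hderiv]
  · exact HasCompactSupport.intro isCompact_Icc fun x hx => by
      by_contra h
      exact hx (hsupp h)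
  · exact hts.trans fun x hx => ha.trans_le hx.1

/-- The du Bois-Reymond lemma: a function with vanishing weak derivative is constant. -/
lemma exists_ae_eq_const {f : ℝ → Fin d → ℂ} (hf : IsWeakDeriv f 0) :
    ∃ c : Fin d → ℂ, f =ᵐ[semiAxis] fun _ => c := by
  -- Centre `2` and outer radius `1` keep the support in `[1, 3]`, away from `0`. The constant will
  -- be the mean of `f` against the normalised bump.
  let η : ContDiffBump (2 : ℝ) := ⟨1 / 2, 1, by norm_num, by norm_num⟩
  let e : ℝ → ℝ := η.normed volume
  have he1 : ContDiff ℝ ∞ e := η.contDiff_normed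
  have he2 : HasCompactSupport e := η.hasCompactSupport_normed
  have he3 : tsupport e ⊆ Ioi 0 := by
    rw [show tsupport e = _ from η.tsupport_normed_eq, Real.closedBall_eq_Icc]
    intro x hx
    have := hx.1
    norm_num [η] at this
    exact mem_Ioi.2 (by linarith)
  have he4 : ∫ ξ, e ξ = 1 := η.integral_normed
  have hei : Integrable e := he1.continuous.integrable_of_hasCompactSupport he2
  set c := ∫ ξ in Ioi 0, e ξ • f ξ with hc
  refine ⟨c, ?_⟩
  have hloc : LocallyIntegrableOn (fun ξ => f ξ - c) (Ioi 0) :=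
    hf.1.sub (continuous_const.locallyIntegrable.locallyIntegrableOn _)
  have h1 : (fun ξ => f ξ - c) =ᵐ[semiAxis] 0 := by
    refine ae_eq_zero_of_forall_test hloc fun ψ h1 h2 h3 => ?_
    have hψi : Integrable ψ := h1.continuous.integrable_of_hasCompactSupport h2
    set A := ∫ ξ, ψ ξ with hA
    -- Subtracting `A` times the bump makes the integral zero, so the difference is the derivative
    -- of a test function.
    obtain ⟨φ, p1, p2, p3, p4⟩ := exists_test_primitive (θ := fun ξ => ψ ξ - A * e ξ)
      (h1.sub (contDiff_const.mul he1)) (h2.sub (he2.mul_left))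
      ((tsupport_sub _ _).trans (union_subset h3 ((tsupport_mul_subset_right).trans he3)))
      (by rw [integral_sub hψi (hei.const_mul A), integral_const_mul, he4]; simp [hA])
    have h5 := hf.2.2 φ p1 p2 p3
    simp only [p4, Pi.zero_apply, smul_zero, integral_zero, neg_zero, sub_smul, mul_smul] at h5
    have h7 : Integrable (fun ξ => A • e ξ • f ξ) (volume.restrict (Ioi 0)) :=
      (hf.integrable_smul_left he1.continuous he2 he3).restrict.smul A
    rw [integral_sub (hf.integrable_smul_left h1.continuous h2 h3).restrict h7, integral_smul] at h5
    simp only [smul_sub]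
    rw [integral_sub (hf.integrable_smul_left h1.continuous h2 h3).restrict
      (hψi.restrict.smul_const c), integral_smul_const]
    have h6 : ∫ ξ in Ioi 0, ψ ξ = A :=
      setIntegral_eq_integral_of_forall_compl_eq_zero fun x hx =>
        image_eq_zero_of_notMem_tsupport fun h => hx (h3 h)
    rw [h6]
    exact h5
  filter_upwards [h1] with ξ hξ
  exact sub_eq_zero.1 hξ

/-- A function whose weak derivative is integrable up to `0` has a locally absolutely continuous
representative on `[0, ∞)`. -/
lemma IsWeakDeriv.exists_isPrimitive {u v : ℝ → Fin d → ℂ} (h : IsWeakDeriv u v)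
    (hv : ∀ R, IntegrableOn v (Icc 0 R)) : ∃ g, IsPrimitive g v ∧ g =ᵐ[semiAxis] u := by
  have hG : IsPrimitive (fun ξ => ∫ t in (0 : ℝ)..ξ, v t) v := ⟨hv, fun ξ _ => by simp⟩
  have hG' := hG.isWeakDeriv (ae_eq_refl _)
  have hd : IsWeakDeriv (u - fun ξ => ∫ t in (0 : ℝ)..ξ, v t) 0 := by
    refine ⟨h.1.sub hG'.1, fun x hx => ⟨univ, univ_mem, integrableOn_zero⟩, fun φ h1 h2 h3 => ?_⟩
    have h4 : Continuous (deriv φ) := h1.continuous_deriv (by simp)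
    have h5 := tsupport_deriv_subset.trans h3
    simp only [Pi.sub_apply, smul_sub]
    rw [integral_sub (h.integrable_smul_left h4 h2.deriv h5).restrict
      (hG'.integrable_smul_left h4 h2.deriv h5).restrict, h.2.2 φ h1 h2 h3, hG'.2.2 φ h1 h2 h3]
    simp
  obtain ⟨c, hc⟩ := exists_ae_eq_const hd
  refine ⟨fun ξ => c + ∫ t in (0 : ℝ)..ξ, v t, ⟨hv, fun ξ _ => by simp⟩, ?_⟩
  filter_upwards [hc] with ξ hξ
  rw [← hξ]
  simp

/-- Continuous representatives that agree almost everywhere agree on `(0, ∞)` and, by closure, at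
`0`. Hence the boundary value does not depend on the representative. -/
lemma HasValueAtZero.eq_of_continuousOn {u g : ℝ → Fin d → ℂ} {c : Fin d → ℂ}
    (h : HasValueAtZero u c) (hg : ContinuousOn g (Ici 0)) (hgu : g =ᵐ[semiAxis] u) : c = g 0 := by
  obtain ⟨k, hk, hku, rfl⟩ := h
  have h1 : k =ᵐ[volume.restrict (Ioi 0)] g := by
    rw [← semiAxis_eq_restrict_Ioi]
    exact hku.trans hgu.symm
  have h2 : EqOn k g (Ioi 0) := Measure.eqOn_open_of_ae_eq h1 isOpen_Ioi
    (hk.mono Ioi_subset_Ici_self) (hg.mono Ioi_subset_Ici_self)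
  refine h2.of_subset_closure hk hg Ioi_subset_Ici_self ?_ self_mem_Ici
  rw [closure_Ioi]

end PortHamiltonian

/-! ### The maximal operator: traces, Green's identity, adjoint -/

namespace PortHamiltonian

variable {d : ℕ}

lemma IsWeakDeriv.mulVec {u v : ℝ → Fin d → ℂ} (h : IsWeakDeriv u v)
    (M : Matrix (Fin d) (Fin d) ℂ) :
    IsWeakDeriv (fun ξ => M *ᵥ u ξ) (fun ξ => M *ᵥ v ξ) := by
  let L : (Fin d → ℂ) →L[ℝ] (Fin d → ℂ) := ((M.mulVecLin).restrictScalars ℝ).toContinuousLinearMap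
  have hL : ∀ {k : ℝ → Fin d → ℂ}, LocallyIntegrableOn k (Ioi 0) →
      LocallyIntegrableOn (fun ξ => M *ᵥ k ξ) (Ioi 0) := fun hk x hx => by
    obtain ⟨t, ht, hti⟩ := hk x hx
    exact ⟨t, ht, L.integrable_comp hti⟩
  refine ⟨hL h.1, hL h.2.1, fun φ h1 h2 h3 => ?_⟩
  have h4 : Continuous (deriv φ) := h1.continuous_deriv (by simp)
  have h5 := (h.integrable_smul_left h4 h2.deriv (tsupport_deriv_subset.trans h3)).restrict
    (s := Ioi 0)
  have h6 := (h.integrable_smul_right h1.continuous h2 h3).restrict (s := Ioi 0)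
  have h7 := L.integral_comp_comm h5
  have h8 := L.integral_comp_comm h6
  simp only [map_smul] at h7 h8
  rw [h.2.2 φ h1 h2 h3, map_neg, ← h8] at h7
  exact h7

namespace Hamiltonian

variable {ℋ : Hamiltonian d}

lemma aemeasurable_inv_apply (i j : Fin d) :
    AEMeasurable (fun ξ => (ℋ ξ)⁻¹ i j) semiAxis := by
  have hA : AEMeasurable (β := Fin d → Fin d → ℂ) (fun ξ => ℋ ξ) semiAxis :=
    aemeasurable_pi_lambda _ fun i => aemeasurable_pi_lambda _ fun j => ℋ.aemeasurable i j
  have h1 : Continuous fun A : Fin d → Fin d → ℂ => (Matrix.of A).det :=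
    Continuous.matrix_det (continuous_id (X := Matrix (Fin d) (Fin d) ℂ))
  have h2 : Continuous fun A : Fin d → Fin d → ℂ => (Matrix.of A).adjugate i j :=
    Continuous.matrix_elem (Continuous.matrix_adjugate (continuous_id (X := Matrix (Fin d) (Fin d) ℂ))) i j
  have h3 := (h1.measurable.comp_aemeasurable hA).inv.mul (h2.measurable.comp_aemeasurable hA)
  refine h3.congr (Eventually.of_forall fun ξ => ?_)
  simp [Matrix.inv_def, Matrix.smul_apply]
  rfl

lemma mulVec_inv_mulVec_ae : ∀ᵐ ξ ∂semiAxis, ∀ ζ : Fin d → ℂ, ℋ ξ *ᵥ ((ℋ ξ)⁻¹ *ᵥ ζ) = ζ := by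
  filter_upwards [ℋ.lower_bound_ae] with ξ ⟨m, hm, h⟩ ζ
  have hinj : Function.Injective (ℋ ξ).mulVec := by
    refine (injective_iff_map_eq_zero ((ℋ ξ).mulVecLin)).2 fun a ha => ?_
    have h1 := h a
    rw [show ℋ ξ *ᵥ a = 0 from ha, dotProduct_zero, Complex.zero_re] at h1
    have h2 : sqNorm a = 0 := le_antisymm (by unfold sqNorm; nlinarith) (sqNorm_nonneg a)
    exact sqNorm_eq_zero h2
  have hu := (Matrix.isUnit_iff_isUnit_det _).1 (Matrix.mulVec_injective_iff_isUnit.1 hinj)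
  rw [mulVec_mulVec, mul_nonsing_inv _ hu, one_mulVec]

/-- Every `u` that is square integrable with respect to the weight `1 / m` is of the form `ℋx`. -/
lemma exists_mul_ae_eq {m : ℕ → ℝ} (hm : ∀ n, 0 < m n) (hmle : ∀ᵐ ξ ∂semiAxis,
    ∀ ζ : Fin d → ℂ, m ⌊ξ⌋₊ * sqNorm ζ ≤ (star ζ ⬝ᵥ ℋ ξ *ᵥ ζ).re) {u : ℝ → Fin d → ℂ}
    (hu : AEStronglyMeasurable u semiAxis)
    (hi : Integrable (fun ξ => (m ⌊ξ⌋₊)⁻¹ * sqNorm (u ξ)) semiAxis) :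
    ∃ x : ℋ.L2, ℋ.mul x =ᵐ[semiAxis] u := by
  have hx : ℋ.MemL2 fun ξ => (ℋ ξ)⁻¹ *ᵥ u ξ := by
    refine memL2_of_le (aestronglyMeasurable_mulVec aemeasurable_inv_apply hu) hi ?_
    filter_upwards [hmle, ℋ.mulVec_inv_mulVec_ae] with ξ h1 h2
    set a := (ℋ ξ)⁻¹ *ᵥ u ξ with ha
    have h3 := h1 a
    simp only [form]
    rw [← ha]
    rw [h2] at h3 ⊢
    have hs : 0 < √(m ⌊ξ⌋₊) := Real.sqrt_pos.2 (hm _)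
    -- The scaling gives `2 Re(a^⋆u) ≤ m|a|² + m⁻¹|u|²`. Since `u = ℋa`, the first term is at most
    -- `Re(a^⋆u)` and is absorbed.
    have h4 := norm_dotProduct_le ((√(m ⌊ξ⌋₊) : ℂ) • a) ((√(m ⌊ξ⌋₊) : ℂ)⁻¹ • u ξ)
    rw [sqNorm_smul, sqNorm_smul, norm_inv, Complex.norm_of_nonneg hs.le, inv_pow,
      Real.sq_sqrt (hm _).le, star_smul, smul_dotProduct, dotProduct_smul, smul_smul] at h4
    have h5 : star (√(m ⌊ξ⌋₊) : ℂ) * (√(m ⌊ξ⌋₊) : ℂ)⁻¹ = 1 := by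
      rw [show star (√(m ⌊ξ⌋₊) : ℂ) = √(m ⌊ξ⌋₊) from Complex.conj_ofReal _]
      exact mul_inv_cancel₀ (Complex.ofReal_ne_zero.2 hs.ne')
    rw [h5, one_smul] at h4
    have h6 := Complex.re_le_norm (star a ⬝ᵥ u ξ)
    linarith
  refine ⟨L2.mk _ hx, ?_⟩
  filter_upwards [L2.coe_mk _ hx, ℋ.mulVec_inv_mulVec_ae] with ξ h1 h2
  rw [mul, h1, h2]

lemma exists_mul_ae_eq_of_bounded {u : ℝ → Fin d → ℂ} (hu : AEStronglyMeasurable u semiAxis)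
    {B R : ℝ} (hB : ∀ ξ, sqNorm (u ξ) ≤ B) (hR : ∀ ξ, R < ξ → u ξ = 0) :
    ∃ x : ℋ.L2, ℋ.mul x =ᵐ[semiAxis] u := by
  obtain ⟨m, hm, hmle⟩ := ℋ.exists_floor_lower_bound
  have hmeas : Measurable fun ξ : ℝ => m ⌊ξ⌋₊ := measurable_from_nat.comp Nat.measurable_floor
  refine exists_mul_ae_eq hm hmle hu ?_
  -- Only finitely many unit cells meet `[0, R]`; the sum dominates the weight `1 / m` on each of
  -- them.
  set C : ℝ := (∑ n ∈ Finset.range (⌊R⌋₊ + 1), (m n)⁻¹) * B with hC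
  have hc : Integrable ((Icc 0 R).indicator fun _ => C) semiAxis :=
    ((integrable_indicator_iff measurableSet_Icc).2 (integrableOn_const (by simp))).restrict
  refine hc.mono' (hmeas.inv.aestronglyMeasurable.mul
    (continuous_sqNorm.comp_aestronglyMeasurable hu)) ?_
  filter_upwards [ae_restrict_mem measurableSet_Ici] with ξ hξ
  rw [Real.norm_of_nonneg (mul_nonneg (inv_nonneg.2 (hm _).le) (sqNorm_nonneg _))]
  rcases le_or_gt ξ R with h | h
  · rw [indicator_of_mem (show ξ ∈ Icc 0 R from ⟨hξ, h⟩)]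
    refine mul_le_mul ?_ (hB ξ) (sqNorm_nonneg _)
      (Finset.sum_nonneg fun n _ => inv_nonneg.2 (hm n).le)
    exact Finset.single_le_sum (f := fun n => (m n)⁻¹) (fun n _ => inv_nonneg.2 (hm n).le)
      (Finset.mem_range.2 (Nat.lt_succ_of_le (Nat.floor_le_floor h)))
  · rw [indicator_of_notMem (fun hh => absurd hh.2 (not_le.2 h)), hR ξ h]
    simp [sqNorm]

lemma memL2_of_bounded (hℋ : ℋ.Bounded) {u : ℝ → Fin d → ℂ} (hu : AEStronglyMeasurable u semiAxis)
    {B R : ℝ} (hB : ∀ ξ, sqNorm (u ξ) ≤ B) (hR : ∀ ξ, R < ξ → u ξ = 0) : ℋ.MemL2 u := by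
  refine MemL2.of_sqNorm hℋ hu ?_
  have hc : Integrable ((Icc 0 R).indicator fun _ => B) semiAxis :=
    ((integrable_indicator_iff measurableSet_Icc).2 (integrableOn_const (by simp))).restrict
  refine hc.mono' (continuous_sqNorm.comp_aestronglyMeasurable hu) ?_
  filter_upwards [ae_restrict_mem measurableSet_Ici] with ξ hξ
  rw [Real.norm_of_nonneg (sqNorm_nonneg _)]
  rcases le_or_gt ξ R with h | h
  · rw [indicator_of_mem (show ξ ∈ Icc 0 R from ⟨hξ, h⟩)]
    exact hB ξ
  · rw [indicator_of_notMem (fun hh => absurd hh.2 (not_le.2 h)), hR ξ h]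
    simp [sqNorm]

variable (ℋ) in
/-- `x` belongs to the maximal domain, `P₁(ℋx)' = y` and `(ℋx)(0) = c`. -/
def HasTrace (P₁ : Matrix (Fin d) (Fin d) ℂ) (x y : ℋ.L2) (c : Fin d → ℂ) : Prop :=
  ∃ g v, IsPrimitive g v ∧ g =ᵐ[semiAxis] ℋ.mul x ∧ (⇑y =ᵐ[semiAxis] fun ξ => P₁ *ᵥ v ξ) ∧ g 0 = c

lemma mul_add_ae (x y : ℋ.L2) : ℋ.mul (x + y) =ᵐ[semiAxis] fun ξ => ℋ.mul x ξ + ℋ.mul y ξ := by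
  filter_upwards [L2.coe_add x y] with ξ h
  simp only [mul, h, Pi.add_apply, mulVec_add]

lemma mul_smul_ae (a : ℂ) (x : ℋ.L2) : ℋ.mul (a • x) =ᵐ[semiAxis] fun ξ => a • ℋ.mul x ξ := by
  filter_upwards [L2.coe_smul a x] with ξ h
  simp only [mul, h, Pi.smul_apply, mulVec_smul]

namespace HasTrace

variable {P₁ : Matrix (Fin d) (Fin d) ℂ} {x y x' y' : ℋ.L2} {c c' : Fin d → ℂ}

lemma exists_isWeakDeriv (h : ℋ.HasTrace P₁ x y c) :
    ∃ v, IsWeakDeriv (ℋ.mul x) v ∧ ⇑y =ᵐ[semiAxis] fun ξ => P₁ *ᵥ v ξ := by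
  obtain ⟨g, v, h1, h2, h3, -⟩ := h
  exact ⟨v, h1.isWeakDeriv h2, h3⟩

lemma hasValueAtZero (h : ℋ.HasTrace P₁ x y c) : HasValueAtZero (ℋ.mul x) c := by
  obtain ⟨g, v, h1, h2, -, h4⟩ := h
  exact ⟨g, h1.continuousOn, h2, h4⟩

lemma eq_of_hasValueAtZero (h : ℋ.HasTrace P₁ x y c) (hc : HasValueAtZero (ℋ.mul x) c') :
    c' = c := by
  obtain ⟨g, v, h1, h2, -, rfl⟩ := h
  exact hc.eq_of_continuousOn h1.continuousOn h2

lemma ae_eq (h : ℋ.HasTrace P₁ x y c) {v : ℝ → Fin d → ℂ} (hv : IsWeakDeriv (ℋ.mul x) v) :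
    ⇑y =ᵐ[semiAxis] fun ξ => P₁ *ᵥ v ξ := by
  obtain ⟨w, h1, h2⟩ := h.exists_isWeakDeriv
  filter_upwards [h2, h1.ae_unique hv] with ξ h3 h4
  rw [h3, h4]

lemma unique (h : ℋ.HasTrace P₁ x y c) (h' : ℋ.HasTrace P₁ x y' c') : y = y' ∧ c = c' := by
  refine ⟨?_, h'.eq_of_hasValueAtZero h.hasValueAtZero⟩
  obtain ⟨v, h1, h2⟩ := h.exists_isWeakDeriv
  exact L2.ext_ae (h2.trans (h'.ae_eq h1).symm)

lemma add (h : ℋ.HasTrace P₁ x y c) (h' : ℋ.HasTrace P₁ x' y' c') :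
    ℋ.HasTrace P₁ (x + x') (y + y') (c + c') := by
  obtain ⟨g, v, h1, h2, h3, rfl⟩ := h
  obtain ⟨g', v', h1', h2', h3', rfl⟩ := h'
  refine ⟨_, _, h1.add h1', ?_, ?_, rfl⟩
  · filter_upwards [h2, h2', mul_add_ae x x'] with ξ e1 e2 e3
    rw [e3, e1, e2]
  · filter_upwards [h3, h3', L2.coe_add y y'] with ξ e1 e2 e3
    rw [e3, Pi.add_apply, e1, e2, mulVec_add]

lemma smul (a : ℂ) (h : ℋ.HasTrace P₁ x y c) : ℋ.HasTrace P₁ (a • x) (a • y) (a • c) := by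
  obtain ⟨g, v, h1, h2, h3, rfl⟩ := h
  have h4 := h1.mulVec (a • (1 : Matrix (Fin d) (Fin d) ℂ))
  simp only [smul_mulVec, one_mulVec] at h4
  refine ⟨_, _, h4, ?_, ?_, rfl⟩
  · filter_upwards [h2, mul_smul_ae a x] with ξ e1 e2
    rw [e2, e1]
  · filter_upwards [h3, L2.coe_smul a y] with ξ e1 e2
    rw [e2, Pi.smul_apply, e1, mulVec_smul]

end HasTrace

lemma form_eq_dotProduct_mul_right (x y : ℋ.L2) (ξ : ℝ) :
    ℋ.form x y ξ = star (x ξ) ⬝ᵥ ℋ.mul y ξ := rfl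

lemma form_eq_dotProduct_mul_left (x y : ℋ.L2) :
    ∀ᵐ ξ ∂semiAxis, ℋ.form x y ξ = star (ℋ.mul x ξ) ⬝ᵥ y ξ := by
  filter_upwards [ℋ.hermitian] with ξ h
  rw [mul, star_mulVec, h.eq, ← dotProduct_mulVec]
  rfl

/-- Green's identity for the maximal operator. -/
lemma HasTrace.inner_add_inner (hℋ : ℋ.Bounded) {P₁ : Matrix (Fin d) (Fin d) ℂ} (hP : P₁ᴴ = P₁)
    {x y x' y' : ℋ.L2} {c c' : Fin d → ℂ} (h : ℋ.HasTrace P₁ x y c)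
    (h' : ℋ.HasTrace P₁ x' y' c') :
    inner ℂ x y' + inner ℂ y x' = - (star c ⬝ᵥ P₁ *ᵥ c') := by
  obtain ⟨g, v, h1, h2, h3, rfl⟩ := h
  obtain ⟨g', v', h1', h2', h3', rfl⟩ := h'
  have e1 : ℋ.form x y' =ᵐ[semiAxis] fun ξ => star (g ξ) ⬝ᵥ P₁ *ᵥ v' ξ := by
    filter_upwards [form_eq_dotProduct_mul_left x y', h2, h3'] with ξ a1 a2 a3
    rw [a1, a2, a3]
  have e2 : ℋ.form y x' =ᵐ[semiAxis] fun ξ => star (v ξ) ⬝ᵥ P₁ *ᵥ g' ξ := by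
    filter_upwards [h2', h3] with ξ a1 a2
    rw [form_eq_dotProduct_mul_right, ← a1, a2, star_mulVec, hP, ← dotProduct_mulVec]
  have i1 := x.memL2.integrable_form y'.memL2
  have i2 := y.memL2.integrable_form x'.memL2
  -- Unweighted square integrability, which comes from boundedness of `ℋ`, makes `g^⋆P₁g'`
  -- integrable and so removes the boundary term at infinity.
  have i3 : Integrable (fun ξ => sqNorm (g ξ)) semiAxis :=
    (x.memL2.integrable_sqNorm_mul hℋ).congr (by filter_upwards [h2] with ξ a; rw [a]; rfl)
  have i4 : Integrable (fun ξ => sqNorm (P₁ *ᵥ g' ξ)) semiAxis := by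
    refine (integrable_sqNorm_const_mulVec P₁ (aestronglyMeasurable_mulVec ℋ.aemeasurable x'.memL2.1)
      (x'.memL2.integrable_sqNorm_mul hℋ)).congr ?_
    filter_upwards [h2'] with ξ a
    rw [a]; rfl
  have m1 : AEStronglyMeasurable g semiAxis := h1.continuousOn.aestronglyMeasurable measurableSet_Ici
  have m2 : AEStronglyMeasurable (fun ξ => P₁ *ᵥ g' ξ) semiAxis :=
    (h1'.mulVec P₁).continuousOn.aestronglyMeasurable measurableSet_Ici
  have i5 : Integrable (fun ξ => star (g ξ) ⬝ᵥ P₁ *ᵥ g' ξ) semiAxis := by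
    refine (i3.add i4).mono' (aestronglyMeasurable_dotProduct m1 m2) (Eventually.of_forall fun ξ => ?_)
    have := norm_dotProduct_le (g ξ) (P₁ *ᵥ g' ξ)
    simp only [Pi.add_apply]
    linarith [norm_nonneg (star (g ξ) ⬝ᵥ P₁ *ᵥ g' ξ)]
  have key := h1.integral_dotProduct_semiAxis (h1'.mulVec P₁)
    ((i2.congr e2).add (i1.congr e1)) i5
  rw [integral_add (i2.congr e2) (i1.congr e1), ← integral_congr_ae e1, ← integral_congr_ae e2] at key
  rw [L2.inner_def, L2.inner_def, add_comm]
  exact key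

/-- Elements of `L²_ℋ` are integrable up to `0`, hence so is `v = P₁⁻¹y`. This gives `ℋx` a
representative continuous on `[0, ∞)`, so a boundary value exists without being assumed. -/
lemma exists_hasTrace_of_isWeakDeriv {P₁ : Matrix (Fin d) (Fin d) ℂ} (hP : IsUnit P₁) {x y : ℋ.L2}
    {v : ℝ → Fin d → ℂ} (h : IsWeakDeriv (ℋ.mul x) v) (hy : ⇑y =ᵐ[semiAxis] fun ξ => P₁ *ᵥ v ξ) :
    ∃ c, ℋ.HasTrace P₁ x y c := by
  have hv : ∀ R, IntegrableOn v (Icc 0 R) := by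
    intro R
    let L : (Fin d → ℂ) →L[ℝ] (Fin d → ℂ) :=
      ((P₁⁻¹.mulVecLin).restrictScalars ℝ).toContinuousLinearMap
    have hle : volume.restrict (Icc (0 : ℝ) R) ≤ semiAxis :=
      Measure.restrict_mono (fun x hx => hx.1) le_rfl
    have h1 := L.integrable_comp (y.memL2.integrableOn R)
    refine h1.congr (ae_mono hle ?_)
    filter_upwards [hy] with ξ h2
    rw [h2]
    change P₁⁻¹ *ᵥ (P₁ *ᵥ v ξ) = v ξ
    rw [mulVec_mulVec, nonsing_inv_mul _ ((Matrix.isUnit_iff_isUnit_det _).1 hP), one_mulVec]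
  obtain ⟨g, hg, hgu⟩ := h.exists_isPrimitive hv
  exact ⟨g 0, g, v, hg, hgu, hy, rfl⟩

/-- Smooth compactly supported elements of the maximal domain. -/
lemma exists_hasTrace_smul (hℋ : ℋ.Bounded) (P₁ : Matrix (Fin d) (Fin d) ℂ) {φ : ℝ → ℝ}
    (hφ : ContDiff ℝ 1 φ) (hc : HasCompactSupport φ) (ζ : Fin d → ℂ) :
    ∃ x y : ℋ.L2, ℋ.HasTrace P₁ x y (φ 0 • ζ) ∧ (ℋ.mul x =ᵐ[semiAxis] fun ξ => φ ξ • ζ) ∧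
      ⇑y =ᵐ[semiAxis] fun ξ => deriv φ ξ • P₁ *ᵥ ζ := by
  have hb : ∀ {ψ : ℝ → ℝ} (_ : Continuous ψ) (_ : HasCompactSupport ψ) (η : Fin d → ℂ),
      ∃ B R : ℝ, (∀ ξ, sqNorm (ψ ξ • η) ≤ B) ∧ ∀ ξ, R < ξ → ψ ξ • η = 0 := by
    intro ψ h1 h2 η
    obtain ⟨C, hC⟩ := h1.bounded_above_of_compact_support h2
    obtain ⟨R, hR⟩ := h2.isCompact.bddAbove
    refine ⟨C ^ 2 * sqNorm η, R, fun ξ => ?_, fun ξ hξ => ?_⟩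
    · rw [← Complex.coe_smul, sqNorm_smul, Complex.norm_real]
      exact mul_le_mul_of_nonneg_right (pow_le_pow_left₀ (norm_nonneg _) (hC ξ) 2) (sqNorm_nonneg _)
    · rw [image_eq_zero_of_notMem_tsupport fun h => (not_le.2 hξ) (hR h), zero_smul]
  have hd : Continuous (deriv φ) := hφ.continuous_deriv_one
  obtain ⟨B, R, hB, hR⟩ := hb hφ.continuous hc ζ
  obtain ⟨B', R', hB', hR'⟩ := hb hd hc.deriv (P₁ *ᵥ ζ)
  obtain ⟨x, hx⟩ := ℋ.exists_mul_ae_eq_of_bounded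
    (hφ.continuous.smul (continuous_const (y := ζ))).aestronglyMeasurable hB hR
  have hy := memL2_of_bounded hℋ
    (hd.smul (continuous_const (y := P₁ *ᵥ ζ))).aestronglyMeasurable hB' hR'
  refine ⟨x, L2.mk _ hy, ⟨_, _, isPrimitive_smul_const hφ ζ, hx.symm, ?_, rfl⟩, hx, L2.coe_mk _ hy⟩
  filter_upwards [L2.coe_mk _ hy] with ξ h
  rw [h]
  exact (mulVec_smul P₁ (deriv φ ξ) ζ).symm

/-- A smooth cutoff times `c` serves. Because all boundary values occur, an orthogonality relation
between elements of two domains becomes one between vectors of `ℂ^d`. -/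
lemma exists_hasTrace_zero_eq (hℋ : ℋ.Bounded) (P₁ : Matrix (Fin d) (Fin d) ℂ) (c : Fin d → ℂ) :
    ∃ x y : ℋ.L2, ℋ.HasTrace P₁ x y c := by
  let η : ContDiffBump (0 : ℝ) := default
  obtain ⟨x, y, h, -⟩ := ℋ.exists_hasTrace_smul hℋ P₁ η.contDiff η.hasCompactSupport c
  rw [η.one_of_mem_closedBall (Metric.mem_closedBall_self η.rIn_pos.le), one_smul] at h
  exact ⟨x, y, h⟩

/-- The maximal operator is the adjoint of its restriction to test functions. -/
lemma exists_hasTrace_of_forall_test (hℋ : ℋ.Bounded) {P₁ : Matrix (Fin d) (Fin d) ℂ}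
    (hP : P₁ᴴ = P₁) (hPu : IsUnit P₁) {x z : ℋ.L2}
    (h : ∀ x' y' : ℋ.L2, ℋ.HasTrace P₁ x' y' 0 → inner ℂ x' z + inner ℂ y' x = 0) :
    ∃ c, ℋ.HasTrace P₁ x z c := by
  have hdet := (Matrix.isUnit_iff_isUnit_det _).1 hPu
  have hloc : ∀ {k : ℝ → Fin d → ℂ}, (∀ R, IntegrableOn k (Icc 0 R)) →
      LocallyIntegrableOn k (Ioi 0) := fun hk t ht =>
    ⟨Icc 0 (t + 1), mem_nhdsWithin_of_mem_nhds (Icc_mem_nhds ht (lt_add_one t)), hk _⟩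
  have hz := hloc z.memL2.integrableOn
  have hu := hloc (x.memL2.mulVec_mul hℋ P₁).integrableOn
  have hw : IsWeakDeriv (fun ξ => P₁ *ᵥ ℋ.mul x ξ) z := by
    refine ⟨hu, hz, fun φ h1 h2 h3 => ?_⟩
    have hd : Continuous (deriv φ) := h1.continuous_deriv (by simp)
    have i1 : Integrable (fun ξ => φ ξ • z ξ) :=
      integrable_smul_of_tsupport_subset h1.continuous h2 le_rfl (hz.integrableOn_compact_subset h3 h2)
    have i2 : Integrable (fun ξ => deriv φ ξ • P₁ *ᵥ ℋ.mul x ξ) :=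
      integrable_smul_of_tsupport_subset hd h2.deriv le_rfl
        (hu.integrableOn_compact_subset (tsupport_deriv_subset.trans h3) h2.deriv)
    have key : ∀ ζ : Fin d → ℂ, star ζ ⬝ᵥ ((∫ ξ in Ioi 0, deriv φ ξ • P₁ *ᵥ ℋ.mul x ξ) +
        ∫ ξ in Ioi 0, φ ξ • z ξ) = 0 := by
      intro ζ
      -- The element with `ℋx' = φζ` has boundary value zero, so the hypothesis applies to it. It is
      -- the weak equation for `P₁ℋx` tested with `φ` and paired with `ζ`.
      obtain ⟨x', y', a1, a2, a3⟩ := ℋ.exists_hasTrace_smul hℋ P₁ (h1.of_le (by simp)) h2 ζ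
      rw [image_eq_zero_of_notMem_tsupport fun h => lt_irrefl (0 : ℝ) (mem_Ioi.1 (h3 h)),
        zero_smul] at a1
      have b1 := h x' y' a1
      let L : (Fin d → ℂ) →L[ℝ] ℂ :=
        (((dotProductBilin ℂ ℂ (star ζ)) : (Fin d → ℂ) →ₗ[ℂ] ℂ).restrictScalars ℝ).toContinuousLinearMap
      have hL : ∀ η, L η = star ζ ⬝ᵥ η := fun η => rfl
      rw [L2.inner_def, L2.inner_def] at b1
      have c1 : ∫ ξ, ℋ.form x' z ξ ∂semiAxis = L (∫ ξ in Ioi 0, φ ξ • z ξ) := by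
        rw [← L.integral_comp_comm i1.restrict, ← semiAxis_eq_restrict_Ioi]
        refine integral_congr_ae ?_
        filter_upwards [form_eq_dotProduct_mul_left x' z, a2] with ξ e1 e2
        rw [e1, e2, hL, star_smul, smul_dotProduct, dotProduct_smul]
        simp
      have c2 : ∫ ξ, ℋ.form y' x ξ ∂semiAxis = L (∫ ξ in Ioi 0, deriv φ ξ • P₁ *ᵥ ℋ.mul x ξ) := by
        rw [← L.integral_comp_comm i2.restrict, ← semiAxis_eq_restrict_Ioi]
        refine integral_congr_ae ?_
        filter_upwards [a3] with ξ e1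
        rw [form_eq_dotProduct_mul_right, e1, hL, star_smul, smul_dotProduct, dotProduct_smul,
          star_mulVec, hP, ← dotProduct_mulVec]
        simp
      rw [c1, c2] at b1
      rw [← hL, map_add, add_comm]
      exact b1
    refine eq_neg_of_add_eq_zero_left (sqNorm_eq_zero ?_)
    have := key ((∫ ξ in Ioi 0, deriv φ ξ • P₁ *ᵥ ℋ.mul x ξ) + ∫ ξ in Ioi 0, φ ξ • z ξ)
    rw [star_dotProduct_self] at this
    exact_mod_cast this
  have hw2 := hw.mulVec P₁⁻¹
  simp only [mulVec_mulVec, nonsing_inv_mul _ hdet, one_mulVec] at hw2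
  refine exists_hasTrace_of_isWeakDeriv hPu hw2 (Eventually.of_forall fun ξ => ?_)
  simp only [mulVec_mulVec, mul_nonsing_inv _ hdet, one_mulVec]

/-- This computes the adjoint of the maximal operator restricted to boundary values in `V`. Having
`0 ∈ V` makes test functions available and yields the trace; Green's identity then puts that trace
in the `P₁`-orthogonal companion of `V`. -/
lemma exists_hasTrace_of_forall (hℋ : ℋ.Bounded) {P₁ : Matrix (Fin d) (Fin d) ℂ}
    (hP : P₁ᴴ = P₁) (hPu : IsUnit P₁) {V : Set (Fin d → ℂ)} (h0 : 0 ∈ V) {x z : ℋ.L2}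
    (h : ∀ (x' y' : ℋ.L2), ∀ c' ∈ V, ℋ.HasTrace P₁ x' y' c' → inner ℂ x' z + inner ℂ y' x = 0) :
    ∃ c, ℋ.HasTrace P₁ x z c ∧ ∀ c' ∈ V, star c' ⬝ᵥ P₁ *ᵥ c = 0 := by
  obtain ⟨c, hc⟩ := exists_hasTrace_of_forall_test hℋ hP hPu fun x' y' => h x' y' 0 h0
  refine ⟨c, hc, fun c' hc' => ?_⟩
  obtain ⟨x', y', h'⟩ := ℋ.exists_hasTrace_zero_eq hℋ P₁ c'
  have h1 := h'.inner_add_inner hℋ hP hc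
  rw [h x' y' c' hc' h'] at h1
  exact neg_eq_zero.1 h1.symm

/-- The operator `x ↦ M ℋ x` on `L²_ℋ`. -/
def mulOp (hℋ : ℋ.Bounded) (M : Matrix (Fin d) (Fin d) ℂ) (x : ℋ.L2) : ℋ.L2 :=
  L2.mk (fun ξ => M *ᵥ ℋ.mul x ξ) (x.memL2.mulVec_mul hℋ M)

lemma coe_mulOp (hℋ : ℋ.Bounded) (M : Matrix (Fin d) (Fin d) ℂ) (x : ℋ.L2) :
    ⇑(mulOp hℋ M x) =ᵐ[semiAxis] fun ξ => M *ᵥ ℋ.mul x ξ := L2.coe_mk _ _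

lemma mulOp_add (hℋ : ℋ.Bounded) (M : Matrix (Fin d) (Fin d) ℂ) (x y : ℋ.L2) :
    mulOp hℋ M (x + y) = mulOp hℋ M x + mulOp hℋ M y := by
  refine L2.ext_ae ?_
  filter_upwards [coe_mulOp hℋ M (x + y), coe_mulOp hℋ M x, coe_mulOp hℋ M y, mul_add_ae x y,
    L2.coe_add (mulOp hℋ M x) (mulOp hℋ M y)] with ξ h1 h2 h3 h4 h5
  rw [h1, h5, h4, Pi.add_apply, h2, h3, mulVec_add]

lemma mulOp_smul (hℋ : ℋ.Bounded) (M : Matrix (Fin d) (Fin d) ℂ) (a : ℂ) (x : ℋ.L2) :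
    mulOp hℋ M (a • x) = a • mulOp hℋ M x := by
  refine L2.ext_ae ?_
  filter_upwards [coe_mulOp hℋ M (a • x), coe_mulOp hℋ M x, mul_smul_ae a x,
    L2.coe_smul a (mulOp hℋ M x)] with ξ h1 h2 h3 h4
  rw [h1, h4, h3, Pi.smul_apply, h2, mulVec_smul]

lemma inner_mulOp (hℋ : ℋ.Bounded) {M : Matrix (Fin d) (Fin d) ℂ} (hM : Mᴴ = -M) (x y : ℋ.L2) :
    inner ℂ x (mulOp hℋ M y) = - inner ℂ (mulOp hℋ M x) y := by
  rw [L2.inner_def, L2.inner_def, ← integral_neg]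
  refine integral_congr_ae ?_
  filter_upwards [form_eq_dotProduct_mul_left x (mulOp hℋ M y), coe_mulOp hℋ M x,
    coe_mulOp hℋ M y] with ξ h1 h2 h3
  rw [h1, form_eq_dotProduct_mul_right, h2, h3, star_mulVec, hM, ← dotProduct_mulVec, neg_mulVec,
    dotProduct_neg, neg_neg]

end Hamiltonian

end PortHamiltonian

/-! ### Oscillation argument and multipliers: equality of the two candidate domains -/

namespace PortHamiltonian

variable {d : ℕ}

/-- The Riemann–Lebesgue lemma for the primitives of a rapidly oscillating integrable function. -/
lemma exists_integral_fourierChar_small {v : ℝ → Fin d → ℂ} {a b : ℝ} (hab : a ≤ b)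
    (hv : IntegrableOn v (Icc a b)) {ε : ℝ} (hε : 0 < ε) :
    ∃ N : ℝ, sqNorm (∫ t in a..b, (Real.fourierChar (-(t * N)) : ℂ) • v t) ≤ ε ∧
      ∫ ξ in Icc a b, sqNorm (∫ t in a..ξ, (Real.fourierChar (-(t * N)) : ℂ) • v t) ≤ ε := by
  let F : ℕ → ℝ → Fin d → ℂ := fun N ξ =>
    ∫ t in a..ξ, (Real.fourierChar (-(t * (N : ℝ))) : ℂ) • v t
  have hcoc : Tendsto (fun N : ℕ => (N : ℝ)) atTop (cocompact ℝ) :=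
    tendsto_natCast_atTop_atTop.mono_right atTop_le_cocompact
  have hlim : ∀ ξ ∈ Icc a b, Tendsto (fun N => F N ξ) atTop (𝓝 0) := by
    intro ξ hξ
    have h1 := (tendsto_integral_exp_inner_smul_cocompact (V := ℝ)
      ((Ioc a ξ).indicator v)).comp hcoc
    refine h1.congr fun N => ?_
    simp only [Function.comp, F]
    rw [intervalIntegral.integral_of_le hξ.1, ← integral_indicator measurableSet_Ioc]
    refine integral_congr_ae (Eventually.of_forall fun t => ?_)
    by_cases ht : t ∈ Ioc a ξ
    · simp only [indicator_of_mem ht]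
      rw [show inner ℝ t (N : ℝ) = t * N by simp [mul_comm]]
      rfl
    · simp only [indicator_of_notMem ht]
      rw [Circle.smul_def, smul_zero]
  have hbound : ∀ N, ∀ ξ ∈ Icc a b, ‖F N ξ‖ ≤ ∫ t in Icc a b, ‖v t‖ := by
    intro N ξ hξ
    simp only [F]
    rw [intervalIntegral.integral_of_le hξ.1]
    refine (norm_integral_le_integral_norm _).trans ?_
    simp only [norm_smul, Circle.norm_coe, one_mul]
    exact setIntegral_mono_set hv.norm (Eventually.of_forall fun _ => norm_nonneg _)
      (Ioc_subset_Icc_self.trans (Icc_subset_Icc_right hξ.2)).eventuallyLE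
  have hFc : ∀ N, ContinuousOn (F N) (Icc a b) := by
    intro N
    have hi : IntegrableOn (fun t => (Real.fourierChar (-(t * (N : ℝ))) : ℂ) • v t) (Icc a b) := by
      refine hv.continuousOn_smul (Continuous.continuousOn ?_) isCompact_Icc
      exact continuous_subtype_val.comp (Real.continuous_fourierChar.comp (by fun_prop))
    rw [← uIcc_of_le hab] at hi ⊢
    exact intervalIntegral.continuousOn_primitive_interval hi
  have h1 : Tendsto (fun N => sqNorm (F N b)) atTop (𝓝 0) := by
    have := (continuous_sqNorm.tendsto 0).comp (hlim b ⟨hab, le_rfl⟩)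
    simpa only [Function.comp_def, sqNorm_zero] using this
  have h2 : Tendsto (fun N => ∫ ξ in Icc a b, sqNorm (F N ξ)) atTop (𝓝 0) := by
    have h3 := tendsto_integral_of_dominated_convergence (μ := volume.restrict (Icc a b))
      (F := fun N ξ => sqNorm (F N ξ)) (f := fun _ => (0 : ℝ))
      (fun _ => d * (∫ t in Icc a b, ‖v t‖) ^ 2)
      (fun N => (continuous_sqNorm.comp_continuousOn (hFc N)).aestronglyMeasurable measurableSet_Icc)
      (integrableOn_const (by simp)) (fun N => ?_) ?_
    · simpa using h3
    · filter_upwards [ae_restrict_mem measurableSet_Icc] with ξ hξ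
      rw [Real.norm_of_nonneg (sqNorm_nonneg _)]
      refine (sqNorm_le_norm_sq _).trans (mul_le_mul_of_nonneg_left ?_ (by positivity))
      exact pow_le_pow_left₀ (norm_nonneg _) (hbound N ξ hξ) 2
    · filter_upwards [ae_restrict_mem measurableSet_Icc] with ξ hξ
      have := (continuous_sqNorm.tendsto 0).comp (hlim ξ hξ)
      simpa only [Function.comp_def, sqNorm_zero] using this
  obtain ⟨N, hN1, hN2⟩ := ((h1.eventually (gt_mem_nhds hε)).and
    (h2.eventually (gt_mem_nhds hε))).exists
  exact ⟨N, hN1.le, hN2.le⟩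

lemma iUnion_Ico_natCast : ⋃ n : ℕ, Ico (n : ℝ) (n + 1) = Ici 0 := by
  ext x
  simp only [mem_iUnion, mem_Ico, mem_Ici]
  exact ⟨fun ⟨n, h, _⟩ => n.cast_nonneg.trans h,
    fun h => ⟨⌊x⌋₊, Nat.floor_le h, Nat.lt_floor_add_one x⟩⟩

lemma floor_eq_of_mem_Ico {n : ℕ} {ξ : ℝ} (h : ξ ∈ Ico (n : ℝ) (n + 1)) : ⌊ξ⌋₊ = n :=
  (Nat.floor_eq_iff (n.cast_nonneg.trans h.1)).2 h

lemma integrable_semiAxis_of_le_geometric {G : ℝ → ℝ} (hG : ∀ ξ, 0 ≤ G ξ)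
    (hi : ∀ n : ℕ, IntegrableOn G (Ico (n : ℝ) (n + 1))) {C : ℝ}
    (hC : ∀ n : ℕ, ∫ ξ in Ico (n : ℝ) (n + 1), G ξ ≤ C * (1 / 2) ^ n) : Integrable G semiAxis := by
  rw [semiAxis, ← iUnion_Ico_natCast]
  refine integrableOn_iUnion_of_summable_integral_norm hi ?_
  refine Summable.of_nonneg_of_le (fun n => integral_nonneg fun _ => norm_nonneg _) (fun n => ?_)
    (summable_geometric_two.mul_left C)
  simp only [Real.norm_of_nonneg (hG _)]
  exact hC n

namespace Hamiltonian

variable {ℋ : Hamiltonian d}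

lemma MemL2.sub {f g : ℝ → Fin d → ℂ} (hf : ℋ.MemL2 f) (hg : ℋ.MemL2 g) : ℋ.MemL2 (f - g) := by
  have := hf.add (hg.smul (-1))
  rwa [neg_one_smul, ← sub_eq_add_neg] at this

lemma MemL2.smul_unimodular {f : ℝ → Fin d → ℂ} (hf : ℋ.MemL2 f) {e : ℝ → ℂ} (he : Measurable e)
    (h1 : ∀ ξ, ‖e ξ‖ = 1) : ℋ.MemL2 (fun ξ => e ξ • f ξ) := by
  refine ⟨he.aestronglyMeasurable.smul hf.1, hf.2.congr (Eventually.of_forall fun ξ => ?_)⟩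
  have h2 : star (e ξ) * e ξ = 1 := by
    have := Complex.conj_mul' (e ξ)
    rw [h1 ξ] at this
    simpa using this
  simp only [form]
  rw [star_smul, smul_dotProduct, mulVec_smul, dotProduct_smul, smul_smul, h2, one_smul]

/-- If `P₁v ∈ L²_ℋ` whenever `v ∈ L²_ℋ` is the derivative of some `ℋx` with `x ∈ L²_ℋ` and
`(ℋx)(0) = 0`, then `P₁v ∈ L²_ℋ` for all `v ∈ L²_ℋ`: after multiplication by a rapidly oscillating
unimodular function, and up to a small correction, every `v` is such a derivative. -/
lemma memL2_mulVec_of_forall_weakDeriv (hℋ : ℋ.Bounded) {P₁ : Matrix (Fin d) (Fin d) ℂ}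
    (h : ∀ (x : ℋ.L2) (v : ℝ → Fin d → ℂ), IsWeakDeriv (ℋ.mul x) v → ℋ.MemL2 v →
      HasValueAtZero (ℋ.mul x) 0 → ℋ.MemL2 (fun ξ => P₁ *ᵥ v ξ))
    {v : ℝ → Fin d → ℂ} (hv : ℋ.MemL2 v) : ℋ.MemL2 (fun ξ => P₁ *ᵥ v ξ) := by
  obtain ⟨m, hm, hmle⟩ := ℋ.exists_floor_lower_bound
  have hvn : ∀ n : ℕ, IntegrableOn v (Icc (n : ℝ) (n + 1)) := fun n =>
    (hv.integrableOn (n + 1)).mono_set (Icc_subset_Icc_left n.cast_nonneg)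
  set ε : ℕ → ℝ := fun n => min 1 (m n) * (1 / 2) ^ n with hε
  have hmin : ∀ n, 0 < min 1 (m n) := fun n => lt_min one_pos (hm n)
  have hε0 : ∀ n, 0 < ε n := fun n => mul_pos (hmin n) (by positivity)
  have hε1 : ∀ n, ε n ≤ (1 / 2) ^ n := fun n =>
    mul_le_of_le_one_left (by positivity) (min_le_left _ _)
  have hεm : ∀ n, (m n)⁻¹ * ε n ≤ (1 / 2) ^ n := fun n => by
    rw [inv_mul_le_iff₀ (hm n)]
    exact mul_le_mul_of_nonneg_right (min_le_right _ _) (by positivity)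
  choose N hN1 hN2 using fun n : ℕ =>
    exists_integral_fourierChar_small (by linarith : (n : ℝ) ≤ n + 1) (hvn n) (hε0 n)
  set e : ℝ → ℂ := fun ξ => (Real.fourierChar (-(ξ * N ⌊ξ⌋₊)) : ℂ) with he
  have hem : Measurable e := by
    have h1 : Measurable fun ξ : ℝ => N ⌊ξ⌋₊ := measurable_from_nat.comp Nat.measurable_floor
    exact (continuous_subtype_val.comp Real.continuous_fourierChar).measurable.comp
      (measurable_id.mul h1).neg
  have hen : ∀ ξ, ‖e ξ‖ = 1 := fun ξ => Circle.norm_coe _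
  set F : ℕ → ℝ → Fin d → ℂ := fun n ξ =>
    ∫ t in (n : ℝ)..ξ, (Real.fourierChar (-(t * N n)) : ℂ) • v t with hF
  -- The increment of the oscillating primitive over the `n`-th cell. Subtracting it as a constant
  -- on this cell of length one makes the primitive `u` vanish at every integer, so errors do not
  -- accumulate.
  set ρ : ℕ → Fin d → ℂ := fun n => F n (n + 1) with hρ
  have hρle : ∀ n, sqNorm (ρ n) ≤ ε n := hN1
  set r : ℝ → Fin d → ℂ := fun ξ => ρ ⌊ξ⌋₊ with hr
  have hrm : Measurable r := (measurable_from_nat (f := ρ)).comp Nat.measurable_floor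
  have hrL : ℋ.MemL2 r := by
    refine MemL2.of_sqNorm hℋ hrm.aestronglyMeasurable ?_
    have hc : ∀ n : ℕ, EqOn (fun ξ => sqNorm (r ξ)) (fun _ => sqNorm (ρ n)) (Ico (n : ℝ) (n + 1)) :=
      fun n ξ hξ => by simp only [hr, floor_eq_of_mem_Ico hξ]
    refine integrable_semiAxis_of_le_geometric (fun _ => sqNorm_nonneg _) (fun n => ?_) (C := 1)
      fun n => ?_
    · exact (integrableOn_congr_fun (hc n) measurableSet_Ico).2 (integrableOn_const (by simp))
    · rw [setIntegral_congr_fun measurableSet_Ico (hc n), setIntegral_const]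
      simpa using (hρle n).trans (hε1 n)
  set w : ℝ → Fin d → ℂ := fun ξ => e ξ • v ξ - r ξ with hw
  have hevL : ℋ.MemL2 fun ξ => e ξ • v ξ := hv.smul_unimodular hem hen
  have hwL : ℋ.MemL2 w := hevL.sub hrL
  set u : ℝ → Fin d → ℂ := fun ξ => ∫ t in (0 : ℝ)..ξ, w t with hu
  have hup : IsPrimitive u w := ⟨hwL.integrableOn, fun ξ _ => by simp [hu]⟩
  have hstep : ∀ n : ℕ, ∀ ξ ∈ Icc (n : ℝ) (n + 1), u ξ = u n + (F n ξ - (ξ - n) • ρ n) := by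
    intro n ξ hξ
    have hn0 : (0 : ℝ) ≤ n := n.cast_nonneg
    have hi : ∀ {k : ℝ → Fin d → ℂ}, IntegrableOn k (Icc (n : ℝ) (n + 1)) →
        IntervalIntegrable k volume n ξ := fun hk =>
      (intervalIntegrable_iff_integrableOn_Icc_of_le hξ.1).2
        (hk.mono_set (Icc_subset_Icc_right hξ.2))
    have h1 : u ξ = u n + ∫ t in (n : ℝ)..ξ, w t := by
      have h2 := hup.intervalIntegrable hn0
      have h3 := hi ((hwL.integrableOn (n + 1)).mono_set (Icc_subset_Icc_left hn0))
      exact (intervalIntegral.integral_add_adjacent_intervals h2 h3).symm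
    have h4 : ∫ t in (n : ℝ)..ξ, w t =
        ∫ t in (n : ℝ)..ξ, ((Real.fourierChar (-(t * N n)) : ℂ) • v t - ρ n) := by
      refine intervalIntegral.integral_congr_ae ?_
      -- The right endpoint belongs to the next cell; it is a null set.
      have h5 : ∀ᵐ t : ℝ, t ≠ n + 1 := by simp [ae_iff]
      filter_upwards [h5] with t ht0 ht
      rw [uIoc_of_le hξ.1] at ht
      have h6 : ⌊t⌋₊ = n :=
        floor_eq_of_mem_Ico ⟨ht.1.le, lt_of_le_of_ne (ht.2.trans hξ.2) ht0⟩
      simp only [hw, he, hr, h6]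
    rw [h1, h4, intervalIntegral.integral_sub _ (by simp), intervalIntegral.integral_const]
    refine hi ((hvn n).continuousOn_smul (Continuous.continuousOn ?_) isCompact_Icc)
    exact continuous_subtype_val.comp (Real.continuous_fourierChar.comp (by fun_prop))
  have hun : ∀ n : ℕ, u n = 0 := by
    intro n
    induction n with
    | zero => simp [hu]
    | succ n ih =>
      have := hstep n (n + 1) ⟨by linarith, le_rfl⟩
      rw [ih] at this
      push_cast
      rw [this]
      simp [hρ]
  have huc : ContinuousOn u (Ici 0) := hup.continuousOn
  have hFi : ∀ n : ℕ, IntegrableOn (fun ξ => sqNorm (F n ξ)) (Icc (n : ℝ) (n + 1)) := by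
    intro n
    refine ContinuousOn.integrableOn_Icc (continuous_sqNorm.comp_continuousOn ?_)
    have hi : IntegrableOn (fun t => (Real.fourierChar (-(t * N n)) : ℂ) • v t)
        (Icc (n : ℝ) (n + 1)) := by
      refine (hvn n).continuousOn_smul (Continuous.continuousOn ?_) isCompact_Icc
      exact continuous_subtype_val.comp (Real.continuous_fourierChar.comp (by fun_prop))
    rw [← uIcc_of_le (by linarith : (n : ℝ) ≤ n + 1)] at hi ⊢
    exact intervalIntegral.continuousOn_primitive_interval hi
  have hui : Integrable (fun ξ => (m ⌊ξ⌋₊)⁻¹ * sqNorm (u ξ)) semiAxis := by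
    have hc : ∀ n : ℕ, EqOn (fun ξ => (m ⌊ξ⌋₊)⁻¹ * sqNorm (u ξ)) (fun ξ => (m n)⁻¹ * sqNorm (u ξ))
        (Ico (n : ℝ) (n + 1)) := fun n ξ hξ => by simp only [floor_eq_of_mem_Ico hξ]
    have hi : ∀ n : ℕ, IntegrableOn (fun ξ => sqNorm (u ξ)) (Ico (n : ℝ) (n + 1)) := fun n =>
      (ContinuousOn.integrableOn_Icc (continuous_sqNorm.comp_continuousOn (huc.mono
        fun x hx => n.cast_nonneg.trans hx.1))).mono_set Ico_subset_Icc_self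
    refine integrable_semiAxis_of_le_geometric
      (fun ξ => mul_nonneg (inv_nonneg.2 (hm _).le) (sqNorm_nonneg _)) (fun n => ?_) (C := 4)
      fun n => ?_
    · exact (integrableOn_congr_fun (hc n) measurableSet_Ico).2 ((hi n).const_mul _)
    · rw [setIntegral_congr_fun measurableSet_Ico (hc n), integral_const_mul]
      have h1 : ∫ ξ in Ico (n : ℝ) (n + 1), sqNorm (u ξ) ≤
          ∫ ξ in Ico (n : ℝ) (n + 1), (2 * sqNorm (F n ξ) + 2 * sqNorm (ρ n)) := by
        refine setIntegral_mono_on (hi n) ((((hFi n).mono_set Ico_subset_Icc_self).const_mul 2).add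
          (integrableOn_const (by simp))) measurableSet_Ico fun ξ hξ => ?_
        rw [hstep n ξ (Ico_subset_Icc_self hξ), hun, zero_add, sub_eq_add_neg, ← neg_smul,
          ← Complex.coe_smul]
        refine (sqNorm_add_le _ _).trans ?_
        rw [sqNorm_smul, Complex.norm_real, norm_neg]
        have h2 : ‖ξ - n‖ ^ 2 ≤ 1 := by
          rw [Real.norm_of_nonneg (by linarith [hξ.1])]
          exact pow_le_one₀ (by linarith [hξ.1]) (by linarith [hξ.2])
        nlinarith [sqNorm_nonneg (ρ n)]
      have h2 : ∫ ξ in Ico (n : ℝ) (n + 1), (2 * sqNorm (F n ξ) + 2 * sqNorm (ρ n)) ≤ 4 * ε n := by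
        rw [integral_add (((hFi n).mono_set Ico_subset_Icc_self).const_mul 2)
          (integrableOn_const (by simp)), integral_const_mul, setIntegral_const,
          ← integral_Icc_eq_integral_Ico]
        have h3 := hN2 n
        have h4 := hρle n
        simp only [measureReal_def, Real.volume_Ico, add_sub_cancel_left, ENNReal.ofReal_one,
          ENNReal.toReal_one, one_smul]
        linarith
      have h3 := mul_le_mul_of_nonneg_left (h1.trans h2) (inv_nonneg.2 (hm n).le)
      linarith [hεm n]
  obtain ⟨x, hx⟩ := exists_mul_ae_eq hm hmle (huc.aestronglyMeasurable measurableSet_Ici) hui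
  have h1 := h x w (hup.isWeakDeriv hx.symm) hwL ⟨u, huc, hx.symm, by simp [hu]⟩
  have hrL' : ℋ.MemL2 (fun ξ => P₁ *ᵥ r ξ) := by
    refine MemL2.of_sqNorm hℋ (aestronglyMeasurable_const_mulVec P₁ hrm.aestronglyMeasurable)
      (integrable_sqNorm_const_mulVec P₁ hrm.aestronglyMeasurable ?_)
    have hc : ∀ n : ℕ, EqOn (fun ξ => sqNorm (r ξ)) (fun _ => sqNorm (ρ n)) (Ico (n : ℝ) (n + 1)) :=
      fun n ξ hξ => by simp only [hr, floor_eq_of_mem_Ico hξ]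
    refine integrable_semiAxis_of_le_geometric (fun _ => sqNorm_nonneg _) (fun n => ?_) (C := 1)
      fun n => ?_
    · exact (integrableOn_congr_fun (hc n) measurableSet_Ico).2 (integrableOn_const (by simp))
    · rw [setIntegral_congr_fun measurableSet_Ico (hc n), setIntegral_const]
      simpa using (hρle n).trans (hε1 n)
  -- Adding the correction back and multiplying by the conjugate phase recovers `P₁v`, because the
  -- phase is scalar and commutes with `P₁`.
  have h2 := (h1.add hrL').smul_unimodular (e := fun ξ => star (e ξ))
    (Complex.continuous_conj.measurable.comp hem) fun ξ => by rw [norm_star, hen]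
  refine h2.congr (Eventually.of_forall fun ξ => ?_)
  have h3 : star (e ξ) * e ξ = 1 := by
    have := Complex.conj_mul' (e ξ)
    rw [hen ξ] at this
    simpa using this
  simp only [Pi.add_apply, hw, mulVec_sub, sub_add_cancel]
  rw [mulVec_smul, smul_smul, h3, one_smul]

/-- The matrices that act boundedly on `L²_ℋ` by multiplication. -/
def multipliers (ℋ : Hamiltonian d) : Submodule ℂ (Matrix (Fin d) (Fin d) ℂ) where
  carrier := {M | ∀ v, ℋ.MemL2 v → ℋ.MemL2 fun ξ => M *ᵥ v ξ}
  zero_mem' v _ := by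
    simp only [zero_mulVec]
    exact memL2_zero
  add_mem' {M N} hM hN v hv := by
    simp only [add_mulVec]
    exact (hM v hv).add (hN v hv)
  smul_mem' c M hM v hv := by
    simp only [smul_mulVec]
    exact (hM v hv).smul c

/-- Left multiplication by `M` is an injective linear map of the finite-dimensional space of
multipliers into itself, hence onto; a preimage of `1` is the inverse. -/
lemma inv_mem_multipliers {M : Matrix (Fin d) (Fin d) ℂ} (hM : M ∈ multipliers ℋ)
    (hu : IsUnit M) : M⁻¹ ∈ multipliers ℋ := by
  have hdet := (Matrix.isUnit_iff_isUnit_det _).1 hu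
  let L : multipliers ℋ →ₗ[ℂ] multipliers ℋ :=
    { toFun := fun N => ⟨M * N.1, fun v hv => by
        have := hM _ (N.2 v hv)
        simpa only [mulVec_mulVec] using this⟩
      map_add' := fun A B => Subtype.ext (mul_add _ _ _)
      map_smul' := fun c A => Subtype.ext (Matrix.mul_smul _ _ _) }
  have hinj : Function.Injective L := fun A B hAB => by
    have h1 : M * A.1 = M * B.1 := congrArg Subtype.val hAB
    exact Subtype.ext (hu.mul_left_cancel h1)
  have h1 : (1 : Matrix (Fin d) (Fin d) ℂ) ∈ multipliers ℋ := fun v hv => by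
    simpa only [one_mulVec] using hv
  obtain ⟨N, hN⟩ := (LinearMap.injective_iff_surjective.1 hinj) ⟨1, h1⟩
  have h2 : M * N.1 = 1 := congrArg Subtype.val hN
  rw [Matrix.inv_eq_right_inv h2]
  exact N.2

end Hamiltonian

end PortHamiltonian

namespace PortHamiltonian

/-! ### Range of `c - H` for a closed dissipative operator -/

section Range

variable {X : Type*} [NormedAddCommGroup X] [InnerProductSpace ℂ X] [CompleteSpace X]

/-- Dissipativity bounds `c - H` from below, so convergence of images forces convergence of
preimages. A closed graph then makes the range closed, and `horth` excludes a nonzero orthogonal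
complement. -/
lemma exists_smul_sub_eq_of_isClosed_graph {H : X →ₗ.[ℂ] X}
    (hH : ∀ x : H.domain, (inner ℂ (x : X) (H x)).re ≤ 0) (hcl : IsClosed (H.graph : Set (X × X)))
    {c : ℝ} (hc : 0 < c)
    (horth : ∀ y : X, (∀ x : H.domain, inner ℂ ((c : ℂ) • (x : X) - H x) y = 0) → y = 0) (f : X) :
    ∃ x : H.domain, (c : ℂ) • (x : X) - H x = f := by
  let L : H.domain →ₗ[ℂ] X := (c : ℂ) • H.domain.subtype - H.toFun
  have hL : ∀ x, L x = (c : ℂ) • (x : X) - H x := fun x => rfl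
  have hclosed : IsClosed (LinearMap.range L : Set X) := by
    refine IsSeqClosed.isClosed fun u f hu hf => ?_
    choose x hx using hu
    have hdist : ∀ m n, dist (x m : X) (x n) ≤ c⁻¹ * dist (u m) (u n) := by
      intro m n
      have h1 := mul_norm_le_norm_smul_sub (hH (x m - x n)) c
      rw [← hL, map_sub, hx, hx, Submodule.coe_sub] at h1
      rw [dist_eq_norm, dist_eq_norm, le_inv_mul_iff₀ hc]
      exact h1
    have hcau : CauchySeq fun n => (x n : X) := by
      refine Metric.cauchySeq_iff.2 fun ε hε => ?_
      obtain ⟨N, hN⟩ := Metric.cauchySeq_iff.1 hf.cauchySeq (c * ε) (by positivity)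
      refine ⟨N, fun m hm n hn => (hdist m n).trans_lt ?_⟩
      rw [inv_mul_lt_iff₀ hc]
      exact hN m hm n hn
    obtain ⟨z, hz⟩ := cauchySeq_tendsto_of_complete hcau
    have h1 : Tendsto (fun n => ((x n : X), H (x n))) atTop (𝓝 (z, (c : ℂ) • z - f)) := by
      refine hz.prodMk_nhds (((hz.const_smul (c : ℂ)).sub hf).congr fun n => ?_)
      rw [← hx n, hL]
      abel
    have h2 := hcl.mem_of_tendsto h1 (Eventually.of_forall fun n => H.mem_graph (x n))
    obtain ⟨y, hy1, hy2⟩ := (LinearPMap.mem_graph_iff H).1 h2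
    refine ⟨y, ?_⟩
    rw [hL, hy2]
    simp only at hy1
    rw [hy1, sub_sub_cancel]
  have htop : LinearMap.range L = ⊤ := by
    rw [← hclosed.submodule_topologicalClosure_eq, Submodule.topologicalClosure_eq_top_iff,
      Submodule.eq_bot_iff]
    exact fun y hy => horth y fun x => hy _ ⟨x, rfl⟩
  obtain ⟨x, hx⟩ := (LinearMap.range_eq_top.1 htop) f
  exact ⟨x, hx⟩

end Range

/-! ### Linear algebra of the indefinite boundary form -/

section Boundary

variable {p q : ℕ} {lam : Fin p → ℝ} {theta : Fin q → ℝ}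
  {P₁ S : Matrix (Fin (p + q)) (Fin (p + q)) ℂ}

lemma star_dotProduct_mulVec_eq (hP₁S : P₁ = Sᴴ * deltaMatrix lam theta * S)
    (c c' : Fin (p + q) → ℂ) : star c ⬝ᵥ P₁ *ᵥ c' =
      ∑ k, (lam k : ℂ) * (star (prPlus (S *ᵥ c) k) * prPlus (S *ᵥ c') k) -
        ∑ j, (theta j : ℂ) * (star (prMinus (S *ᵥ c) j) * prMinus (S *ᵥ c') j) := by
  have h1 : star c ⬝ᵥ P₁ *ᵥ c' = star (S *ᵥ c) ⬝ᵥ deltaMatrix lam theta *ᵥ (S *ᵥ c') := by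
    rw [hP₁S, star_mulVec, ← mulVec_mulVec, ← mulVec_mulVec, ← dotProduct_mulVec]
  rw [h1, deltaMatrix, dotProduct, Fin.sum_univ_add, sub_eq_add_neg, ← Finset.sum_neg_distrib]
  congr 1
  · refine Finset.sum_congr rfl fun k _ => ?_
    rw [mulVec_diagonal, Fin.append_left]
    simp only [prPlus, Pi.star_apply]
    ring
  · refine Finset.sum_congr rfl fun j _ => ?_
    rw [mulVec_diagonal, Fin.append_right]
    simp only [prMinus, Pi.star_apply, Complex.ofReal_neg]
    ring

lemma re_star_dotProduct_mulVec_self (hP₁S : P₁ = Sᴴ * deltaMatrix lam theta * S)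
    (c : Fin (p + q) → ℂ) : (star c ⬝ᵥ P₁ *ᵥ c).re =
      ∑ k, lam k * ‖prPlus (S *ᵥ c) k‖ ^ 2 - ∑ j, theta j * ‖prMinus (S *ᵥ c) j‖ ^ 2 := by
  have h1 : ∀ (r : ℝ) (z : ℂ), ((r : ℂ) * (star z * z)).re = r * ‖z‖ ^ 2 := by
    intro r z
    rw [show star z * z = ((‖z‖ ^ 2 : ℝ) : ℂ) by rw [Complex.ofReal_pow]; exact Complex.conj_mul' z,
      ← Complex.ofReal_mul, Complex.ofReal_re]
  rw [star_dotProduct_mulVec_eq hP₁S, Complex.sub_re, Complex.re_sum, Complex.re_sum]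
  simp only [h1]

lemma exists_mulVec_eq_append (hS : S ∈ Matrix.unitaryGroup (Fin (p + q)) ℂ) (a : Fin p → ℂ)
    (b : Fin q → ℂ) : ∃ c, prPlus (S *ᵥ c) = a ∧ prMinus (S *ᵥ c) = b := by
  refine ⟨Sᴴ *ᵥ Fin.append a b, ?_⟩
  have h : S * Sᴴ = 1 := Matrix.mem_unitaryGroup_iff.1 hS
  rw [mulVec_mulVec, h, one_mulVec]
  constructor
  · ext k; simp [prPlus]
  · ext j; simp [prMinus]

/-- The subspace of boundary values associated with `T`. -/
def boundarySet (S : Matrix (Fin (p + q)) (Fin (p + q)) ℂ) (T : (Fin q → ℂ) →ₗ[ℂ] (Fin p → ℂ)) :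
    Set (Fin (p + q) → ℂ) := {c | T (prMinus (S *ᵥ c)) = prPlus (S *ᵥ c)}

/-- `boundarySet` as a subspace. -/
def boundarySubmodule (S : Matrix (Fin (p + q)) (Fin (p + q)) ℂ)
    (T : (Fin q → ℂ) →ₗ[ℂ] (Fin p → ℂ)) : Submodule ℂ (Fin (p + q) → ℂ) where
  carrier := boundarySet S T
  add_mem' {c c'} hc hc' := by
    change T (prMinus (S *ᵥ (c + c'))) = prPlus (S *ᵥ (c + c'))
    rw [mulVec_add]
    exact (T.map_add _ _).trans (congrArg₂ (· + ·) hc hc')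
  zero_mem' := by
    change T (prMinus (S *ᵥ 0)) = prPlus (S *ᵥ 0)
    rw [mulVec_zero]
    exact T.map_zero
  smul_mem' a c hc := by
    change T (prMinus (S *ᵥ (a • c))) = prPlus (S *ᵥ (a • c))
    rw [mulVec_smul]
    exact (T.map_smul a _).trans (congrArg (a • ·) hc)

/-- The orthogonal companion of a set of boundary values with respect to the form of `P₁`. -/
def companion (P₁ : Matrix (Fin (p + q)) (Fin (p + q)) ℂ) (V : Set (Fin (p + q) → ℂ)) :
    Set (Fin (p + q) → ℂ) := {c | ∀ c' ∈ V, star c' ⬝ᵥ P₁ *ᵥ c = 0}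

variable {T : (Fin q → ℂ) →ₗ[ℂ] (Fin p → ℂ)}

lemma re_nonpos_of_mem_boundarySet (hP₁S : P₁ = Sᴴ * deltaMatrix lam theta * S)
    (hT : IsWeightedContraction lam theta T) {c : Fin (p + q) → ℂ} (hc : c ∈ boundarySet S T) :
    (star c ⬝ᵥ P₁ *ᵥ c).re ≤ 0 := by
  rw [re_star_dotProduct_mulVec_self hP₁S, ← (show _ = _ from hc)]
  linarith [hT (prMinus (S *ᵥ c))]

/-- Write `Sc = (a, b)`. Pairing with the graph vector `(Tb, b)` gives `‖b‖_Θ² = ⟨Tb, a⟩_Λ`, at most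
the mean of `‖Tb‖_Λ²` and `‖a‖_Λ²`. Contractivity then yields `‖b‖_Θ ≤ ‖a‖_Λ`. -/
lemma re_nonneg_of_mem_companion (hS : S ∈ Matrix.unitaryGroup (Fin (p + q)) ℂ)
    (hP₁S : P₁ = Sᴴ * deltaMatrix lam theta * S) (hlam : ∀ k, 0 < lam k)
    (hT : IsWeightedContraction lam theta T) {c : Fin (p + q) → ℂ}
    (hc : c ∈ companion P₁ (boundarySet S T)) : 0 ≤ (star c ⬝ᵥ P₁ *ᵥ c).re := by
  set a := prPlus (S *ᵥ c) with ha
  set b := prMinus (S *ᵥ c) with hb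
  obtain ⟨c', h1, h2⟩ := exists_mulVec_eq_append hS (T b) b
  have h3 := hc c' (by rw [boundarySet, mem_ofPred_eq, h1, h2])
  have h4 := re_star_dotProduct_mulVec_self hP₁S c
  rw [star_dotProduct_mulVec_eq hP₁S, h1, h2, ← ha, ← hb] at h3
  rw [← ha, ← hb] at h4
  have h5 : ∑ j, (theta j : ℂ) * (star (b j) * b j) = ((∑ j, theta j * ‖b j‖ ^ 2 : ℝ) : ℂ) := by
    rw [Complex.ofReal_sum]
    refine Finset.sum_congr rfl fun j _ => ?_
    rw [Complex.ofReal_mul, Complex.ofReal_pow]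
    congr 1
    exact Complex.conj_mul' _
  rw [h5, sub_eq_zero] at h3
  have h6 : ∑ j, theta j * ‖b j‖ ^ 2 ≤ ∑ k, lam k * (‖T b k‖ * ‖a k‖) := by
    have h7 : ∑ j, theta j * ‖b j‖ ^ 2 ≤ ‖∑ k, (lam k : ℂ) * (star (T b k) * a k)‖ := by
      rw [h3, Complex.norm_real]
      exact le_abs_self _
    refine h7.trans ((norm_sum_le _ _).trans (Finset.sum_le_sum fun k _ => ?_))
    rw [norm_mul, norm_mul, norm_star, Complex.norm_of_nonneg (hlam k).le]
  have h8 : 2 * ∑ k, lam k * (‖T b k‖ * ‖a k‖) ≤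
      ∑ k, lam k * ‖T b k‖ ^ 2 + ∑ k, lam k * ‖a k‖ ^ 2 := by
    rw [Finset.mul_sum, ← Finset.sum_add_distrib]
    refine Finset.sum_le_sum fun k _ => ?_
    nlinarith [mul_nonneg (hlam k).le (sq_nonneg (‖T b k‖ - ‖a k‖))]
  linarith [hT b]

/-- The companion of the graph of `T` contains the vectors `(a', T^*a')`, the adjoint being taken
for the weighted products. With the defect `a' = a - Tb` the pairing equals `‖a'‖_Λ²`, which must
vanish. -/
lemma mem_boundarySet_of_forall (hS : S ∈ Matrix.unitaryGroup (Fin (p + q)) ℂ)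
    (hP₁S : P₁ = Sᴴ * deltaMatrix lam theta * S) (hlam : ∀ k, 0 < lam k)
    (htheta : ∀ j, 0 < theta j) {c : Fin (p + q) → ℂ}
    (hc : ∀ c' ∈ companion P₁ (boundarySet S T), star c' ⬝ᵥ P₁ *ᵥ c = 0) :
    c ∈ boundarySet S T := by
  set a := prPlus (S *ᵥ c) with ha
  set b := prMinus (S *ᵥ c) with hb
  set M := LinearMap.toMatrix' T with hM
  have hTM : ∀ z k, T z k = ∑ j, M k j * z j := fun z k => by
    rw [← LinearMap.toMatrix'_mulVec T z]; rfl
  set a' : Fin p → ℂ := a - T b with ha'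
  -- The weighted adjoint applied to the defect, `Θ⁻¹M^⋆Λa'`.
  set b' : Fin q → ℂ := fun j => (theta j : ℂ)⁻¹ * ∑ k, (lam k : ℂ) * (star (M k j) * a' k) with hb'
  have hθ : ∀ j, (theta j : ℂ) * b' j = ∑ k, (lam k : ℂ) * (star (M k j) * a' k) := fun j =>
    mul_inv_cancel_left₀ (Complex.ofReal_ne_zero.2 (htheta j).ne') _
  have hpair : ∀ z : Fin q → ℂ, ∑ j, (theta j : ℂ) * (star (z j) * b' j) =
      ∑ k, (lam k : ℂ) * (star (T z k) * a' k) := by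
    intro z
    have e1 : ∀ j, (theta j : ℂ) * (star (z j) * b' j) =
        ∑ k, (lam k : ℂ) * (star (M k j * z j) * a' k) := fun j => by
      rw [mul_left_comm, hθ, Finset.mul_sum]
      refine Finset.sum_congr rfl fun k _ => ?_
      rw [star_mul']
      ring
    simp only [e1]
    rw [Finset.sum_comm]
    refine Finset.sum_congr rfl fun k _ => ?_
    rw [hTM, star_sum, Finset.sum_mul, Finset.mul_sum]
  obtain ⟨c', h1, h2⟩ := exists_mulVec_eq_append hS a' b'
  have hc' : c' ∈ companion P₁ (boundarySet S T) := by
    intro z hz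
    rw [star_dotProduct_mulVec_eq hP₁S, h1, h2, hpair, (show _ = _ from hz), sub_self]
  have h3 := hc c' hc'
  have hsym : ∑ j, (theta j : ℂ) * (star (b' j) * b j) =
      ∑ k, (lam k : ℂ) * (star (a' k) * T b k) := by
    have := congrArg star (hpair b)
    rw [star_sum, star_sum] at this
    have e2 : ∀ (r : ℝ) (z w : ℂ), star ((r : ℂ) * (star z * w)) = (r : ℂ) * (star w * z) := by
      intro r z w
      rw [star_mul', star_mul', star_star, show star (r : ℂ) = r from Complex.conj_ofReal r]
      ring
    simpa only [e2] using this
  rw [star_dotProduct_mulVec_eq hP₁S, h1, h2, ← ha, ← hb, hsym, ← Finset.sum_sub_distrib] at h3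
  have h4 : ∑ k, lam k * ‖a' k‖ ^ 2 = 0 := by
    have e3 : ∀ k, (lam k : ℂ) * (star (a' k) * a k) - (lam k : ℂ) * (star (a' k) * T b k) =
        ((lam k * ‖a' k‖ ^ 2 : ℝ) : ℂ) := fun k => by
      rw [← mul_sub, ← mul_sub, Complex.ofReal_mul, Complex.ofReal_pow]
      congr 1
      exact Complex.conj_mul' (a' k)
    simp only [e3] at h3
    exact_mod_cast h3
  have h5 := (Finset.sum_eq_zero_iff_of_nonneg
    (fun k _ => mul_nonneg (hlam k).le (sq_nonneg _))).1 h4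
  change T b = a
  refine (sub_eq_zero.1 (funext fun k => ?_)).symm
  have h6 := h5 k (Finset.mem_univ k)
  rw [mul_eq_zero, or_iff_right (hlam k).ne'] at h6
  change a' k = 0
  simpa using h6

/-- A subspace on which the form of `P₁` is nonpositive is contained in the graph of a
contraction. -/
lemma exists_contraction_of_nonpos (hlam : ∀ k, 0 < lam k) (htheta : ∀ j, 0 < theta j)
    (hS : S ∈ Matrix.unitaryGroup (Fin (p + q)) ℂ) (hP₁S : P₁ = Sᴴ * deltaMatrix lam theta * S)
    (V : Submodule ℂ (Fin (p + q) → ℂ)) (hV : ∀ c ∈ V, (star c ⬝ᵥ P₁ *ᵥ c).re ≤ 0) :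
    ∃ T : (Fin q → ℂ) →ₗ[ℂ] (Fin p → ℂ), IsWeightedContraction lam theta T ∧
      ∀ c ∈ V, c ∈ boundarySet S T := by
  have hle : ∀ c ∈ V, ∑ k, lam k * ‖prPlus (S *ᵥ c) k‖ ^ 2 ≤
      ∑ j, theta j * ‖prMinus (S *ᵥ c) j‖ ^ 2 := fun c hc => by
    have := hV c hc
    rw [re_star_dotProduct_mulVec_self hP₁S] at this
    linarith
  -- Scaling by `√θ` turns the weighted norm into the Euclidean one, for which orthogonal
  -- projections are at hand.
  let ι : (Fin q → ℂ) →ₗ[ℂ] EuclideanSpace ℂ (Fin q) :=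
    { toFun := fun b => WithLp.toLp 2 fun j => (√(theta j) : ℂ) * b j
      map_add' := fun b b' => by ext j; simp [mul_add]
      map_smul' := fun r b => by ext j; simp [mul_left_comm] }
  have hι : ∀ b, ‖ι b‖ ^ 2 = ∑ j, theta j * ‖b j‖ ^ 2 := fun b => by
    rw [EuclideanSpace.norm_sq_eq]
    refine Finset.sum_congr rfl fun j _ => ?_
    change ‖(√(theta j) : ℂ) * b j‖ ^ 2 = _
    rw [norm_mul, mul_pow, Complex.norm_real, Real.norm_of_nonneg (Real.sqrt_nonneg _),
      Real.sq_sqrt (htheta j).le]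
  let plus : V →ₗ[ℂ] (Fin p → ℂ) :=
    { toFun := fun c => prPlus (S *ᵥ (c : Fin (p + q) → ℂ))
      map_add' := fun c c' => by ext k; simp [prPlus, mulVec_add]
      map_smul' := fun r c => by ext k; simp [prPlus, mulVec_smul] }
  let minus : V →ₗ[ℂ] (Fin q → ℂ) :=
    { toFun := fun c => prMinus (S *ᵥ (c : Fin (p + q) → ℂ))
      map_add' := fun c c' => by ext k; simp [prMinus, mulVec_add]
      map_smul' := fun r c => by ext k; simp [prMinus, mulVec_smul] }
  let β : V →ₗ[ℂ] EuclideanSpace ℂ (Fin q) := ι ∘ₗ minus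
  have hβ : ∀ c : V, ‖β c‖ ^ 2 = ∑ j, theta j * ‖prMinus (S *ᵥ (c : Fin (p + q) → ℂ)) j‖ ^ 2 :=
    fun c => hι _
  -- If the minus part vanishes, nonpositivity of the form kills the plus part too; hence `V` is a
  -- graph over its minus parts.
  have hinj : Function.Injective β := by
    refine (injective_iff_map_eq_zero β).2 fun c hc => ?_
    have h1 := hβ c
    rw [hc, norm_zero, zero_pow two_ne_zero] at h1
    have h2 := hle c c.2
    rw [← h1] at h2
    have h3 := (Finset.sum_eq_zero_iff_of_nonneg
      (fun j _ => mul_nonneg (htheta j).le (sq_nonneg _))).1 h1.symm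
    have h4 := (Finset.sum_eq_zero_iff_of_nonneg
      (fun k _ => mul_nonneg (hlam k).le (sq_nonneg _))).1
      (le_antisymm h2 (Finset.sum_nonneg fun k _ => mul_nonneg (hlam k).le (sq_nonneg _)))
    have h5 : S *ᵥ (c : Fin (p + q) → ℂ) = 0 := by
      funext i
      refine Fin.addCases (fun k => ?_) (fun j => ?_) i
      · have := h4 k (Finset.mem_univ k)
        rw [mul_eq_zero, or_iff_right (hlam k).ne'] at this
        simpa [prPlus] using this
      · have := h3 j (Finset.mem_univ j)
        rw [mul_eq_zero, or_iff_right (htheta j).ne'] at this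
        simpa [prMinus] using this
    have h6 : Sᴴ * S = 1 := Matrix.mem_unitaryGroup_iff'.1 hS
    refine Subtype.ext ?_
    rw [← one_mulVec (c : Fin (p + q) → ℂ), ← h6, ← mulVec_mulVec, h5, mulVec_zero]
    rfl
  let e := LinearEquiv.ofInjective β hinj
  let P := (LinearMap.range β).orthogonalProjectionOnto
  -- Project onto the minus parts of `V`, then read off the corresponding plus part. The projection
  -- does not increase the norm, so the bound on `V` persists.
  refine ⟨plus ∘ₗ e.symm.toLinearMap ∘ₗ P.toLinearMap ∘ₗ ι, fun b => ?_, fun c hc => ?_⟩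
  · set c : V := e.symm (P (ι b)) with hc
    have h1 : e c = P (ι b) := e.apply_symm_apply _
    have h2 : β c = (P (ι b) : EuclideanSpace ℂ (Fin q)) := congrArg Subtype.val h1
    have h3 : ‖β c‖ ≤ ‖ι b‖ := by
      rw [h2]
      exact (LinearMap.range β).norm_orthogonalProjectionOnto_apply_le (ι b)
    calc ∑ k, lam k * ‖prPlus (S *ᵥ (c : Fin (p + q) → ℂ)) k‖ ^ 2 ≤ ‖β c‖ ^ 2 :=
          (hle c c.2).trans_eq (hβ c).symm
      _ ≤ ‖ι b‖ ^ 2 := pow_le_pow_left₀ (norm_nonneg _) h3 2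
      _ = _ := hι b
  · have h1 : P (β ⟨c, hc⟩) = e ⟨c, hc⟩ :=
      Submodule.orthogonalProjectionOnto_mem_subspace_eq_self (e ⟨c, hc⟩)
    change plus (e.symm (P (β ⟨c, hc⟩))) = plus ⟨c, hc⟩
    rw [h1, e.symm_apply_apply]

end Boundary

end PortHamiltonian

namespace PortHamiltonian

namespace Hamiltonian

/-! ### Generation and boundary conditions -/

section Operator

variable {d : ℕ} {ℋ : Hamiltonian d} {P₁ P₀ : Matrix (Fin d) (Fin d) ℂ}

lemma two_mul_re_inner (hℋ : ℋ.Bounded) (hP₁ : P₁ᴴ = P₁) {x y : ℋ.L2} {c : Fin d → ℂ}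
    (h : ℋ.HasTrace P₁ x y c) : 2 * (inner ℂ x y).re = - (star c ⬝ᵥ P₁ *ᵥ c).re := by
  have h1 := congrArg Complex.re (h.inner_add_inner hℋ hP₁ h)
  have h2 : (inner ℂ y x).re = (inner ℂ x y).re := inner_re_symm (𝕜 := ℂ) y x
  rw [Complex.add_re, Complex.neg_re, h2] at h1
  linarith

lemma re_inner_mulOp (hℋ : ℋ.Bounded) (hP₀ : P₀ᴴ = -P₀) (x : ℋ.L2) :
    (inner ℂ x (mulOp hℋ P₀ x)).re = 0 := by
  have h1 := congrArg Complex.re (inner_mulOp hℋ hP₀ x x)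
  have h2 : (inner ℂ (mulOp hℋ P₀ x) x).re = (inner ℂ x (mulOp hℋ P₀ x)).re :=
    inner_re_symm (𝕜 := ℂ) _ _
  rw [Complex.neg_re, h2] at h1
  linarith

lemma IsImage.exists_hasTrace (hℋ : ℋ.Bounded) (hP₁u : IsUnit P₁) {x y : ℋ.L2}
    (h : ℋ.IsImage P₁ P₀ x y) : ∃ c, ℋ.HasTrace P₁ x (y - mulOp hℋ P₀ x) c := by
  obtain ⟨v, hv, hy⟩ := h
  refine exists_hasTrace_of_isWeakDeriv hP₁u hv ?_
  filter_upwards [hy, coe_mulOp hℋ P₀ x, L2.coe_sub y (mulOp hℋ P₀ x)] with ξ h1 h2 h3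
  rw [h3, Pi.sub_apply, h1, h2, add_sub_cancel_right]

lemma mem_domain_iff (hP₁u : IsUnit P₁) {Q : Matrix (Fin d) (Fin d) ℂ}
    (hQ : ∀ v : ℝ → Fin d → ℂ, ℋ.MemL2 (fun ξ => Q *ᵥ v ξ) ↔ ℋ.MemL2 (fun ξ => P₁ *ᵥ v ξ))
    {B : (Fin d → ℂ) → Prop} {x : ℋ.L2} :
    x ∈ ℋ.domain Q B ↔ ∃ y c, ℋ.HasTrace P₁ x y c ∧ B c := by
  constructor
  · rintro ⟨⟨v, hv, hvL⟩, c, hc, hB⟩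
    obtain ⟨c', h⟩ := exists_hasTrace_of_isWeakDeriv hP₁u hv (L2.coe_mk _ ((hQ v).1 hvL))
    rw [h.eq_of_hasValueAtZero hc] at hB
    exact ⟨_, c', h, hB⟩
  · rintro ⟨y, c, h, hB⟩
    obtain ⟨v, hv, hy⟩ := h.exists_isWeakDeriv
    exact ⟨⟨v, hv, (hQ v).2 (y.memL2.congr hy)⟩, c, h.hasValueAtZero, hB⟩

/-- The two choices of `Q` define the same domains for the operators in question. -/
lemma memL2_mulVec_iff (hℋ : ℋ.Bounded) (hP₁u : IsUnit P₁) {Q : Matrix (Fin d) (Fin d) ℂ}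
    (hQ : Q = 1 ∨ Q = P₁) {H : ℋ.L2 →ₗ.[ℂ] ℋ.L2}
    (hH : ∀ x : H.domain, ℋ.IsImage P₁ P₀ x (-(H x)))
    (hA : ℋ.domain Q (fun c => c = 0) ⊆ (H.domain : Set ℋ.L2)) (v : ℝ → Fin d → ℂ) :
    ℋ.MemL2 (fun ξ => Q *ᵥ v ξ) ↔ ℋ.MemL2 (fun ξ => P₁ *ᵥ v ξ) := by
  rcases hQ with rfl | rfl
  swap
  · rfl
  -- The inclusion of `D(A)` enters here: for `x ∈ D(A)` the image `Hx` lies in `L²_ℋ`, which forces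
  -- `P₁(ℋx)' ∈ L²_ℋ`.
  have hmem : P₁ ∈ multipliers ℋ := fun v hv => by
    refine memL2_mulVec_of_forall_weakDeriv hℋ (fun x w hw hwL h0 => ?_) hv
    have hx : x ∈ H.domain := hA ⟨⟨w, hw, by simpa only [one_mulVec] using hwL⟩, 0, h0, rfl⟩
    obtain ⟨c, hc⟩ := (hH ⟨x, hx⟩).exists_hasTrace hℋ hP₁u
    exact (L2.memL2 _).congr (hc.ae_eq hw)
  have hinv := inv_mem_multipliers hmem hP₁u
  simp only [one_mulVec]
  refine ⟨hmem v, fun h => ?_⟩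
  have := hinv _ h
  simpa only [mulVec_mulVec, nonsing_inv_mul _ ((Matrix.isUnit_iff_isUnit_det _).1 hP₁u),
    one_mulVec] using this

/-- If the boundary values are those in `V`, and `V` is determined by its companion `V'`, on which
the form of `P₁` is nonnegative, then the operator generates a contraction semigroup. -/
theorem generatesContractionSemigroup_of_domain_eq (hℋ : ℋ.Bounded) (hP₁ : P₁ᴴ = P₁)
    (hP₁u : IsUnit P₁) (hP₀ : P₀ᴴ = -P₀) {H : ℋ.L2 →ₗ.[ℂ] ℋ.L2}
    (hH : ∀ x : H.domain, ℋ.IsImage P₁ P₀ x (-(H x))) {V V' : Set (Fin d → ℂ)}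
    (hdom : ∀ x, x ∈ H.domain ↔ ∃ y c, ℋ.HasTrace P₁ x y c ∧ c ∈ V) (h0 : 0 ∈ V)
    (hV : ∀ c ∈ V, (star c ⬝ᵥ P₁ *ᵥ c).re ≤ 0) (hV' : ∀ c ∈ V', 0 ≤ (star c ⬝ᵥ P₁ *ᵥ c).re)
    (hVV' : ∀ c, c ∈ V' ↔ ∀ c' ∈ V, star c' ⬝ᵥ P₁ *ᵥ c = 0)
    (hV'V : ∀ c, (∀ c' ∈ V', star c' ⬝ᵥ P₁ *ᵥ c = 0) → c ∈ V) :
    GeneratesContractionSemigroup H := by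
  have htr : ∀ x : H.domain, ∃ c ∈ V, ℋ.HasTrace P₁ (x : ℋ.L2) (-(H x) - mulOp hℋ P₀ x) c := by
    intro x
    obtain ⟨c, hc⟩ := (hH x).exists_hasTrace hℋ hP₁u
    obtain ⟨y, c', h1, h2⟩ := (hdom x).1 x.2
    rw [← (hc.unique h1).2] at h2
    exact ⟨c, h2, hc⟩
  have hdiss : ∀ x : H.domain, (inner ℂ (x : ℋ.L2) (H x)).re ≤ 0 := by
    intro x
    obtain ⟨c, hc, h⟩ := htr x
    have h1 := two_mul_re_inner hℋ hP₁ h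
    rw [inner_sub_right, inner_neg_right, Complex.sub_re, Complex.neg_re,
      re_inner_mulOp hℋ hP₀] at h1
    linarith [hV c hc]
  have h0' : (0 : Fin d → ℂ) ∈ V' := (hVV' 0).2 fun c' _ => by rw [mulVec_zero, dotProduct_zero]
  -- The operator is the adjoint of the one with boundary values in `V'`. Membership in the graph
  -- thus becomes a family of continuous equations, and closedness follows.
  have hgraph : (H.graph : Set (ℋ.L2 × ℋ.L2)) = {z | ∀ (x' y' : ℋ.L2), ∀ c' ∈ V',
      ℋ.HasTrace P₁ x' y' c' →
      inner ℂ x' (-z.2) + inner ℂ (mulOp hℋ P₀ x') z.1 + inner ℂ y' z.1 = 0} := by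
    ext ⟨x, h⟩
    simp only [SetLike.mem_coe, mem_ofPred_eq]
    have hrw : ∀ x' y' : ℋ.L2, inner ℂ x' (-h) + inner ℂ (mulOp hℋ P₀ x') x + inner ℂ y' x =
        inner ℂ x' (-h - mulOp hℋ P₀ x) + inner ℂ y' x := fun x' y' => by
      rw [inner_sub_right, inner_mulOp hℋ hP₀, sub_neg_eq_add]
    constructor
    · intro hxh x' y' c' hc' h'
      obtain ⟨z, rfl, rfl⟩ := (LinearPMap.mem_graph_iff H).1 hxh
      obtain ⟨c, hc, h1⟩ := htr z
      rw [hrw, h'.inner_add_inner hℋ hP₁ h1, ← dot_symm hP₁, (hVV' c').1 hc' c hc, star_zero,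
        neg_zero]
    · intro hxh
      obtain ⟨c, h1, h2⟩ := exists_hasTrace_of_forall hℋ hP₁ hP₁u h0'
        (x := x) (z := -h - mulOp hℋ P₀ x) fun x' y' c' hc' h' => by
          rw [← hrw]; exact hxh x' y' c' hc' h'
      have hx : x ∈ H.domain := (hdom x).2 ⟨_, c, h1, hV'V c h2⟩
      obtain ⟨c₂, -, h3⟩ := htr ⟨x, hx⟩
      have h4 := (h3.unique h1).1
      rw [sub_left_inj, neg_inj] at h4
      exact (LinearPMap.mem_graph_iff H).2 ⟨⟨x, hx⟩, rfl, h4⟩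
  have hclosed : IsClosed (H.graph : Set (ℋ.L2 × ℋ.L2)) := by
    rw [hgraph]
    simp only [ofPred_forall]
    refine isClosed_iInter fun x' => isClosed_iInter fun y' => isClosed_iInter fun c' =>
      isClosed_iInter fun _ => isClosed_iInter fun _ => isClosed_eq ?_ continuous_const
    fun_prop
  refine generatesContractionSemigroup_of_dissipative hdiss fun a ha =>
    exists_smul_sub_eq_of_isClosed_graph hdiss hclosed ha fun y hy => ?_
  -- Orthogonality of `y` to the range means `P₁(ℋy)' + P₀ℋy = ay` with boundary value in `V'`.
  -- Green's identity then gives `2a‖y‖² = -Re(c^⋆P₁c) ≤ 0`.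
  obtain ⟨c, h1, h2⟩ := exists_hasTrace_of_forall hℋ hP₁ hP₁u h0
    (x := y) (z := (a : ℂ) • y - mulOp hℋ P₀ y) fun x w c hc hx => by
      have hxD : x ∈ H.domain := (hdom x).2 ⟨w, c, hx, hc⟩
      obtain ⟨c₂, -, h3⟩ := htr ⟨x, hxD⟩
      have h4 := (h3.unique hx).1
      have h5 : (a : ℂ) • x - H ⟨x, hxD⟩ = (a : ℂ) • x + (w + mulOp hℋ P₀ x) := by
        rw [← h4, sub_add_cancel, sub_eq_add_neg]
      have h6 := hy ⟨x, hxD⟩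
      rw [h5, inner_add_left, inner_add_left, inner_smul_left] at h6
      rw [inner_sub_right, inner_smul_right, inner_mulOp hℋ hP₀, ← h6,
        show (starRingEnd ℂ) (a : ℂ) = a from Complex.conj_ofReal a]
      ring
  have h3 := two_mul_re_inner hℋ hP₁ h1
  rw [inner_sub_right, Complex.sub_re, re_inner_smul_self, re_inner_mulOp hℋ hP₀] at h3
  have h4 := hV' c ((hVV' c).2 h2)
  have h5 : ‖y‖ ^ 2 ≤ 0 := by
    by_contra! h6
    nlinarith [mul_pos ha h6]
  simpa using le_antisymm h5 (by positivity)

/-- The boundary values of the elements of the domain of an operator. -/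
def boundaryValues (P₁ : Matrix (Fin d) (Fin d) ℂ) (H : ℋ.L2 →ₗ.[ℂ] ℋ.L2) :
    Submodule ℂ (Fin d → ℂ) where
  carrier := {c | ∃ x ∈ H.domain, ∃ y, ℋ.HasTrace P₁ x y c}
  add_mem' := by
    rintro c c' ⟨x, hx, y, h⟩ ⟨x', hx', y', h'⟩
    exact ⟨x + x', H.domain.add_mem hx hx', y + y', h.add h'⟩
  zero_mem' := by
    refine ⟨0, H.domain.zero_mem, 0, 0, 0, ⟨fun R => integrableOn_zero, fun ξ _ => by simp⟩,
      ?_, ?_, rfl⟩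
    · filter_upwards [mul_smul_ae (0 : ℂ) (0 : ℋ.L2)] with ξ h
      rw [zero_smul] at h
      rw [h, zero_smul, Pi.zero_apply]
    · filter_upwards [L2.coe_smul (0 : ℂ) (0 : ℋ.L2)] with ξ h
      rw [zero_smul] at h
      rw [h, zero_smul, Pi.zero_apply, mulVec_zero]
  smul_mem' := by
    rintro a c ⟨x, hx, y, h⟩
    exact ⟨a • x, H.domain.smul_mem a hx, a • y, h.smul a⟩

/-- A generator is maximal among the dissipative operators given by boundary conditions. -/
theorem mem_domain_of_generates (hℋ : ℋ.Bounded) (hP₁ : P₁ᴴ = P₁) (hP₁u : IsUnit P₁)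
    (hP₀ : P₀ᴴ = -P₀) {H : ℋ.L2 →ₗ.[ℂ] ℋ.L2} (hH : ∀ x : H.domain, ℋ.IsImage P₁ P₀ x (-(H x)))
    (hgen : GeneratesContractionSemigroup H) {V : Submodule ℂ (Fin d → ℂ)}
    (hV : ∀ c ∈ V, (star c ⬝ᵥ P₁ *ᵥ c).re ≤ 0) (hle : boundaryValues P₁ H ≤ V)
    {x y : ℋ.L2} {c : Fin d → ℂ} (h : ℋ.HasTrace P₁ x y c) (hc : c ∈ V) : x ∈ H.domain := by
  -- The right side is `x` minus the maximal operator applied to `x`. So `e = x - z` has its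
  -- boundary value in `V` and equals its own image under the maximal operator; dissipativity on `V`
  -- forces `e = 0`.
  obtain ⟨z, hz⟩ := hgen.exists_sub_eq (x + y + mulOp hℋ P₀ x)
  obtain ⟨c₂, h2⟩ := (hH z).exists_hasTrace hℋ hP₁u
  have hc₂ : c₂ ∈ V := hle ⟨z, z.2, _, h2⟩
  have h3 := h.add (h2.smul (-1))
  set e : ℋ.L2 := x + (-1 : ℂ) • (z : ℋ.L2) with he
  have h4 : y + (-1 : ℂ) • (-(H z) - mulOp hℋ P₀ z) = -e - mulOp hℋ P₀ e := by
    have h5 : H z = (z : ℋ.L2) - (x + y + mulOp hℋ P₀ x) := by rw [← hz]; abel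
    rw [he, mulOp_add, mulOp_smul, h5]
    simp only [neg_one_smul]
    abel
  rw [h4] at h3
  have h5 := two_mul_re_inner hℋ hP₁ h3
  have h6 := hV _ (V.add_mem hc (V.smul_mem (-1) hc₂))
  have h7 : (inner ℂ e e).re = ‖e‖ ^ 2 := inner_self_eq_norm_sq (𝕜 := ℂ) e
  rw [inner_sub_right, inner_neg_right, Complex.sub_re, Complex.neg_re, re_inner_mulOp hℋ hP₀,
    h7] at h5
  have h8 : ‖e‖ ^ 2 = 0 := le_antisymm (by linarith) (by positivity)
  have h9 : e = 0 := by simpa using h8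
  have h10 : x = z := by
    rw [he, neg_one_smul, ← sub_eq_add_neg] at h9
    exact sub_eq_zero.1 h9
  rw [h10]
  exact z.2

/-- Green's identity reads `2 Re⟨x, Hx⟩ = Re(c^⋆P₁c)` on the domain, and a generator is dissipative.
-/
lemma re_nonpos_of_mem_boundaryValues (hℋ : ℋ.Bounded) (hP₁ : P₁ᴴ = P₁) (hP₁u : IsUnit P₁)
    (hP₀ : P₀ᴴ = -P₀) {H : ℋ.L2 →ₗ.[ℂ] ℋ.L2} (hH : ∀ x : H.domain, ℋ.IsImage P₁ P₀ x (-(H x)))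
    (hgen : GeneratesContractionSemigroup H) {c : Fin d → ℂ} (hc : c ∈ boundaryValues P₁ H) :
    (star c ⬝ᵥ P₁ *ᵥ c).re ≤ 0 := by
  obtain ⟨x, hx, y, h⟩ := hc
  obtain ⟨c', h'⟩ := (hH ⟨x, hx⟩).exists_hasTrace hℋ hP₁u
  have h1 := two_mul_re_inner hℋ hP₁ h'
  rw [inner_sub_right, inner_neg_right, Complex.sub_re, Complex.neg_re,
    re_inner_mulOp hℋ hP₀] at h1
  have h2 := hgen.re_inner_nonpos ⟨x, hx⟩
  rw [(h.unique h').2]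
  linarith

end Operator

end Hamiltonian

end PortHamiltonian

end

theorem theorem5p2 {p q : ℕ} (hd : 1 ≤ p + q)
    (ℋ : PortHamiltonian.Hamiltonian (p + q)) (hℋ : ℋ.Bounded)
    (P₁ P₀ S : Matrix (Fin (p + q)) (Fin (p + q)) ℂ)
    (hP₁ : P₁ᴴ = P₁) (hP₁u : IsUnit P₁) (hP₀ : P₀ᴴ = -P₀)
    (lam : Fin p → ℝ) (theta : Fin q → ℝ) (hlam : ∀ k, 0 < lam k) (htheta : ∀ j, 0 < theta j)
    (hS : S ∈ Matrix.unitaryGroup (Fin (p + q)) ℂ)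
    (hP₁S : P₁ = Sᴴ * PortHamiltonian.deltaMatrix lam theta * S)
    (Q : Matrix (Fin (p + q)) (Fin (p + q)) ℂ) (hQ : Q = 1 ∨ Q = P₁)
    (H : ℋ.L2 →ₗ.[ℂ] ℋ.L2)
    (hH : ∀ x : H.domain, ℋ.IsImage P₁ P₀ x (-(H x)))
    (hA : ℋ.domain Q (fun c => c = 0) ⊆ (H.domain : Set ℋ.L2)) :
    PortHamiltonian.GeneratesContractionSemigroup H ↔
      ∃ T : (Fin q → ℂ) →ₗ[ℂ] (Fin p → ℂ), PortHamiltonian.IsWeightedContraction lam theta T ∧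
        (H.domain : Set ℋ.L2) = ℋ.domain Q (fun c =>
          T (PortHamiltonian.prMinus (S *ᵥ c)) = PortHamiltonian.prPlus (S *ᵥ c)) := by
  have hQ' := PortHamiltonian.Hamiltonian.memL2_mulVec_iff hℋ hP₁u hQ hH hA
  constructor
  · intro hgen
    obtain ⟨T, hT, hVT⟩ := PortHamiltonian.exists_contraction_of_nonpos hlam htheta hS hP₁S
      (PortHamiltonian.Hamiltonian.boundaryValues P₁ H) fun c hc =>
        PortHamiltonian.Hamiltonian.re_nonpos_of_mem_boundaryValues hℋ hP₁ hP₁u hP₀ hH hgen hc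
    refine ⟨T, hT, Set.Subset.antisymm (fun x hx => ?_) (fun x hx => ?_)⟩
    · obtain ⟨c, hc⟩ := (hH ⟨x, hx⟩).exists_hasTrace hℋ hP₁u
      exact (PortHamiltonian.Hamiltonian.mem_domain_iff hP₁u hQ').2
        ⟨_, c, hc, hVT c ⟨x, hx, _, hc⟩⟩
    -- The boundary values of `H` need not a priori fill the graph of `T`; maximality of the
    -- generator shows that the larger domain adds nothing.
    · obtain ⟨y, c, h, hc⟩ := (PortHamiltonian.Hamiltonian.mem_domain_iff hP₁u hQ').1 hx
      exact PortHamiltonian.Hamiltonian.mem_domain_of_generates hℋ hP₁ hP₁u hP₀ hH hgen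
        (V := PortHamiltonian.boundarySubmodule S T)
        (fun c hc => PortHamiltonian.re_nonpos_of_mem_boundarySet hP₁S hT hc) hVT h hc
  · rintro ⟨T, hT, hdom⟩
    -- The companion of the graph of `T` supplies the boundary conditions of the adjoint problem.
    refine PortHamiltonian.Hamiltonian.generatesContractionSemigroup_of_domain_eq hℋ hP₁ hP₁u hP₀ hH
      (V := PortHamiltonian.boundarySet S T)
      (V' := PortHamiltonian.companion P₁ (PortHamiltonian.boundarySet S T)) (fun x => ?_)
      (PortHamiltonian.boundarySubmodule S T).zero_mem
      (fun c hc => PortHamiltonian.re_nonpos_of_mem_boundarySet hP₁S hT hc)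
      (fun c hc => PortHamiltonian.re_nonneg_of_mem_companion hS hP₁S hlam hT hc)
      (fun c => Iff.rfl)
      (fun c hc => PortHamiltonian.mem_boundarySet_of_forall hS hP₁S hlam htheta hc)
    rw [← SetLike.mem_coe, hdom]
    exact PortHamiltonian.Hamiltonian.mem_domain_iff hP₁u hQ'
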